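/- Let $\gamma$ be the standard Gaussian measure on $\mathbb R^n$. For a probability measure $\mu$ on $\mathbb R^n$ with density $f=d\mu/d\gamma$, let $H(\mu\mid\gamma)=\int\log f\,d\mu$ be the relative entropy, $I(\mu\mid\gamma)=\int|\nabla\log f|^2\,d\mu$ the relative Fisher information (where $\nabla\log f=\nabla f/f$ and $\nabla f$ is the weak gradient of $f$; $I(\mu\mid\gamma)=+\infty$ if $\mu$ is not absolutely continuous or $f$ has no locally integrable weak gradient), and let $$\delta(\mu)=\tfrac12 I(\mu\mid\gamma)-H(\mu\mid\gamma)$$ be the log-Sobolev deficit, with $\delta(\mu)=+\infty$ when $I(\mu\mid\gamma)=+\infty$. **Theorem 1.3.** Let $\mu$ be a probability measure on $\mathbb R^n$ with finite second moment, and let $\lambda_1,\dots,\lambda_n$ be the eigenvalues, counted with multiplicity, of its covariance matrix $\mathrm{cov}(\mu)$. With the convention that $\lambda^{-1}-1+\log\lambda=+\infty$ for $\lambda=0$, $$\delta(\mu)\ \ge\ \frac12\sum_{i=1}^n \mathbf 1_{\{\lambda_i<1\}}\left(\lambda_i^{-1}-1+\log\lambda_i\right).$$ In particular, if $\mathrm{cov}(\mu)\preceq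 \mathrm{Id}_n$, then $$\delta(\mu)\ \ge\ \frac12\sum_{i=1}^n\left(\lambda_i^{-1}-1+\log\lambda_i\right)=\delta(\gamma_\lambda)$$ for every Gaussian measure $\gamma_\lambda$ on $\mathbb R^n$ having the same covariance matrix as $\mu$ (and such Gaussian measures exist). On the other hand, this fails without the hypothesis $\mathrm{cov}(\mu)\preceq \mathrm{Id}_n$, even in dimension $1$: there is a sequence $(\mu_k)$ of finite mixtures of nondegenerate Gaussian measures on $\mathbb R$ such that $\mathrm{var}(\mu_k)\to\infty$ while $\delta(\mu_k)\to0$; in particular $\delta(\mu_k)<\frac12\left(\mathrm{var}(\mu_k)^{-1}-1+\log\mathrm{var}(\mu_k)\right)$ for all large $k$. -/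

import Mathlib

open MeasureTheory ProbabilityTheory Filter Topology
open scoped ENNReal NNReal ContDiff

noncomputable section

namespace LogSobolev

section Deficit

variable {E : Type*} [NormedAddCommGroup E] [InnerProductSpace ℝ E] [FiniteDimensional ℝ E]
  [MeasurableSpace E] [BorelSpace E]

/-- `G` is the weak gradient of the function `f` on the Euclidean space `E`: both are locally
Lebesgue integrable, and `∫ f ∂ᵥφ dx = - ∫ φ ⟨G, v⟩ dx` for every smooth compactly supported `φ`
and every direction `v`. -/
def HasWeakGradient (f : E → ℝ) (G : E → E) : Prop :=
  LocallyIntegrable f volume ∧ LocallyIntegrable G volume ∧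
    ∀ φ : E → ℝ, ContDiff ℝ ∞ φ → HasCompactSupport φ → ∀ v : E,
      ∫ x, f x * fderiv ℝ φ x v = - ∫ x, φ x * inner ℝ (G x) v

/-- The density `dμ/dγ` of `μ` with respect to the standard Gaussian measure `γ` on `E`. -/
def gaussianDensity (μ : Measure E) : E → ℝ :=
  fun x => (μ.rnDeriv (stdGaussian E) x).toReal

/-- The relative Fisher information `I(μ | γ) = ∫ |∇ log f|² dμ`, where `f = dμ/dγ` and
`∇ log f = ∇f / f` with `∇f` the weak gradient of `f`. A weak gradient is unique up to Lebesgue-null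
sets, so the infimum is over a family on which the integral is constant. It is over the empty
family, and hence `I(μ | γ) = ∞`, when `μ` is not absolutely continuous with respect to `γ` or
its density has no weak gradient. -/
def fisherInfo (μ : Measure E) : ℝ≥0∞ :=
  ⨅ (G : E → E) (_ : μ ≪ stdGaussian E ∧ HasWeakGradient (gaussianDensity μ) G),
    ∫⁻ x, ‖(gaussianDensity μ x)⁻¹ • G x‖ₑ ^ 2 ∂μ

open Classical in
/-- The log-Sobolev deficit `δ(μ) = ½ I(μ | γ) - H(μ | γ)`, where `H(μ | γ) = ∫ log (dμ/dγ) dμ` is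
the relative entropy (Kullback-Leibler divergence); `δ(μ) = +∞` when `I(μ | γ) = ∞`. -/
def deficit (μ : Measure E) : EReal :=
  if fisherInfo μ = ⊤ then ⊤
  else ((1 / 2 : ℝ) : EReal) * ((fisherInfo μ : ℝ≥0∞) : EReal)
    - ((InformationTheory.klDiv μ (stdGaussian E) : ℝ≥0∞) : EReal)

end Deficit

/-- The covariance matrix of a measure on `ℝⁿ`. -/
def covMatrix {n : ℕ} (μ : Measure (EuclideanSpace ℝ (Fin n))) : Matrix (Fin n) (Fin n) ℝ :=
  Matrix.of fun i j => cov[fun x => x i, fun x => x j; μ]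

lemma isHermitian_covMatrix {n : ℕ} (μ : Measure (EuclideanSpace ℝ (Fin n))) :
    (covMatrix μ).IsHermitian := by
  ext i j
  simp [covMatrix, covariance_comm]

/-- The eigenvalues `λ₁, …, λₙ` (with multiplicity) of the covariance matrix of `μ`. -/
def covEigenvalues {n : ℕ} (μ : Measure (EuclideanSpace ℝ (Fin n))) : Fin n → ℝ :=
  (isHermitian_covMatrix μ).eigenvalues

open Classical in
/-- The quantity `l⁻¹ - 1 + log l` for `l ≥ 0`, equal to its limit `+∞` at `l = 0`. -/
def eigenTerm (l : ℝ) : EReal :=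
  if l = 0 then ⊤ else ((l⁻¹ - 1 + Real.log l : ℝ) : EReal)

/-- `μ` is a finite mixture (convex combination) of nondegenerate Gaussian measures on `ℝ`. -/
def IsGaussianMixture (μ : Measure ℝ) : Prop :=
  ∃ (m : ℕ) (w : Fin m → ℝ≥0) (a : Fin m → ℝ) (s : Fin m → ℝ≥0),
    ∑ j, w j = 1 ∧ (∀ j, s j ≠ 0) ∧ μ = ∑ j, w j • gaussianReal (a j) (s j)

end LogSobolev

end

open LogSobolev

/-! Let u = U - x, where U = ∇ log (dμ/dγ); thus u is the score of μ relative to Lebesgue measure.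
In an orthonormal basis diagonalising the covariance, put J_i = ∫ ⟨b_i, u⟩² dμ and m_i = ∫ ⟨b_i, x⟩²
dμ. Since ∫ ⟨b_i, u⟩⟨b_i, x⟩ dμ = -1, the Fisher information is I(μ | γ) = ∑ (J_i - 2 + m_i).

The logarithmic Sobolev inequality is applied not to μ but to its image under the diagonal
stretching S = diag(s_i). Both the information and the entropy of S_*μ are explicit: the former is ∑
(J_i / s_i² - 2 + s_i² m_i), the latter is H(μ | γ) - ∑ log s_i + ½ ∑ (s_i² - 1) m_i. The second
moments cancel, leaving δ(μ) ≥ ½ ∑ ((1 - s_i⁻²) J_i - 2 log s_i). For λ_i < 1 take s_i = λ_i^{-1/2},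
otherwise s_i = 1. Cramér–Rao, J_i ≥ 1 / λ_i, then yields λ_i⁻¹ - 1 + log λ_i for each i with λ_i <
1. It also shows that finite information excludes λ_i = 0. This is `IsScore.klDiv_add_le`, resting
on `IsScore.dual_bound` and `IsScore.one_le_mul_variance`.

The logarithmic Sobolev inequality is proved along Gross's route: the two-point inequality,
tensorisation over random signs, the central limit theorem. It is kept in the dual form ∫ g dμ ≤ ½ I
+ log ∫ e^g dγ, which is stable under limits and changes of variables. A measure with a square
integrable score is reached by mollification (`IsScore.logSobolev`), and the dual bound is turned
into an entropy bound in `klDiv_le_of_dual_bound`. To see that ∇f / f is a score when f may vanish,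
one needs the weak gradient to vanish almost everywhere on {f = 0}
(`HasWeakGradient.ae_eq_zero_of_eq_zero`).

For Gaussians the explicit upper bound on the deficit meets the general lower bound. For the failure
at large variance, (1 - ε) N(0, 1) + ε N(a, 1) has deficit at most the binary entropy of ε whatever
a is, while its variance is 1 + ε(1 - ε)a². Taking ε = 1 / a with a → ∞ separates the two. -/

noncomputable section

namespace LogSobolev

/-! ### The logarithmic Sobolev inequality on two points -/

section TwoPoint

/-- `2 log y ≤ y - y⁻¹` for `y ≥ 1`. -/
lemma two_mul_log_le_sub_inv {y : ℝ} (hy : 1 ≤ y) : 2 * Real.log y ≤ y - y⁻¹ := by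
  have hd : ∀ x ∈ Set.Ioi (0 : ℝ), HasDerivAt (fun y : ℝ => y - y⁻¹ - 2 * Real.log y)
      (1 - (-(x ^ 2)⁻¹) - 2 * x⁻¹) x := by
    intro x hx
    have hx0 : x ≠ 0 := (Set.mem_Ioi.1 hx).ne'
    exact ((hasDerivAt_id x).sub (hasDerivAt_inv hx0)).sub ((Real.hasDerivAt_log hx0).const_mul 2)
  have hmono : MonotoneOn (fun y : ℝ => y - y⁻¹ - 2 * Real.log y) (Set.Ioi 0) := by
    apply monotoneOn_of_deriv_nonneg (convex_Ioi 0)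
    · exact fun x hx => (hd x hx).continuousAt.continuousWithinAt
    · exact fun x hx => (hd x (interior_subset hx)).differentiableAt.differentiableWithinAt
    · intro x hx
      rw [(hd x (interior_subset hx)).deriv]
      have : 1 - (-(x ^ 2)⁻¹) - 2 * x⁻¹ = (1 - x⁻¹) ^ 2 := by rw [inv_pow x 2 |>.symm]; ring
      rw [this]; positivity
  have h := hmono (Set.mem_Ioi.2 one_pos) (Set.mem_Ioi.2 (one_pos.trans_le hy)) hy
  simp only [inv_one, Real.log_one] at h
  linarith

/-- `e^b + e^{-b/(1-b)} ≥ 2` on `[0, 1)`. -/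
lemma two_le_exp_add_exp {b : ℝ} (h0 : 0 ≤ b) (h1 : b < 1) :
    2 ≤ Real.exp b + Real.exp (-(b / (1 - b))) := by
  have hd : ∀ x ∈ Set.Ico (0 : ℝ) 1, HasDerivAt
      (fun b : ℝ => Real.exp b + Real.exp (-(b / (1 - b))))
      (Real.exp x + Real.exp (-(x / (1 - x))) * -((1 * (1 - x) - x * (-1)) / (1 - x) ^ 2)) x := by
    intro x hx
    have hx0 : 1 - x ≠ 0 := by linarith [hx.2]
    exact (Real.hasDerivAt_exp x).add
      ((((hasDerivAt_id x).div ((hasDerivAt_id x).const_sub 1) hx0).neg).exp)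
  have hmono : MonotoneOn (fun b : ℝ => Real.exp b + Real.exp (-(b / (1 - b)))) (Set.Ico 0 1) := by
    apply monotoneOn_of_deriv_nonneg (convex_Ico 0 1)
    · exact fun x hx => (hd x hx).continuousAt.continuousWithinAt
    · exact fun x hx => (hd x (interior_subset hx)).differentiableAt.differentiableWithinAt
    · intro x hx
      have hx' := interior_subset hx
      rw [(hd x hx').deriv]
      have hp : 0 < 1 - x := by linarith [hx'.2]
      -- With y = (1 - x)⁻¹ one has x = 1 - y⁻¹ and x / (1 - x) = y - 1, so nonnegativity of the
      -- derivative is exactly 2 log y ≤ y - y⁻¹.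
      have hlog := two_mul_log_le_sub_inv (y := (1 - x)⁻¹)
        ((one_le_inv₀ hp).2 (by linarith [hx'.1]))
      rw [Real.log_inv, inv_inv] at hlog
      have hfrac : x / (1 - x) = (1 - x)⁻¹ - 1 := by field_simp; ring
      have hle : Real.exp (-(x / (1 - x))) ≤ Real.exp x * (1 - x) ^ 2 := by
        rw [← Real.exp_log (by positivity : 0 < (1 - x) ^ 2), ← Real.exp_add, Real.exp_le_exp,
          Real.log_pow, hfrac]
        push_cast
        linarith
      have : 1 * (1 - x) - x * (-1) = 1 := by ring
      rw [this]
      have : Real.exp (-(x / (1 - x))) * (1 / (1 - x) ^ 2) ≤ Real.exp x := by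
        rw [mul_one_div, div_le_iff₀ (by positivity)]; exact hle
      linarith
  have h := hmono (by simp) (Set.mem_Ico.2 ⟨h0, h1⟩) h0
  simp only [Real.exp_zero, zero_div, neg_zero] at h
  linarith

/-- These are the positivity conditions on the matrix with diagonal (1 - u, 1 - v) and off-diagonal
entries -1. The determinant condition says v ≤ -u / (1 - u), which follows from e^v = 2 - e^u ≤
e^{-u/(1-u)}. -/
lemma two_point_aux {u v : ℝ} (h : Real.exp u + Real.exp v = 2) (huv : v ≤ u) :
    0 ≤ u ∧ u < 1 ∧ 1 ≤ (1 - u) * (1 - v) := by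
  have hu : 0 ≤ u := by
    by_contra! hlt
    have := Real.exp_lt_exp.2 hlt
    have := Real.exp_lt_exp.2 (huv.trans_lt hlt)
    rw [Real.exp_zero] at *
    linarith
  have hu1 : u < 1 := by
    have h2 : Real.exp u < Real.exp 1 := by
      linarith [Real.exp_pos v, Real.exp_one_gt_d9]
    exact Real.exp_lt_exp.1 h2
  refine ⟨hu, hu1, ?_⟩
  have h3 := two_le_exp_add_exp hu hu1
  have h4 : Real.exp v ≤ Real.exp (-(u / (1 - u))) := by linarith
  rw [Real.exp_le_exp] at h4
  have hp : 0 < 1 - u := by linarith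
  have h5 : 1 + u / (1 - u) ≤ 1 - v := by linarith
  have h6 : 1 + u / (1 - u) = (1 - u)⁻¹ := by field_simp; ring
  rw [h6] at h5
  calc (1 : ℝ) = (1 - u) * (1 - u)⁻¹ := by field_simp
    _ ≤ _ := by gcongr

/-- The difference of the two sides is the quadratic form (1 - u)p² - 2pq + (1 - v)q², which
`two_point_aux` makes positive semidefinite. -/
lemma two_point_normalized {u v : ℝ} (h : Real.exp u + Real.exp v = 2) (p q : ℝ) :
    u * p ^ 2 + v * q ^ 2 ≤ (p - q) ^ 2 := by
  wlog huv : v ≤ u generalizing u v p q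
  · have := this (by linarith) q p (not_le.1 huv).le
    nlinarith
  obtain ⟨_, hu1, hmul⟩ := two_point_aux h huv
  have hp : 0 < 1 - u := by linarith
  have : 0 ≤ (1 - u) * ((1 - u) * p ^ 2 - 2 * p * q + (1 - v) * q ^ 2) := by
    nlinarith [sq_nonneg ((1 - u) * p - q), sq_nonneg q]
  have := nonneg_of_mul_nonneg_right this hp
  linarith

/-- The logarithmic Sobolev inequality on the two-point space, in dual form. -/
lemma two_point_logSobolev (u v p q : ℝ) :
    2⁻¹ * (u * p ^ 2) + 2⁻¹ * (v * q ^ 2) ≤ 2⁻¹ * (p - q) ^ 2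
      + (2⁻¹ * p ^ 2 + 2⁻¹ * q ^ 2) * Real.log (2⁻¹ * Real.exp u + 2⁻¹ * Real.exp v) := by
  -- Subtracting l from u and v normalises the mean of the exponentials to 1 and changes both sides
  -- by the same amount.
  set l := Real.log (2⁻¹ * Real.exp u + 2⁻¹ * Real.exp v) with hl
  have hexp : Real.exp l = 2⁻¹ * Real.exp u + 2⁻¹ * Real.exp v :=
    Real.exp_log (by positivity)
  have h : Real.exp (u - l) + Real.exp (v - l) = 2 := by
    rw [Real.exp_sub, Real.exp_sub, ← add_div, div_eq_iff (Real.exp_pos l).ne', hexp]; ring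
  have := two_point_normalized h p q
  nlinarith

end TwoPoint

/-! ### Tensorisation: sums of independent random signs -/

section Cube

variable {E : Type*} [NormedAddCommGroup E] [MeasurableSpace E] [BorelSpace E]

/-- The law of `∑ ε_c • c` over the entries `c` of a list, for independent random signs `ε_c`. -/
def signSum : List E → Measure E
  | [] => Measure.dirac 0
  | c :: l => (2⁻¹ : ℝ≥0∞) • (signSum l).map (fun x => x + c)
      + (2⁻¹ : ℝ≥0∞) • (signSum l).map (fun x => x - c)

instance isProbabilityMeasure_signSum (l : List E) : IsProbabilityMeasure (signSum l) := by
  induction l with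
  | nil => rw [signSum]; infer_instance
  | cons c l ih =>
    constructor
    have h1 : IsProbabilityMeasure ((signSum l).map (fun x => x + c)) :=
      Measure.isProbabilityMeasure_map (by fun_prop)
    have h2 : IsProbabilityMeasure ((signSum l).map (fun x => x - c)) :=
      Measure.isProbabilityMeasure_map (by fun_prop)
    simp [signSum, ENNReal.inv_two_add_inv_two]

lemma integrable_signSum {F : Type*} [NormedAddCommGroup F] [SecondCountableTopologyEither E F]
    (l : List E) {f : E → F} (hf : Continuous f) : Integrable f (signSum l) := by
  induction l generalizing f with
  | nil =>
    rw [signSum]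
    exact integrable_dirac' (hf.stronglyMeasurable) (by simp)
  | cons c l ih =>
    rw [signSum]
    refine Integrable.add_measure (Integrable.smul_measure ?_ (by simp))
      (Integrable.smul_measure ?_ (by simp))
    · rw [integrable_map_measure hf.aestronglyMeasurable (by fun_prop)]
      exact ih (by fun_prop)
    · rw [integrable_map_measure hf.aestronglyMeasurable (by fun_prop)]
      exact ih (by fun_prop)

lemma integral_signSum_cons {F : Type*} [NormedAddCommGroup F] [NormedSpace ℝ F]
    [SecondCountableTopologyEither E F] (c : E) (l : List E) {f : E → F} (hf : Continuous f) :
    ∫ x, f x ∂(signSum (c :: l)) =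
      (2⁻¹ : ℝ) • ∫ x, f (x + c) ∂(signSum l) + (2⁻¹ : ℝ) • ∫ x, f (x - c) ∂(signSum l) := by
  have h1 : Integrable f ((signSum l).map (fun x => x + c)) := by
    rw [integrable_map_measure hf.aestronglyMeasurable (by fun_prop)]
    exact integrable_signSum l (by fun_prop)
  have h2 : Integrable f ((signSum l).map (fun x => x - c)) := by
    rw [integrable_map_measure hf.aestronglyMeasurable (by fun_prop)]
    exact integrable_signSum l (by fun_prop)
  rw [signSum, integral_add_measure (h1.smul_measure (by simp)) (h2.smul_measure (by simp)),
    integral_smul_measure, integral_smul_measure,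
    integral_map (by fun_prop) hf.aestronglyMeasurable,
    integral_map (by fun_prop) hf.aestronglyMeasurable]
  simp

/-- The increment of `φ` between `y - c` and `y + c`, controlled by the derivative of `φ` at a
nearby point. -/
lemma sq_sub_le_of_lipschitz_fderiv {E : Type*} [NormedAddCommGroup E] [NormedSpace ℝ E] {φ : E → ℝ} (hφ : ContDiff ℝ 1 φ)
    {L : ℝ≥0} (hL : LipschitzWith L (fderiv ℝ φ)) (c y x : E) (hx : x = y + c ∨ x = y - c) :
    2⁻¹ * (φ (y + c) - φ (y - c)) ^ 2
      ≤ 2 * (|fderiv ℝ φ x c| + 2 * L * ‖c‖ ^ 2) ^ 2 := by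
  have key : ‖φ (y + c) - φ (y - c) - fderiv ℝ φ x ((y + c) - (y - c))‖
      ≤ (2 * L * ‖c‖) * ‖(y + c) - (y - c)‖ := by
    refine Convex.norm_image_sub_le_of_norm_hasFDerivWithin_le' (𝕜 := ℝ) (f := φ)
      (f' := fderiv ℝ φ) (s := segment ℝ (y - c) (y + c)) (φ := fderiv ℝ φ x)
      (fun z _ => ((hφ.differentiable one_ne_zero) z).hasFDerivAt.hasFDerivWithinAt) ?_
      (convex_segment _ _) (left_mem_segment ℝ _ _) (right_mem_segment ℝ _ _)
    intro z hz
    have h1 := hL.dist_le_mul z x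
    rw [dist_eq_norm] at h1
    refine h1.trans ?_
    have h2 : dist z x ≤ 2 * ‖c‖ := by
      have h3 : dist (y - c) (y + c) = 2 * ‖c‖ := by
        rw [dist_eq_norm, show y - c - (y + c) = -((2 : ℝ) • c) by rw [two_smul]; abel, norm_neg,
          norm_smul]; simp
      have := dist_add_dist_of_mem_segment hz
      rcases hx with rfl | rfl
      · linarith [dist_nonneg (x := y - c) (y := z)]
      · rw [dist_comm]; linarith [dist_nonneg (x := z) (y := y + c)]
    nlinarith [L.2, norm_nonneg c]
  have h2c : (y + c) - (y - c) = (2 : ℝ) • c := by rw [two_smul]; abel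
  rw [h2c, map_smul, norm_smul, Real.norm_eq_abs, smul_eq_mul] at key
  have h4 : |φ (y + c) - φ (y - c)| ≤ 2 * (|fderiv ℝ φ x c| + 2 * L * ‖c‖ ^ 2) := by
    have := abs_le.1 key
    have h5 := abs_le.1 (le_refl |fderiv ℝ φ x c|)
    simp only [Real.norm_eq_abs, abs_two] at this
    rw [abs_le]
    constructor <;> nlinarith
  have h6 : (φ (y + c) - φ (y - c)) ^ 2 ≤ (2 * (|fderiv ℝ φ x c| + 2 * L * ‖c‖ ^ 2)) ^ 2 := by
    rw [← sq_abs]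
    gcongr
  nlinarith

lemma integral_mul_le_sqrt_mul_sqrt {Ω : Type*} [MeasurableSpace Ω] {μ : Measure Ω} {f g : Ω → ℝ}
    (hf : MemLp f 2 μ) (hg : MemLp g 2 μ) :
    ∫ x, f x * g x ∂μ ≤ √(∫ x, f x ^ 2 ∂μ) * √(∫ x, g x ^ 2 ∂μ) := by
  have h := integral_mul_norm_le_Lp_mul_Lq (μ := μ) (f := f) (g := g) Real.HolderConjugate.two_two
    (by simpa using hf) (by simpa using hg)
  simp only [Real.rpow_two, Real.norm_eq_abs, sq_abs, ← Real.sqrt_eq_rpow] at h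
  refine le_trans ?_ h
  refine integral_mono (hf.integrable_mul hg) ?_ ?_
  · exact (hf.integrable_mul hg).norm.congr (by simp [Filter.EventuallyEq])
  · intro x
    simp only
    rw [← abs_mul]
    exact le_abs_self _

/-- Tensorisation, one sign at a time. Conditioning on the new sign and using the induction
hypothesis on each half leaves a two-point problem for the L² norms of the shifted φ and the
exponential integrals of the shifted g. The natural energy is a discrete gradient; replacing it by a
derivative costs the `L * ‖c‖ ^ 2` error, negligible when the steps are of size m^{-1/2}. -/
theorem logSobolev_signSum [NormedSpace ℝ E] (l : List E) {φ g : E → ℝ} (hφ : ContDiff ℝ 1 φ)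
    {L : ℝ≥0} (hL : LipschitzWith L (fderiv ℝ φ)) (hg : Continuous g) :
    ∫ x, g x * φ x ^ 2 ∂(signSum l) ≤
      ∫ x, (l.map fun c => 2 * (|fderiv ℝ φ x c| + 2 * L * ‖c‖ ^ 2) ^ 2).sum ∂(signSum l)
      + (∫ x, φ x ^ 2 ∂(signSum l)) * Real.log (∫ x, Real.exp (g x) ∂(signSum l)) := by
  have hDc : ∀ (l : List E) {ψ : E → ℝ}, ContDiff ℝ 1 ψ → Continuous
      (fun x => (l.map fun c => 2 * (|fderiv ℝ ψ x c| + 2 * L * ‖c‖ ^ 2) ^ 2).sum) := by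
    intro l ψ hψ
    have := hψ.continuous_fderiv one_ne_zero
    refine continuous_list_sum l (fun c _ => ?_)
    fun_prop
  induction l generalizing φ g with
  | nil => simp [signSum, mul_comm]
  | cons c l ih =>
    have hφc := hφ.continuous
    have hφ₁ : ContDiff ℝ 1 (fun x => φ (x + c)) := hφ.comp (contDiff_id.add contDiff_const)
    have hφ₂ : ContDiff ℝ 1 (fun x => φ (x - c)) := hφ.comp (contDiff_id.sub contDiff_const)
    have hfd₁ : fderiv ℝ (fun x => φ (x + c)) = fun x => fderiv ℝ φ (x + c) := by
      ext1 x; exact fderiv_comp_add_right c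
    have hfd₂ : fderiv ℝ (fun x => φ (x - c)) = fun x => fderiv ℝ φ (x - c) := by
      ext1 x; simpa only [sub_eq_add_neg] using fderiv_comp_add_right (f := φ) (x := x) (-c)
    have h₁ := ih hφ₁ (g := fun x => g (x + c))
      (by rw [hfd₁]; exact .of_dist_le_mul fun x y => by simpa using hL.dist_le_mul (x + c) (y + c))
      (by fun_prop)
    have h₂ := ih hφ₂ (g := fun x => g (x - c))
      (by rw [hfd₂]; exact .of_dist_le_mul fun x y => by simpa using hL.dist_le_mul (x - c) (y - c))
      (by fun_prop)
    simp only [hfd₁, hfd₂] at h₁ h₂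
    have hint : ∀ {f : E → ℝ}, Continuous f → Integrable f (signSum l) :=
      fun hf => integrable_signSum l hf
    have hD := hDc (c :: l) hφ
    have hDl := hDc l hφ
    have hfc := hφ.continuous_fderiv one_ne_zero
    rw [integral_signSum_cons c l (by fun_prop), integral_signSum_cons c l hD,
      integral_signSum_cons c l (by fun_prop), integral_signSum_cons c l (by fun_prop)]
    simp only [List.map_cons, List.sum_cons, smul_eq_mul]
    have hq₁ : Integrable (fun x => 2 * (|fderiv ℝ φ (x + c) c| + 2 * L * ‖c‖ ^ 2) ^ 2)
      (signSum l) := hint (by fun_prop)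
    have hq₂ : Integrable (fun x => 2 * (|fderiv ℝ φ (x - c) c| + 2 * L * ‖c‖ ^ 2) ^ 2)
      (signSum l) := hint (by fun_prop)
    have hr₁ := hint (f := fun x => (l.map fun c₁ =>
      2 * (|fderiv ℝ φ (x + c) c₁| + 2 * L * ‖c₁‖ ^ 2) ^ 2).sum)
      (hDl.comp (continuous_add_const c))
    have hr₂ := hint (f := fun x => (l.map fun c₁ =>
      2 * (|fderiv ℝ φ (x - c) c₁| + 2 * L * ‖c₁‖ ^ 2) ^ 2).sum)
      (hDl.comp (continuous_sub_right c))
    rw [integral_add hq₁ hr₁, integral_add hq₂ hr₂]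
    set a := ∫ x, φ (x + c) ^ 2 ∂(signSum l) with ha
    set b := ∫ x, φ (x - c) ^ 2 ∂(signSum l) with hb
    set A := ∫ x, Real.exp (g (x + c)) ∂(signSum l) with hA
    set B := ∫ x, Real.exp (g (x - c)) ∂(signSum l) with hB
    have ha0 : 0 ≤ a := integral_nonneg fun x => sq_nonneg _
    have hb0 : 0 ≤ b := integral_nonneg fun x => sq_nonneg _
    have hA0 : 0 < A := integral_exp_pos (hint (by fun_prop))
    have hB0 : 0 < B := integral_exp_pos (hint (by fun_prop))
    have htp := two_point_logSobolev (Real.log A) (Real.log B) (√a) (√b)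
    rw [Real.exp_log hA0, Real.exp_log hB0, Real.sq_sqrt ha0, Real.sq_sqrt hb0, sub_sq,
      Real.sq_sqrt ha0, Real.sq_sqrt hb0] at htp
    have hmem : ∀ {f : E → ℝ}, Continuous f → MemLp f 2 (signSum l) := fun hf =>
      (memLp_two_iff_integrable_sq hf.aestronglyMeasurable).2 (hint (hf.pow 2))
    -- By Cauchy–Schwarz, (√a - √b)² ≤ ∫ (φ(x + c) - φ(x - c))²: the two-point energy is dominated
    -- by the discrete gradient.
    have hCS := integral_mul_le_sqrt_mul_sqrt (hmem (f := fun x => φ (x + c)) (by fun_prop))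
      (hmem (f := fun x => φ (x - c)) (by fun_prop))
    have hsq : ∫ x, 2⁻¹ * (φ (x + c) - φ (x - c)) ^ 2 ∂(signSum l)
        = 2⁻¹ * (a - 2 * ∫ x, φ (x + c) * φ (x - c) ∂(signSum l) + b) := by
      have he : ∀ x, 2⁻¹ * (φ (x + c) - φ (x - c)) ^ 2
          = 2⁻¹ * φ (x + c) ^ 2 - φ (x + c) * φ (x - c) + 2⁻¹ * φ (x - c) ^ 2 := fun x => by ring
      simp_rw [he]
      rw [integral_add (hint (by fun_prop)) (hint (by fun_prop)),
        integral_sub (hint (by fun_prop)) (hint (by fun_prop)), integral_const_mul,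
        integral_const_mul]
      ring
    -- The derivative is taken at each endpoint in turn, because the new gradient term integrated
    -- over the longer sum is the mean of the integrals at x + c and at x - c.
    have hi₁ : ∫ x, 2⁻¹ * (φ (x + c) - φ (x - c)) ^ 2 ∂(signSum l)
        ≤ ∫ x, 2 * (|fderiv ℝ φ (x + c) c| + 2 * L * ‖c‖ ^ 2) ^ 2 ∂(signSum l) :=
      integral_mono (hint (by fun_prop)) (hint (by fun_prop)) fun x =>
        sq_sub_le_of_lipschitz_fderiv hφ hL c x _ (Or.inl rfl)
    have hi₂ : ∫ x, 2⁻¹ * (φ (x + c) - φ (x - c)) ^ 2 ∂(signSum l)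
        ≤ ∫ x, 2 * (|fderiv ℝ φ (x - c) c| + 2 * L * ‖c‖ ^ 2) ^ 2 ∂(signSum l) :=
      integral_mono (hint (by fun_prop)) (hint (by fun_prop)) fun x =>
        sq_sub_le_of_lipschitz_fderiv hφ hL c x _ (Or.inr rfl)
    nlinarith

end Cube

/-! ### Central limit theorem and the Gaussian inequality for compactly supported functions -/

section GaussianLimit

variable {E : Type*} [NormedAddCommGroup E] [InnerProductSpace ℝ E] [FiniteDimensional ℝ E]
  [MeasurableSpace E] [BorelSpace E]

omit [FiniteDimensional ℝ E] in
lemma charFun_signSum [SecondCountableTopology E] (l : List E) (t : E) :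
    charFun (signSum l) t = (((l.map fun c => Real.cos (inner ℝ c t)).prod : ℝ) : ℂ) := by
  induction l with
  | nil => simp [signSum]
  | cons c l ih =>
    rw [charFun_apply, integral_signSum_cons c l (by fun_prop)]
    simp only [sub_eq_add_neg, inner_add_left, inner_neg_left, Complex.ofReal_add,
      Complex.ofReal_neg, add_mul, Complex.exp_add]
    rw [integral_mul_const, integral_mul_const, ← charFun_apply, ih, List.map_cons,
      List.prod_cons, Complex.ofReal_mul, Complex.ofReal_cos, Complex.cos]
    simp only [Complex.real_smul]
    push_cast
    ring

lemma tendsto_cos_pow (x : ℝ) :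
    Tendsto (fun m : ℕ => Real.cos ((√m)⁻¹ * x) ^ m) atTop (𝓝 (Real.exp (-x ^ 2 / 2))) := by
  have h : Tendsto (fun m : ℕ => (m : ℝ) * (Real.cos ((√m)⁻¹ * x) - 1)) atTop
      (𝓝 (-x ^ 2 / 2)) := by
    rw [tendsto_iff_norm_sub_tendsto_zero]
    have h0 : Tendsto (fun m : ℕ => (x ^ 4 * (5 / 96)) * (m : ℝ)⁻¹) atTop (𝓝 0) := by
      simpa using (tendsto_inv_atTop_nhds_zero_nat (𝕜 := ℝ)).const_mul (x ^ 4 * (5 / 96))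
    have hsm : Tendsto (fun m : ℕ => (√m)⁻¹ * x) atTop (𝓝 0) := by
      rw [← zero_mul x]
      exact .mul_const x (tendsto_inv_atTop_zero.comp <| Real.tendsto_sqrt_atTop.comp <|
        tendsto_natCast_atTop_atTop)
    refine squeeze_zero' (.of_forall fun _ => norm_nonneg _) ?_ h0
    filter_upwards [eventually_gt_atTop 0, hsm.eventually (Metric.closedBall_mem_nhds 0 one_pos)]
      with m hm hx
    have hm' : (0 : ℝ) < m := by exact_mod_cast hm
    have hb := Real.cos_bound (x := (√m)⁻¹ * x) (by simpa using hx)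
    have hs : ((√m)⁻¹ * x) ^ 2 = (m : ℝ)⁻¹ * x ^ 2 := by
      rw [mul_pow, inv_pow, Real.sq_sqrt hm'.le]
    have h4 : |(√m)⁻¹ * x| ^ 4 = ((m : ℝ)⁻¹ * x ^ 2) ^ 2 := by
      rw [← hs, ← sq_abs ((√m)⁻¹ * x)]; ring
    rw [hs, h4] at hb
    have he : (m : ℝ) * (Real.cos ((√m)⁻¹ * x) - 1) - -x ^ 2 / 2
        = m * (Real.cos ((√m)⁻¹ * x) - (1 - (m : ℝ)⁻¹ * x ^ 2 / 2)) := by field_simp; ring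
    rw [he, Real.norm_eq_abs, abs_mul, abs_of_pos hm']
    calc _ ≤ (m : ℝ) * (((m : ℝ)⁻¹ * x ^ 2) ^ 2 * (5 / 96)) := by gcongr
      _ = _ := by field_simp
  simpa using Real.tendsto_one_add_pow_exp_of_tendsto h

/-- `m` copies of each vector of the orthonormal basis `b`, scaled by `1 / √m`. -/
def signSumSteps {ι : Type*} [Fintype ι] (b : ι → E) (m : ℕ) : List E :=
  (Finset.univ : Finset ι).toList.flatMap fun i => List.replicate m ((√m)⁻¹ • b i)

omit [FiniteDimensional ℝ E] [MeasurableSpace E] [BorelSpace E] in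
lemma prod_map_signSumSteps {ι M : Type*} [Fintype ι] [CommMonoid M] (b : ι → E) (m : ℕ)
    (F : E → M) : ((signSumSteps b m).map F).prod = ∏ i, F ((√m)⁻¹ • b i) ^ m := by
  rw [signSumSteps, List.map_flatMap, List.flatMap_def, List.prod_flatten]
  simp [Finset.prod_map_toList]

omit [FiniteDimensional ℝ E] [MeasurableSpace E] [BorelSpace E] in
lemma sum_map_signSumSteps {ι M : Type*} [Fintype ι] [AddCommMonoid M] (b : ι → E) (m : ℕ)
    (F : E → M) : ((signSumSteps b m).map F).sum = ∑ i, m • F ((√m)⁻¹ • b i) := by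
  rw [signSumSteps, List.map_flatMap, List.flatMap_def, List.sum_flatten]
  simp [Finset.sum_map_toList]

/-- The central limit theorem by convergence of characteristic functions: each cos(⟨b i, t⟩ / √m)^m
tends to exp(-⟨b i, t⟩² / 2), and Parseval multiplies these limits to exp(-‖t‖² / 2). -/
lemma tendsto_integral_signSum {ι : Type*} [Fintype ι] (b : OrthonormalBasis ι ℝ E)
    {f : E → ℝ} (hf : Continuous f) {C : ℝ} (hC : ∀ x, |f x| ≤ C) :
    Tendsto (fun m => ∫ x, f x ∂(signSum (signSumSteps b m))) atTop
      (𝓝 (∫ x, f x ∂(stdGaussian E))) := by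
  let P : ℕ → ProbabilityMeasure E := fun m => ⟨signSum (signSumSteps b m), inferInstance⟩
  let Q : ProbabilityMeasure E := ⟨stdGaussian E, inferInstance⟩
  have hw : Tendsto P atTop (𝓝 Q) := by
    rw [ProbabilityMeasure.tendsto_iff_tendsto_charFun]
    intro t
    simp only [P, Q, ProbabilityMeasure.coe_mk]
    simp_rw [charFun_signSum, prod_map_signSumSteps, charFun_stdGaussian]
    have h : Tendsto (fun m : ℕ => ∏ i, Real.cos (inner ℝ ((√m)⁻¹ • b i) t) ^ m) atTop
        (𝓝 (∏ i, Real.exp (-(inner ℝ (b i) t) ^ 2 / 2))) := by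
      refine tendsto_finsetProd _ fun i _ => ?_
      simp_rw [real_inner_smul_left]
      exact tendsto_cos_pow _
    rw [← Real.exp_sum, ← Finset.sum_div, Finset.sum_neg_distrib, b.sum_sq_inner_right] at h
    convert (Complex.continuous_ofReal.tendsto _).comp h using 2
    · simp
    · push_cast; rfl
  rw [ProbabilityMeasure.tendsto_iff_forall_integral_tendsto] at hw
  exact hw (BoundedContinuousFunction.ofNormedAddCommGroup f hf C (by simpa using hC))

/-- The Gaussian logarithmic Sobolev inequality for compactly supported functions, in dual form. -/
theorem logSobolev_of_hasCompactSupport {ι : Type*} [Fintype ι] (b : OrthonormalBasis ι ℝ E)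
    {φ g : E → ℝ} (hφ : ContDiff ℝ 2 φ) (hφs : HasCompactSupport φ) (hg : Continuous g) {M : ℝ}
    (hM : ∀ x, |g x| ≤ M) :
    ∫ x, g x * φ x ^ 2 ∂(stdGaussian E) ≤
      2 * ∫ x, ∑ i, fderiv ℝ φ x (b i) ^ 2 ∂(stdGaussian E)
      + (∫ x, φ x ^ 2 ∂(stdGaussian E)) * Real.log (∫ x, Real.exp (g x) ∂(stdGaussian E)) := by
  have hφc := hφ.continuous
  have hf1 : ContDiff ℝ 1 (fderiv ℝ φ) := hφ.fderiv_right (by norm_num)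
  have hfc := hf1.continuous
  obtain ⟨L, hL⟩ := hf1.lipschitzWith_of_hasCompactSupport (hφs.fderiv ℝ) one_ne_zero
  obtain ⟨C, hC⟩ := hφs.exists_bound_of_continuous hφc
  obtain ⟨C', hC'⟩ := (hφs.fderiv ℝ).exists_bound_of_continuous hfc
  have hfb : ∀ x i, |fderiv ℝ φ x (b i)| ≤ C' := fun x i => by
    simpa using ((fderiv ℝ φ x).le_opNorm (b i)).trans
      (mul_le_mul (hC' x) (b.norm_eq_one i).le (norm_nonneg _) ((norm_nonneg _).trans (hC' x)))
  have hfb2 : ∀ x, |∑ i, fderiv ℝ φ x (b i) ^ 2| ≤ Fintype.card ι * C' ^ 2 := fun x => by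
    rw [abs_of_nonneg (Finset.sum_nonneg fun i _ => sq_nonneg _)]
    calc ∑ i, fderiv ℝ φ x (b i) ^ 2 ≤ ∑ i : ι, C' ^ 2 :=
          Finset.sum_le_sum fun i _ => sq_le_sq.2 ((hfb x i).trans (le_abs_self _))
      _ = _ := by simp
  have hsq : ∀ x, φ x ^ 2 ≤ C ^ 2 := fun x => sq_le_sq.2 ((hC x).trans (le_abs_self _))
  have t1 := tendsto_integral_signSum b (f := fun x => g x * φ x ^ 2) (by fun_prop)
    (C := M * C ^ 2) (fun x => by
      rw [abs_mul, abs_of_nonneg (sq_nonneg (φ x))]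
      exact mul_le_mul (hM x) (hsq x) (sq_nonneg _) ((abs_nonneg _).trans (hM x)))
  have t2 := tendsto_integral_signSum b (f := fun x => φ x ^ 2) (by fun_prop)
    (C := C ^ 2) (fun x => by rw [abs_of_nonneg (sq_nonneg (φ x))]; exact hsq x)
  have t3 := tendsto_integral_signSum b (f := fun x => Real.exp (g x)) (by fun_prop)
    (C := Real.exp M) (fun x => by
      rw [abs_of_nonneg (Real.exp_pos _).le]; gcongr; exact (abs_le.1 (hM x)).2)
  have t4 := tendsto_integral_signSum b (f := fun x => ∑ i, fderiv ℝ φ x (b i) ^ 2)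
    (by fun_prop) hfb2
  have hexp : 0 < ∫ x, Real.exp (g x) ∂(stdGaussian E) := by
    refine integral_exp_pos (Integrable.of_bound (by fun_prop) (Real.exp M) (.of_forall fun x => ?_))
    rw [Real.norm_eq_abs, abs_of_nonneg (Real.exp_pos _).le]; gcongr; exact (abs_le.1 (hM x)).2
  -- The error comes from expanding m · 2(a / √m + 2L / m)² = 2a² + 8La / √m + 8L² / m for the m
  -- equal steps in one basis direction, with a ≤ C'.
  have t5 : Tendsto (fun m : ℕ => 2 * ∫ x, ∑ i, fderiv ℝ φ x (b i) ^ 2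
      ∂(signSum (signSumSteps b m)) + Fintype.card ι * (8 * L * C' * (√m)⁻¹ + 8 * L ^ 2 * (m : ℝ)⁻¹))
      atTop (𝓝 (2 * ∫ x, ∑ i, fderiv ℝ φ x (b i) ^ 2 ∂(stdGaussian E))) := by
    have hs : Tendsto (fun m : ℕ => (√(m : ℝ))⁻¹) atTop (𝓝 0) :=
      tendsto_inv_atTop_zero.comp <| Real.tendsto_sqrt_atTop.comp tendsto_natCast_atTop_atTop
    have := (t4.const_mul 2).add (((hs.const_mul (8 * L * C')).add
      ((tendsto_inv_atTop_nhds_zero_nat (𝕜 := ℝ)).const_mul (8 * (L : ℝ) ^ 2))).const_mul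
        (Fintype.card ι : ℝ))
    simpa using this
  refine le_of_tendsto_of_tendsto t1 (t5.add (t2.mul (t3.log hexp.ne'))) ?_
  filter_upwards [eventually_gt_atTop 0] with m hm
  have hm' : (0 : ℝ) < m := by exact_mod_cast hm
  refine (logSobolev_signSum (signSumSteps b m) (hφ.of_le (by norm_num)) hL hg).trans ?_
  gcongr
  simp_rw [sum_map_signSumSteps]
  have hcont : Continuous fun x => ∑ i, fderiv ℝ φ x (b i) ^ 2 := by fun_prop
  have hint := integrable_signSum (signSumSteps b m) hcont
  rw [← integral_const_mul]
  have hsplit : ∫ x, (2 * ∑ i, fderiv ℝ φ x (b i) ^ 2) ∂(signSum (signSumSteps b m))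
      + Fintype.card ι * (8 * L * C' * (√m)⁻¹ + 8 * L ^ 2 * (m : ℝ)⁻¹)
      = ∫ x, (2 * ∑ i, fderiv ℝ φ x (b i) ^ 2
        + Fintype.card ι * (8 * L * C' * (√m)⁻¹ + 8 * L ^ 2 * (m : ℝ)⁻¹))
          ∂(signSum (signSumSteps b m)) := by
    rw [integral_add (hint.const_mul 2) (integrable_const _)]; simp
  rw [hsplit]
  refine integral_mono (integrable_signSum _ (by fun_prop)) (integrable_signSum _ (by fun_prop))
    fun x => ?_
  have hs2 : (√(m : ℝ))⁻¹ ^ 2 = (m : ℝ)⁻¹ := by rw [inv_pow, Real.sq_sqrt hm'.le]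
  have hs0 : 0 ≤ (√(m : ℝ))⁻¹ := by positivity
  simp only
  rw [Finset.mul_sum, ← nsmul_eq_mul, ← Finset.card_univ, ← Finset.sum_const,
    ← Finset.sum_add_distrib]
  refine Finset.sum_le_sum fun i _ => ?_
  rw [map_smul, norm_smul, b.norm_eq_one i, mul_one, Real.norm_eq_abs, sq_abs, hs2, smul_eq_mul,
    abs_mul, abs_of_nonneg hs0, nsmul_eq_mul, ← sq_abs (fderiv ℝ φ x (b i))]
  set a := |fderiv ℝ φ x (b i)|
  set s := (√(m : ℝ))⁻¹
  have ha : a ≤ C' := hfb x i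
  have hms : (m : ℝ) * s ^ 2 = 1 := by rw [hs2]; field_simp
  have e : (m : ℝ) * (2 * (s * a + 2 * L * (m : ℝ)⁻¹) ^ 2)
      = (m * s ^ 2) * (2 * a ^ 2) + 8 * L * a * s * (m * (m : ℝ)⁻¹)
        + 8 * L ^ 2 * (m : ℝ)⁻¹ * (m * (m : ℝ)⁻¹) := by ring
  rw [e, hms, mul_inv_cancel₀ hm'.ne']
  have : 8 * L * a * s ≤ 8 * L * C' * s := by gcongr
  linarith

end GaussianLimit

/-! ### Lebesgue density of the standard Gaussian measure, and cutoffs -/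

section Density

variable {E : Type*} [NormedAddCommGroup E] [InnerProductSpace ℝ E]

/-- The Lebesgue density of the standard Gaussian measure. -/
def gaussianPdf (x : E) : ℝ :=
  (2 * Real.pi) ^ (-(Module.finrank ℝ E / 2 : ℝ)) * Real.exp (-‖x‖ ^ 2 / 2)

lemma gaussianPdf_pos (x : E) : 0 < gaussianPdf x := by unfold gaussianPdf; positivity

lemma contDiff_gaussianPdf : ContDiff ℝ ∞ (gaussianPdf : E → ℝ) := by
  unfold gaussianPdf
  exact contDiff_const.mul (((contDiff_norm_sq ℝ).neg.div_const 2).exp)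

lemma continuous_gaussianPdf : Continuous (gaussianPdf : E → ℝ) := contDiff_gaussianPdf.continuous

lemma hasFDerivAt_gaussianPdf (x : E) :
    HasFDerivAt gaussianPdf (-(gaussianPdf x) • innerSL ℝ x) x := by
  have h := ((((hasStrictFDerivAt_norm_sq x).hasFDerivAt).neg.mul_const (2⁻¹ : ℝ)).exp).const_mul
    ((2 * Real.pi) ^ (-(Module.finrank ℝ E / 2 : ℝ)))
  refine (h.congr_fderiv ?_)
  ext v
  simp [gaussianPdf, div_eq_mul_inv]
  ring

lemma fderiv_gaussianPdf_apply (x v : E) :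
    fderiv ℝ gaussianPdf x v = -(gaussianPdf x * inner ℝ x v) := by
  rw [(hasFDerivAt_gaussianPdf x).fderiv]; simp

variable [FiniteDimensional ℝ E] [MeasurableSpace E] [BorelSpace E]

lemma integral_gaussianPdf_smul_cexp (t : E) :
    ∫ x : E, (gaussianPdf x : ℂ) * Complex.exp (inner ℝ x t * Complex.I)
      = Complex.exp (-‖t‖ ^ 2 / 2) := by
  have h := GaussianFourier.integral_cexp_neg_mul_sq_norm_add (V := E) (b := 1 / 2) (by norm_num)
    Complex.I t
  have hpi : (0 : ℝ) < 2 * Real.pi := by positivity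
  have h2 : ((Real.pi : ℂ) / (1 / 2)) ^ (Module.finrank ℝ E / 2 : ℂ)
      = (((2 * Real.pi) ^ (Module.finrank ℝ E / 2 : ℝ) : ℝ) : ℂ) := by
    rw [Complex.ofReal_cpow hpi.le]
    push_cast
    congr 1
    ring
  have h3 : ∀ x : E, (gaussianPdf x : ℂ) * Complex.exp (inner ℝ x t * Complex.I)
      = (((2 * Real.pi) ^ (-(Module.finrank ℝ E / 2 : ℝ)) : ℝ) : ℂ)
        * Complex.exp (-(1 / 2) * ‖x‖ ^ 2 + Complex.I * inner ℝ t x) := fun x => by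
    rw [gaussianPdf, Complex.exp_add, real_inner_comm]
    push_cast
    ring_nf
  simp_rw [h3]
  rw [integral_const_mul, h, h2, ← mul_assoc, ← Complex.ofReal_mul, ← Real.rpow_add hpi]
  simp
  ring_nf

lemma integrable_gaussianPdf : Integrable (gaussianPdf : E → ℝ) := by
  have h := integral_gaussianPdf_smul_cexp (0 : E)
  simp only [inner_zero_right, Complex.ofReal_zero, zero_mul, Complex.exp_zero, mul_one,
    norm_zero] at h
  -- A nonintegrable function would have Bochner integral 0, whereas the Fourier integral at t = 0
  -- equals 1.
  have h' : Integrable fun x : E => (gaussianPdf x : ℂ) :=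
    Integrable.of_integral_ne_zero (by rw [h]; simp)
  exact h'.re

/-- Both are finite measures with the same characteristic function; this is what lets Lebesgue
integration by parts and translations be used. -/
lemma stdGaussian_eq_withDensity :
    stdGaussian E = volume.withDensity fun x => ENNReal.ofReal (gaussianPdf x) := by
  have : IsFiniteMeasure (volume.withDensity fun x : E => ENNReal.ofReal (gaussianPdf x)) :=
    isFiniteMeasure_withDensity_ofReal integrable_gaussianPdf.2
  refine Measure.ext_of_charFun (funext fun t => ?_)
  rw [charFun_stdGaussian, charFun_apply, integral_withDensity_eq_integral_toReal_smul
    continuous_gaussianPdf.measurable.ennreal_ofReal (by simp), ← integral_gaussianPdf_smul_cexp t]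
  simp [ENNReal.toReal_ofReal (gaussianPdf_pos _).le]

lemma integral_stdGaussian {F : Type*} [NormedAddCommGroup F] [NormedSpace ℝ F] (f : E → F) :
    ∫ x, f x ∂(stdGaussian E) = ∫ x, gaussianPdf x • f x := by
  rw [stdGaussian_eq_withDensity, integral_withDensity_eq_integral_toReal_smul
    continuous_gaussianPdf.measurable.ennreal_ofReal (by simp)]
  simp [ENNReal.toReal_ofReal (gaussianPdf_pos _).le]

lemma lintegral_stdGaussian {f : E → ℝ≥0∞} (hf : AEMeasurable f) :
    ∫⁻ x, f x ∂(stdGaussian E) = ∫⁻ x, ENNReal.ofReal (gaussianPdf x) * f x := by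
  rw [stdGaussian_eq_withDensity, lintegral_withDensity_eq_lintegral_mul₀
    continuous_gaussianPdf.measurable.ennreal_ofReal.aemeasurable hf]
  rfl

lemma integrable_stdGaussian_iff {F : Type*} [NormedAddCommGroup F] [NormedSpace ℝ F] {f : E → F} :
    Integrable f (stdGaussian E) ↔ Integrable fun x => gaussianPdf x • f x := by
  rw [stdGaussian_eq_withDensity, integrable_withDensity_iff_integrable_smul'
    continuous_gaussianPdf.measurable.ennreal_ofReal (by simp)]
  simp [ENNReal.toReal_ofReal (gaussianPdf_pos _).le]

lemma stdGaussian_absolutelyContinuous : stdGaussian E ≪ volume := by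
  rw [stdGaussian_eq_withDensity]; exact withDensity_absolutelyContinuous _ _

lemma volume_absolutelyContinuous_stdGaussian : (volume : Measure E) ≪ stdGaussian E := by
  rw [stdGaussian_eq_withDensity]
  refine withDensity_absolutelyContinuous'
    continuous_gaussianPdf.measurable.ennreal_ofReal.aemeasurable (.of_forall fun x => ?_)
  simp [gaussianPdf_pos]

variable (E) in
/-- Smooth cutoff functions increasing to `1`, with decaying derivatives. -/
lemma exists_cutoff : ∃ (χ : ℕ → E → ℝ) (C : ℝ), 0 ≤ C ∧ (∀ k, ContDiff ℝ ∞ (χ k)) ∧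
    (∀ k, HasCompactSupport (χ k)) ∧ (∀ k x, 0 ≤ χ k x) ∧ (∀ k x, χ k x ≤ 1) ∧
    (∀ x, ∀ᶠ k in atTop, χ k x = 1) ∧ (∀ k x, ‖fderiv ℝ (χ k) x‖ ≤ C / (k + 1)) ∧
    (∀ k x, ‖x‖ * ‖fderiv ℝ (χ k) x‖ ≤ C) := by
  let B : ContDiffBump (0 : E) := ⟨1, 2, one_pos, one_lt_two⟩
  have hB : ContDiff ℝ ∞ (B : E → ℝ) := B.contDiff
  obtain ⟨C, hC⟩ := (B.hasCompactSupport.fderiv ℝ).exists_bound_of_continuous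
    (hB.continuous_fderiv (by simp))
  have hC0 : 0 ≤ C := (norm_nonneg _).trans (hC 0)
  have hk : ∀ k : ℕ, (0 : ℝ) < (k : ℝ) + 1 := fun k => by positivity
  have hfd : ∀ (k : ℕ) x, fderiv ℝ (fun x : E => B (((k : ℝ) + 1)⁻¹ • x)) x
      = ((k : ℝ) + 1)⁻¹ • fderiv ℝ B (((k : ℝ) + 1)⁻¹ • x) := fun k x => by
    exact fderiv_comp_smul (𝕜 := ℝ) (f := B) _
  refine ⟨fun k x => B (((k : ℝ) + 1)⁻¹ • x), 2 * C, by positivity, fun k => ?_, fun k => ?_,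
    fun k x => B.nonneg, fun k x => B.le_one, fun x => ?_, fun k x => ?_, fun k x => ?_⟩
  · exact hB.comp (contDiff_const_smul _)
  · exact B.hasCompactSupport.comp_smul (inv_pos.2 (hk k)).ne'
  · filter_upwards [eventually_ge_atTop ⌈‖x‖⌉₊] with k hkx
    refine B.one_of_mem_closedBall ?_
    rw [mem_closedBall_zero_iff, norm_smul, norm_inv, Real.norm_of_nonneg (hk k).le,
      inv_mul_le_iff₀ (hk k)]
    have : ‖x‖ ≤ k := (Nat.le_ceil _).trans (by exact_mod_cast hkx)
    simp only [B]
    linarith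
  · rw [hfd, norm_smul, norm_inv, Real.norm_of_nonneg (hk k).le, div_eq_inv_mul]
    gcongr
    linarith [hC (((k : ℝ) + 1)⁻¹ • x)]
  · rw [hfd, norm_smul, norm_inv, Real.norm_of_nonneg (hk k).le]
    -- The derivative of the bump vanishes off the ball of radius 2, and inside it ‖x‖ / (k + 1) ≤
    -- 2. So ‖x‖ ‖∇χ_k‖ stays bounded, as needed for test functions of linear growth.
    by_cases hx : ((k : ℝ) + 1)⁻¹ • x ∈ Metric.closedBall (0 : E) 2
    · rw [mem_closedBall_zero_iff, norm_smul, norm_inv, Real.norm_of_nonneg (hk k).le] at hx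
      rw [← mul_assoc, mul_comm ‖x‖]
      exact mul_le_mul hx (hC _) (norm_nonneg _) zero_le_two
    · have : fderiv ℝ B (((k : ℝ) + 1)⁻¹ • x) = 0 := by
        refine image_eq_zero_of_notMem_tsupport fun h => hx ?_
        have := tsupport_fderiv_subset ℝ h
        rwa [B.tsupport_eq] at this
      rw [this]; simp; positivity

end Density

/-! ### Scores and mollification -/

section Score

variable {E : Type*} [NormedAddCommGroup E] [InnerProductSpace ℝ E] [MeasurableSpace E]

/-- `U` is a square integrable score of `μ` relative to the standard Gaussian measure, i.e. the
gradient `∇ log (dμ/dγ)` in the sense of integration by parts. -/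
structure IsScore (μ : Measure E) (U : E → E) : Prop where
  memLp : MemLp U 2 μ
  integral_eq : ∀ ψ : E → ℝ, ContDiff ℝ ∞ ψ → HasCompactSupport ψ → ∀ v : E,
    ∫ x, ψ x * inner ℝ (U x) v ∂μ = ∫ x, (ψ x * inner ℝ x v - fderiv ℝ ψ x v) ∂μ

/-- The density of the convolution of `μ` with `η`. -/
def mollify (μ : Measure E) (η : E → ℝ) (x : E) : ℝ := ∫ y, η (x - y) ∂μ

variable [FiniteDimensional ℝ E] [BorelSpace E] {μ : Measure E} [IsProbabilityMeasure μ]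
  {η : E → ℝ}

lemma integrable_comp_sub (hη : Continuous η) (hs : HasCompactSupport η) (x : E) :
    Integrable (fun y => η (x - y)) μ := by
  obtain ⟨C, hC⟩ := hs.exists_bound_of_continuous hη
  exact Integrable.of_bound (by fun_prop) C (.of_forall fun y => hC _)

lemma contDiff_mollify (hη : ContDiff ℝ ∞ η) (hs : HasCompactSupport η) :
    ContDiff ℝ ∞ (mollify μ η) := by
  have h := hs.contDiff_convolution_right (μ := μ) (ContinuousLinearMap.mul ℝ ℝ)
    (f := fun _ : E => (1 : ℝ)) (locallyIntegrable_const 1) hη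
  convert h using 1
  ext x
  simp [mollify, convolution_def]

lemma fderiv_mollify_apply (hη : ContDiff ℝ ∞ η) (hs : HasCompactSupport η) (x v : E) :
    fderiv ℝ (mollify μ η) x v = ∫ y, fderiv ℝ η (x - y) v ∂μ := by
  have hη' := hη.continuous_fderiv (by simp)
  obtain ⟨C, hC⟩ := (hs.fderiv ℝ).exists_bound_of_continuous hη'
  have hd : HasFDerivAt (mollify μ η) (∫ y, fderiv ℝ η (x - y) ∂μ) x := by
    refine hasFDerivAt_integral_of_dominated_of_fderiv_le (s := Set.univ) univ_mem
      (F' := fun x y => fderiv ℝ η (x - y)) (bound := fun _ => C)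
      (.of_forall fun x => ?_) (integrable_comp_sub hη.continuous hs x) ?_ ?_ ?_ ?_
    · have := hη.continuous
      exact Continuous.aestronglyMeasurable (by fun_prop)
    · exact Continuous.aestronglyMeasurable (by fun_prop)
    · exact .of_forall fun y x _ => hC _
    · exact integrable_const _
    · refine .of_forall fun y x _ => ?_
      have := ((hη.differentiable (by simp)) (x - y)).hasFDerivAt
      have h := this.comp x ((hasFDerivAt_id x).sub_const y)
      rw [ContinuousLinearMap.comp_id] at h
      exact h
  rw [hd.fderiv, ContinuousLinearMap.integral_apply]
  exact Integrable.of_bound (Continuous.aestronglyMeasurable (by fun_prop)) C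
    (.of_forall fun y => hC _)

lemma integrable_mollify_inner {U : E → E} (hU : MemLp U 2 μ) (hη : Continuous η)
    (hs : HasCompactSupport η) (x w v : E) :
    Integrable (fun y => η (x - y) * inner ℝ (U y + w) v) μ := by
  obtain ⟨C, hC⟩ := hs.exists_bound_of_continuous hη
  have hU1 : Integrable (fun y => inner ℝ (U y + w) v) μ :=
    (((hU.integrable (by norm_num)).add (integrable_const w)).inner_const v)
  exact hU1.bdd_mul (Continuous.aestronglyMeasurable (by fun_prop)) (.of_forall fun y => hC (x - y))

/-- Test the score against y ↦ η(x - y). The left side is the Gaussian density p times the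
derivative of `mollify μ η` / p, so the Gaussian-relative gradient of the mollified measure is an
η-weighted average of U y + (x - y). -/
lemma IsScore.fderiv_mollify {U : E → E} (hU : IsScore μ U) (hη : ContDiff ℝ ∞ η)
    (hs : HasCompactSupport η) (x v : E) :
    fderiv ℝ (mollify μ η) x v + inner ℝ x v * mollify μ η x
      = ∫ y, η (x - y) * inner ℝ (U y + (x - y)) v ∂μ := by
  have hηc := hη.continuous
  have hη' := hη.continuous_fderiv (by simp)
  have hψ : ContDiff ℝ ∞ fun y => η (x - y) := hη.comp (contDiff_const.sub contDiff_id)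
  have hψs : HasCompactSupport fun y => η (x - y) :=
    hs.comp_homeomorph (Homeomorph.subLeft x)
  have hfd : ∀ y, fderiv ℝ (fun y => η (x - y)) y v = -fderiv ℝ η (x - y) v := fun y => by
    have := ((hη.differentiable (by simp)) (x - y)).hasFDerivAt
    have := this.comp y ((hasFDerivAt_id y).const_sub x)
    rw [HasFDerivAt.fderiv (f := fun y => η (x - y)) this]
    simp
  have h := hU.integral_eq _ hψ hψs v
  have hi1 : Integrable (fun y => η (x - y) * inner ℝ y v) μ :=
    (by fun_prop : Continuous fun y => η (x - y) * inner ℝ y v).integrable_of_hasCompactSupport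
      hψs.mul_right
  have hi2 : Integrable (fun y => fderiv ℝ η (x - y) v) μ := 
    integrable_comp_sub (η := fun z => fderiv ℝ η z v) (by fun_prop) (hs.fderiv_apply ℝ v) x
  simp only [hfd, sub_neg_eq_add] at h
  rw [integral_add hi1 hi2] at h
  rw [fderiv_mollify_apply hη hs, mollify, ← integral_const_mul]
  have hsplit : ∀ y, η (x - y) * inner ℝ (U y + (x - y)) v
      = η (x - y) * inner ℝ (U y) v - η (x - y) * inner ℝ y v + inner ℝ x v * η (x - y) := fun y => by
    rw [inner_add_left, inner_sub_left]; ring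
  have hi3 : Integrable (fun y => η (x - y) * inner ℝ (U y) v) μ := by
    simpa using integrable_mollify_inner hU.memLp hηc hs x 0 v
  have hi4 : Integrable (fun y => η (x - y) * inner ℝ (U y) v - η (x - y) * inner ℝ y v) μ :=
    hi3.sub hi1
  simp_rw [hsplit]
  rw [integral_add hi4 ((integrable_comp_sub hηc hs x).const_mul _),
    integral_sub hi3 hi1, h]
  ring

/-- The mollified squared norm of the score. -/
def mollifySq (μ : Measure E) (η : E → ℝ) (U : E → E) (x : E) : ℝ :=
  ∫ y, η (x - y) * ‖U y + (x - y)‖ ^ 2 ∂μ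

lemma sq_integral_mul_le {Ω : Type*} [MeasurableSpace Ω] {μ : Measure Ω} {w h : Ω → ℝ}
    (hw0 : ∀ x, 0 ≤ w x) (hw : Integrable w μ) (hh : AEStronglyMeasurable h μ)
    (hwh : Integrable (fun x => w x * h x ^ 2) μ) :
    (∫ x, w x * h x ∂μ) ^ 2 ≤ (∫ x, w x ∂μ) * ∫ x, w x * h x ^ 2 ∂μ := by
  have hws : AEStronglyMeasurable (fun x => √(w x)) μ :=
    Real.continuous_sqrt.comp_aestronglyMeasurable hw.1
  have hsq : ∀ x, √(w x) ^ 2 = w x := fun x => Real.sq_sqrt (hw0 x)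
  have h1 : MemLp (fun x => √(w x)) 2 μ := by
    rw [memLp_two_iff_integrable_sq hws]; simpa only [hsq] using hw
  have h2 : MemLp (fun x => √(w x) * |h x|) 2 μ := by
    rw [memLp_two_iff_integrable_sq (f := fun x => √(w x) * |h x|) (hws.mul hh.norm)]
    simpa only [mul_pow, hsq, sq_abs] using hwh
  have hCS := integral_mul_le_sqrt_mul_sqrt h1 h2
  have he : ∀ x, √(w x) * (√(w x) * |h x|) = w x * |h x| := fun x => by
    rw [← mul_assoc, ← sq, hsq]
  simp only [mul_pow, hsq, sq_abs, he] at hCS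
  have habs : |∫ x, w x * h x ∂μ| ≤ ∫ x, w x * |h x| ∂μ := by
    refine (abs_integral_le_integral_abs).trans_eq (integral_congr_ae (.of_forall fun x => ?_))
    simp [abs_mul, abs_of_nonneg (hw0 x)]
  rw [← sq_abs]
  calc _ ≤ (√(∫ x, w x ∂μ) * √(∫ x, w x * h x ^ 2 ∂μ)) ^ 2 := by
        gcongr; exact habs.trans hCS
    _ = _ := by
        rw [mul_pow, Real.sq_sqrt (integral_nonneg hw0),
          Real.sq_sqrt (integral_nonneg fun x => mul_nonneg (hw0 x) (sq_nonneg _))]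

lemma norm_add_sq_le_two_mul (a b : E) : ‖a + b‖ ^ 2 ≤ 2 * ‖a‖ ^ 2 + 2 * ‖b‖ ^ 2 := by
  rw [← mul_add]
  exact (pow_le_pow_left₀ (norm_nonneg _) (norm_add_le _ _) 2).trans add_sq_le

lemma integrable_mollifySq {U : E → E} (hU : MemLp U 2 μ) (hη : Continuous η)
    (hs : HasCompactSupport η) (hη0 : ∀ x, 0 ≤ η x) (x : E) :
    Integrable (fun y => η (x - y) * ‖U y + (x - y)‖ ^ 2) μ := by
  obtain ⟨C, hC⟩ := hs.exists_bound_of_continuous hη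
  have hc : AEStronglyMeasurable (fun y => η (x - y)) μ :=
    Continuous.aestronglyMeasurable (by fun_prop)
  have hU2 : Integrable (fun y => ‖U y‖ ^ 2) μ := hU.integrable_norm_pow two_ne_zero
  have h1 : Integrable (fun y => η (x - y) * ‖U y‖ ^ 2) μ :=
    hU2.bdd_mul hc (.of_forall fun y => hC (x - y))
  have hs2 : HasCompactSupport fun z => η z * ‖z‖ ^ 2 := hs.mul_right
  have h2 : Integrable (fun y => η (x - y) * ‖x - y‖ ^ 2) μ :=
    integrable_comp_sub (η := fun z => η z * ‖z‖ ^ 2) (by fun_prop) hs2 x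
  have hb : Integrable (fun y => 2 * (η (x - y) * ‖U y‖ ^ 2) + 2 * (η (x - y) * ‖x - y‖ ^ 2)) μ :=
    (h1.const_mul 2).add (h2.const_mul 2)
  refine hb.mono' ?_ (.of_forall fun y => ?_)
  · have hc' : AEStronglyMeasurable (fun y => x - y) μ :=
      Continuous.aestronglyMeasurable (by fun_prop)
    exact hc.mul ((hU.1.add hc').norm.pow 2)
  · rw [Real.norm_of_nonneg (mul_nonneg (hη0 _) (sq_nonneg _))]
    have := mul_le_mul_of_nonneg_left (norm_add_sq_le_two_mul (U y) (x - y)) (hη0 (x - y))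
    linarith

/-- Convexity of the Fisher information: Cauchy–Schwarz with the weight η(x - y), coordinate by
coordinate, then Parseval. -/
lemma IsScore.sum_sq_fderiv_mollify_le {ι : Type*} [Fintype ι] (b : OrthonormalBasis ι ℝ E)
    {U : E → E} (hU : IsScore μ U) (hη : ContDiff ℝ ∞ η)
    (hs : HasCompactSupport η) (hη0 : ∀ x, 0 ≤ η x) (x : E) :
    ∑ i, (fderiv ℝ (mollify μ η) x (b i) + inner ℝ x (b i) * mollify μ η x) ^ 2
      ≤ mollify μ η x * mollifySq μ η U x := by
  have hηc := hη.continuous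
  have hint := integrable_mollifySq hU.memLp hηc hs hη0 x
  have hm : ∀ i, AEStronglyMeasurable (fun y => inner ℝ (U y + (x - y)) (b i)) μ := fun i => by
    have hc' : AEStronglyMeasurable (fun y => x - y) μ :=
      Continuous.aestronglyMeasurable (by fun_prop)
    exact (hU.memLp.1.add hc').inner aestronglyMeasurable_const
  have hi : ∀ i, Integrable (fun y => η (x - y) * inner ℝ (U y + (x - y)) (b i) ^ 2) μ := fun i => by
    refine hint.mono' ?_ (.of_forall fun y => ?_)
    · have hc : AEStronglyMeasurable (fun y => η (x - y)) μ :=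
        Continuous.aestronglyMeasurable (by fun_prop)
      exact hc.mul ((hm i).pow 2)
    · rw [Real.norm_of_nonneg (mul_nonneg (hη0 _) (sq_nonneg _))]
      refine mul_le_mul_of_nonneg_left ?_ (hη0 _)
      rw [← sq_abs]
      have := abs_real_inner_le_norm (U y + (x - y)) (b i)
      rw [b.norm_eq_one, mul_one] at this
      gcongr
  calc _ ≤ ∑ i, mollify μ η x * ∫ y, η (x - y) * inner ℝ (U y + (x - y)) (b i) ^ 2 ∂μ := by
        refine Finset.sum_le_sum fun i _ => ?_
        rw [hU.fderiv_mollify hη hs]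
        exact sq_integral_mul_le (fun y => hη0 _) (integrable_comp_sub hηc hs x) (hm i) (hi i)
    _ = _ := by
        rw [← Finset.mul_sum, ← integral_finsetSum _ fun i _ => hi i, mollifySq]
        simp_rw [← Finset.mul_sum, b.sum_sq_inner_left]

end Score

/-! ### Integrals of mollified quantities -/

section ScoreLogSobolev

variable {E : Type*} [NormedAddCommGroup E] [InnerProductSpace ℝ E] [MeasurableSpace E]
  [FiniteDimensional ℝ E] [BorelSpace E] {μ : Measure E} [IsProbabilityMeasure μ]
  {η : E → ℝ}

/-- The change of variable z = x - y at fixed y, which reduces Lebesgue integrals of convolutions to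
integrals over y and z. -/
lemma measurePreserving_shear :
    MeasurePreserving (fun p : E × E => (p.1, p.2 - p.1)) (μ.prod volume) (μ.prod volume) := by
  refine (MeasurePreserving.id μ).skew_product (g := fun y x => x - y) ?_ (.of_forall fun y => ?_)
  · exact (measurable_snd.sub measurable_fst)
  · exact map_sub_right_eq_self volume y

lemma integrable_comp_shear {H : E × E → ℝ} (hH : Integrable H (μ.prod volume)) :
    Integrable (fun p : E × E => H (p.1, p.2 - p.1)) (μ.prod volume) :=
  (measurePreserving_shear (μ := μ)).integrable_comp_of_integrable hH

lemma integral_shear {H : E × E → ℝ} (hH : Integrable H (μ.prod volume)) :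
    ∫ x, ∫ y, H (y, x - y) ∂μ = ∫ y, (∫ z, H (y, z)) ∂μ := by
  have hs := integral_integral_swap (f := fun y x => H (y, x - y)) (integrable_comp_shear hH)
  rw [← hs]
  refine integral_congr_ae (.of_forall fun y => ?_)
  exact integral_sub_right_eq_self (fun z => H (y, z)) y

lemma integrable_mul_mollify_prod (hη : Continuous η) (hs : HasCompactSupport η) {F : E → ℝ}
    (hF : Continuous F) {C : ℝ} (hC : ∀ x, |F x| ≤ C) :
    Integrable (fun p : E × E => F (p.1 + p.2) * η p.2) (μ.prod volume) := by
  have h1 : Integrable (fun p : E × E => (1 : ℝ) * η p.2) (μ.prod volume) :=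
    (integrable_const (1 : ℝ)).mul_prod (hη.integrable_of_hasCompactSupport hs)
  simp only [one_mul] at h1
  exact h1.bdd_mul (Continuous.aestronglyMeasurable (by fun_prop)) (.of_forall fun p => hC _)

lemma integrable_mul_mollify (hη : Continuous η) (hs : HasCompactSupport η) {F : E → ℝ}
    (hF : Continuous F) {C : ℝ} (hC : ∀ x, |F x| ≤ C) :
    Integrable (fun x => F x * mollify μ η x) := by
  have h := (integrable_comp_shear
    (integrable_mul_mollify_prod (μ := μ) hη hs hF hC)).integral_prod_right
  simpa [mollify, integral_const_mul] using h

lemma integral_mul_mollify (hη : Continuous η) (hs : HasCompactSupport η) {F : E → ℝ}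
    (hF : Continuous F) {C : ℝ} (hC : ∀ x, |F x| ≤ C) :
    ∫ x, F x * mollify μ η x = ∫ y, (∫ z, F (y + z) * η z) ∂μ := by
  have h := integral_shear (integrable_mul_mollify_prod (μ := μ) hη hs hF hC)
  simpa [mollify, integral_const_mul] using h

lemma integrable_mollifySq_prod {U : E → E} (hU : MemLp U 2 μ) (hη : Continuous η)
    (hs : HasCompactSupport η) (hη0 : ∀ x, 0 ≤ η x) :
    Integrable (fun p : E × E => η p.2 * ‖U p.1 + p.2‖ ^ 2) (μ.prod volume) := by
  have hη1 : Integrable η := hη.integrable_of_hasCompactSupport hs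
  have h1 := (hU.integrable_norm_pow two_ne_zero).mul_prod hη1
  have hη2 : Integrable fun z => η z * ‖z‖ ^ 2 :=
    (by fun_prop : Continuous fun z => η z * ‖z‖ ^ 2).integrable_of_hasCompactSupport hs.mul_right
  have h2 := (integrable_const (1 : ℝ) (μ := μ)).mul_prod hη2
  refine ((h1.const_mul 2).add (h2.const_mul 2)).mono' ?_ (.of_forall fun p => ?_)
  · have hc : AEStronglyMeasurable (fun p : E × E => η p.2) (μ.prod volume) :=
      Continuous.aestronglyMeasurable (by fun_prop)
    exact hc.mul ((hU.1.comp_fst.add continuous_snd.aestronglyMeasurable).norm.pow 2)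
  · rw [Real.norm_of_nonneg (mul_nonneg (hη0 _) (sq_nonneg _))]
    have := mul_le_mul_of_nonneg_left (norm_add_sq_le_two_mul (U p.1) p.2) (hη0 p.2)
    simp only [Pi.add_apply]
    linarith

lemma integrable_mollifySq_volume {U : E → E} (hU : MemLp U 2 μ) (hη : Continuous η)
    (hs : HasCompactSupport η) (hη0 : ∀ x, 0 ≤ η x) : Integrable (mollifySq μ η U) :=
  (integrable_comp_shear (integrable_mollifySq_prod hU hη hs hη0)).integral_prod_right

lemma norm_add_sq_le_of_pos {a : ℝ} (ha : 0 < a) (x y : E) :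
    ‖x + y‖ ^ 2 ≤ (1 + a) * ‖x‖ ^ 2 + (1 + a⁻¹) * ‖y‖ ^ 2 := by
  have h1 : ‖x + y‖ ^ 2 ≤ (‖x‖ + ‖y‖) ^ 2 := by gcongr; exact norm_add_le x y
  have h2 : 0 ≤ a⁻¹ * (a * ‖x‖ - ‖y‖) ^ 2 := by positivity
  have h3 : a⁻¹ * (a * ‖x‖ - ‖y‖) ^ 2
      = (a⁻¹ * a) * (a * ‖x‖ ^ 2 - 2 * ‖x‖ * ‖y‖) + a⁻¹ * ‖y‖ ^ 2 := by ring
  rw [inv_mul_cancel₀ ha.ne'] at h3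
  nlinarith

/-- The shift x - y in the mollified score has norm at most ε on the support of η. The parameter a
splits the square so that ε can tend to 0 first and a afterwards, which recovers ∫ ‖U‖² dμ with
constant 1. -/
lemma integral_mollifySq_le {U : E → E} (hU : MemLp U 2 μ) (hη : Continuous η)
    (hs : HasCompactSupport η) (hη0 : ∀ x, 0 ≤ η x) (hη1 : ∫ x, η x = 1) {ε : ℝ}
    (hε : ∀ x, η x ≠ 0 → ‖x‖ ≤ ε) {a : ℝ} (ha : 0 < a) :
    ∫ x, mollifySq μ η U x ≤ (1 + a) * ∫ y, ‖U y‖ ^ 2 ∂μ + (1 + a⁻¹) * ε ^ 2 := by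
  have hηi : Integrable η := hη.integrable_of_hasCompactSupport hs
  have hprod := integrable_mollifySq_prod hU hη hs hη0
  have h := integral_shear hprod
  simp only at h
  have hU2 := hU.integrable_norm_pow two_ne_zero
  have hb : Integrable (fun y => (1 + a) * ‖U y‖ ^ 2 + (1 + a⁻¹) * ε ^ 2) μ :=
    (hU2.const_mul (1 + a)).add (integrable_const _)
  calc ∫ x, mollifySq μ η U x = ∫ y, (∫ z, η z * ‖U y + z‖ ^ 2) ∂μ := h
    _ ≤ ∫ y, ((1 + a) * ‖U y‖ ^ 2 + (1 + a⁻¹) * ε ^ 2) ∂μ := by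
      refine integral_mono_ae hprod.integral_prod_left hb ?_
      filter_upwards [hprod.prod_right_ae] with y hy
      calc ∫ z, η z * ‖U y + z‖ ^ 2
          ≤ ∫ z, η z * ((1 + a) * ‖U y‖ ^ 2 + (1 + a⁻¹) * ε ^ 2) := by
            refine integral_mono hy (hηi.mul_const _) fun z => ?_
            by_cases hz : η z = 0
            · simp [hz]
            · refine mul_le_mul_of_nonneg_left ?_ (hη0 z)
              refine (norm_add_sq_le_of_pos ha _ _).trans ?_
              have := hε z hz
              gcongr
        _ = _ := by rw [integral_mul_const, hη1, one_mul]
    _ = _ := by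
      rw [integral_add (hU2.const_mul _) (integrable_const _), integral_const_mul]; simp

end ScoreLogSobolev

/-! ### The logarithmic Sobolev inequality for a measure with a score -/

section ScoreLogSobolev

variable {E : Type*} [NormedAddCommGroup E] [InnerProductSpace ℝ E] [MeasurableSpace E]
  [FiniteDimensional ℝ E] [BorelSpace E] {μ : Measure E} [IsProbabilityMeasure μ]
  {η : E → ℝ}

lemma integrable_exp_of_bound {Ω : Type*} [MeasurableSpace Ω] {ν : Measure Ω} [IsFiniteMeasure ν]
    {g : Ω → ℝ} (hg : AEStronglyMeasurable g ν) {M : ℝ} (hM : ∀ x, |g x| ≤ M) :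
    Integrable (fun x => Real.exp (g x)) ν := by
  refine Integrable.of_bound (Real.continuous_exp.comp_aestronglyMeasurable hg) (Real.exp M)
    (.of_forall fun x => ?_)
  rw [Real.norm_eq_abs, abs_of_nonneg (Real.exp_pos _).le]
  gcongr
  exact (abs_le.1 (hM x)).2

/-- The squared gradient of `χ √(r / p + κ)` for a cutoff `χ` and the density `r` of a mollified
measure. -/
lemma sum_sq_fderiv_mul_sqrt_le {ι : Type*} [Fintype ι] (b : OrthonormalBasis ι ℝ E)
    {r K χ : E → ℝ} (hr : ContDiff ℝ ∞ r) (hr0 : ∀ x, 0 ≤ r x) (hχ : ContDiff ℝ ∞ χ)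
    (hK0 : ∀ x, 0 ≤ K x) (hχ0 : ∀ x, 0 ≤ χ x) (hχ1 : ∀ x, χ x ≤ 1) {c κ a : ℝ} (hκ : 0 < κ) (ha : 0 < a)
    (hc : ∀ x, ‖fderiv ℝ χ x‖ ≤ c)
    (hK : ∀ x, ∑ i, (fderiv ℝ r x (b i) + inner ℝ x (b i) * r x) ^ 2 ≤ r x * K x) (x : E) :
    ∑ i, fderiv ℝ (fun x => χ x * √(r x / gaussianPdf x + κ)) x (b i) ^ 2
      ≤ (1 + a) / 4 * (K x / gaussianPdf x)
        + (1 + a⁻¹) * (Fintype.card ι * c ^ 2) * (r x / gaussianPdf x + κ) := by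
  set p := gaussianPdf x with hp
  have hp0 : 0 < p := gaussianPdf_pos x
  set f : E → ℝ := fun x => r x / gaussianPdf x with hf
  have hfd : ContDiff ℝ ∞ f := hr.div contDiff_gaussianPdf fun x => (gaussianPdf_pos x).ne'
  have hf0 : ∀ x, 0 ≤ f x := fun x => div_nonneg (hr0 x) (gaussianPdf_pos x).le
  have hF0 : 0 < f x + κ := by linarith [hf0 x]
  have hdf : HasFDerivAt f (fderiv ℝ f x) x := (hfd.differentiable (by simp) x).hasFDerivAt
  -- Differentiate r = f p, using ∇p = -p x.
  have hfv : ∀ v, fderiv ℝ f x v = (fderiv ℝ r x v + inner ℝ x v * r x) / p := by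
    intro v
    have h1 : r = fun x => f x * gaussianPdf x := by
      ext y; simp only [hf]; field_simp [(gaussianPdf_pos y).ne']
    have h2 : HasFDerivAt (fun x => f x * gaussianPdf x) _ x :=
      hdf.mul (hasFDerivAt_gaussianPdf x)
    have h3 : fderiv ℝ r x v = f x * (-(p * inner ℝ x v)) + p * fderiv ℝ f x v := by
      rw [h1, h2.fderiv]; simp [hp]
    rw [h3]
    have h4 : r x = f x * p := by simp only [hf, ← hp]; field_simp
    rw [h4]; field_simp; ring
  have hs0 : 0 < √(f x + κ) := Real.sqrt_pos.2 hF0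
  have hss : √(f x + κ) ^ 2 = f x + κ := Real.sq_sqrt hF0.le
  have hφ : ∀ v, fderiv ℝ (fun x => χ x * √(f x + κ)) x v
      = χ x * (fderiv ℝ f x v / (2 * √(f x + κ))) + √(f x + κ) * fderiv ℝ χ x v := by
    intro v
    have h1 := (hdf.add_const κ).sqrt hF0.ne'
    have h2 : HasFDerivAt (fun x => χ x * √(f x + κ)) _ x :=
      ((hχ.differentiable (by simp) x).hasFDerivAt).mul h1
    rw [h2.fderiv]
    simp only [add_apply, _root_.smul_apply, smul_eq_mul]
    field_simp
  have hterm : ∀ i, fderiv ℝ (fun x => χ x * √(f x + κ)) x (b i) ^ 2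
      ≤ (1 + a) * (fderiv ℝ f x (b i) ^ 2 / (4 * (f x + κ))) + (1 + a⁻¹) * (c ^ 2 * (f x + κ)) := by
    intro i
    rw [hφ]
    have h1 := norm_add_sq_le_of_pos ha (χ x * (fderiv ℝ f x (b i) / (2 * √(f x + κ))))
      (√(f x + κ) * fderiv ℝ χ x (b i))
    simp only [Real.norm_eq_abs, sq_abs] at h1
    refine h1.trans ?_
    have h2 : fderiv ℝ χ x (b i) ^ 2 ≤ c ^ 2 := by
      rw [← sq_abs]
      have := ((fderiv ℝ χ x).le_opNorm (b i)).trans_eq (by rw [b.norm_eq_one, mul_one])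
      exact pow_le_pow_left₀ (abs_nonneg _) (this.trans (hc x)) 2
    have h3 : χ x ^ 2 ≤ 1 := pow_le_one₀ (hχ0 x) (hχ1 x)
    have h4 : (χ x * (fderiv ℝ f x (b i) / (2 * √(f x + κ)))) ^ 2
        = χ x ^ 2 * (fderiv ℝ f x (b i) ^ 2 / (4 * (f x + κ))) := by
      rw [mul_pow, div_pow, mul_pow, hss]; norm_num
    have h5 : 0 ≤ fderiv ℝ f x (b i) ^ 2 / (4 * (f x + κ)) := by positivity
    rw [h4, mul_pow, hss, mul_comm (f x + κ)]
    gcongr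
    exact mul_le_of_le_one_left h5 h3
  refine (Finset.sum_le_sum fun i _ => hterm i).trans ?_
  rw [Finset.sum_add_distrib, ← Finset.mul_sum, ← Finset.sum_div, Finset.sum_const,
    Finset.card_univ, nsmul_eq_mul]
  -- The hypothesis gives ‖∇f‖² ≤ rK / p² = f K / p; enlarging f to f + κ matches the denominator
  -- produced by differentiating √(f + κ).
  have hsum : ∑ i, fderiv ℝ f x (b i) ^ 2 ≤ (f x + κ) * (K x / p) := by
    simp_rw [hfv, div_pow]
    rw [← Finset.sum_div, div_le_iff₀ (by positivity)]
    refine (hK x).trans ?_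
    have h4 : r x = f x * p := by simp only [hf, ← hp]; field_simp
    have h5 : (f x + κ) * (K x / p) * p ^ 2 = (f x * p) * K x + κ * K x * p := by field_simp
    rw [h5, h4]
    have : 0 ≤ κ * K x * p := mul_nonneg (mul_nonneg hκ.le (hK0 x)) hp0.le
    linarith
  have h6 : (∑ i, fderiv ℝ f x (b i) ^ 2) / (4 * (f x + κ)) ≤ (K x / p) / 4 := by
    rw [div_le_iff₀ (by positivity)]
    linarith
  calc _ ≤ (1 + a) * ((K x / p) / 4) + Fintype.card ι * ((1 + a⁻¹) * (c ^ 2 * (f x + κ))) := by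
        gcongr
    _ = _ := by simp only [hf, ← hp]; ring

/-- Logarithmic Sobolev inequality for a regularised measure. -/
lemma logSobolev_mollify_aux {ι : Type*} [Fintype ι] (b : OrthonormalBasis ι ℝ E)
    {r K g : E → ℝ} (hr : ContDiff ℝ ∞ r) (hr0 : ∀ x, 0 ≤ r x) (hri : Integrable r)
    (hr1 : ∫ x, r x = 1) (hKi : Integrable K)
    (hK0 : ∀ x, 0 ≤ K x)
    (hK : ∀ x, ∑ i, (fderiv ℝ r x (b i) + inner ℝ x (b i) * r x) ^ 2 ≤ r x * K x)
    {κ a : ℝ} (hκ : 0 < κ) (ha : 0 < a) (hg : Continuous g) {M : ℝ} (hM : ∀ x, |g x| ≤ M) :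
    (∫ x, g x * r x) + κ * ∫ x, g x ∂(stdGaussian E) ≤ (1 + a) / 2 * (∫ x, K x)
      + (1 + κ) * Real.log (∫ x, Real.exp (g x) ∂(stdGaussian E)) := by
  obtain ⟨χ, C, hC0, hχ, hχs, hχ0, hχ1, hχlim, hχd, -⟩ := exists_cutoff E
  set F : E → ℝ := fun x => r x / gaussianPdf x + κ with hF
  have hpos := gaussianPdf_pos (E := E)
  have hFpos : ∀ x, 0 < F x := fun x => by
    have := div_nonneg (hr0 x) (hpos x).le
    simp only [hF]; linarith
  have hFd : ContDiff ℝ ∞ F := (hr.div contDiff_gaussianPdf fun x => (hpos x).ne').add contDiff_const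
  have hFc := hFd.continuous
  have hrγ : Integrable (fun x => r x / gaussianPdf x) (stdGaussian E) := by
    rw [integrable_stdGaussian_iff]
    refine hri.congr (.of_forall fun x => ?_)
    have := (hpos x).ne'
    simp only [smul_eq_mul]; field_simp
  have hKγ : Integrable (fun x => K x / gaussianPdf x) (stdGaussian E) := by
    rw [integrable_stdGaussian_iff]
    refine hKi.congr (.of_forall fun x => ?_)
    have := (hpos x).ne'
    simp only [smul_eq_mul]; field_simp
  have hFi : Integrable F (stdGaussian E) := hrγ.add (integrable_const κ)
  have hFint : ∫ x, F x ∂(stdGaussian E) = 1 + κ := by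
    rw [integral_add hrγ (integrable_const κ), integral_stdGaussian]
    have : ∀ x, gaussianPdf x • (r x / gaussianPdf x) = r x := fun x => by
      have := (hpos x).ne'
      simp only [smul_eq_mul]; field_simp
    simp only [this, hr1]
    simp
  have hKint : ∫ x, K x / gaussianPdf x ∂(stdGaussian E) = ∫ x, K x := by
    rw [integral_stdGaussian]
    refine integral_congr_ae (.of_forall fun x => ?_)
    have := (hpos x).ne'
    simp only [smul_eq_mul]; field_simp
  have hgF : Integrable (fun x => g x * F x) (stdGaussian E) :=
    hFi.bdd_mul hg.aestronglyMeasurable (.of_forall hM)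
  have hgFint : ∫ x, g x * F x ∂(stdGaussian E)
      = (∫ x, g x * r x) + κ * ∫ x, g x ∂(stdGaussian E) := by
    have h1 : Integrable (fun x => g x * (r x / gaussianPdf x)) (stdGaussian E) :=
      hrγ.bdd_mul hg.aestronglyMeasurable (.of_forall hM)
    have h2 : Integrable (fun x => κ * g x) (stdGaussian E) :=
      (Integrable.of_bound hg.aestronglyMeasurable M (.of_forall hM)).const_mul κ
    have h3 : ∀ x, g x * F x = g x * (r x / gaussianPdf x) + κ * g x := fun x => by
      simp only [hF]; ring
    simp_rw [h3]
    rw [integral_add h1 h2, integral_const_mul, integral_stdGaussian]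
    congr 1
    refine integral_congr_ae (.of_forall fun x => ?_)
    have := (hpos x).ne'
    simp only [smul_eq_mul]; field_simp
  set l := Real.log (∫ x, Real.exp (g x) ∂(stdGaussian E))
  have hk : ∀ k : ℕ, ∫ x, g x * (χ k x ^ 2 * F x) ∂(stdGaussian E)
      ≤ ((1 + a) / 2 * (∫ x, K x)) + 2 * ((1 + a⁻¹) * (Fintype.card ι * (C / (k + 1)) ^ 2) * (1 + κ))
        + (∫ x, χ k x ^ 2 * F x ∂(stdGaussian E)) * l := by
    intro k
    -- The inequality is applied to a cut-off square root of the density; the shift by κ keeps the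
    -- root smooth where r vanishes.
    have hφ : ContDiff ℝ ∞ fun x => χ k x * √(F x) :=
      (hχ k).mul (hFd.sqrt fun x => (hFpos x).ne')
    have h := logSobolev_of_hasCompactSupport b (hφ.of_le (WithTop.coe_le_coe.2 le_top))
      (hχs k).mul_right hg hM
    simp_rw [mul_pow, Real.sq_sqrt (hFpos _).le] at h
    refine h.trans ?_
    gcongr
    have hi1 := hKγ.const_mul ((1 + a) / 4)
    have hi2 := hFi.const_mul ((1 + a⁻¹) * (Fintype.card ι * (C / (k + 1)) ^ 2))
    have hle : ∫ x, ∑ i, fderiv ℝ (fun x => χ k x * √(F x)) x (b i) ^ 2 ∂(stdGaussian E)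
        ≤ ∫ x, ((1 + a) / 4 * (K x / gaussianPdf x)
          + (1 + a⁻¹) * (Fintype.card ι * (C / (k + 1)) ^ 2) * F x) ∂(stdGaussian E) := by
      refine integral_mono_of_nonneg (.of_forall fun x => Finset.sum_nonneg fun i _ => sq_nonneg _)
        (hi1.add hi2) (.of_forall fun x => ?_)
      exact sum_sq_fderiv_mul_sqrt_le b hr hr0 (hχ k) hK0 (hχ0 k) (hχ1 k) hκ ha (hχd k) hK x
    rw [integral_add hi1 hi2, integral_const_mul, integral_const_mul, hKint, hFint] at hle
    linarith
  have hχb : ∀ k x, |χ k x ^ 2| ≤ 1 := fun k x => by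
    rw [abs_of_nonneg (sq_nonneg _)]; exact pow_le_one₀ (hχ0 k x) (hχ1 k x)
  have t1 : Tendsto (fun k => ∫ x, g x * (χ k x ^ 2 * F x) ∂(stdGaussian E)) atTop
      (𝓝 (∫ x, g x * F x ∂(stdGaussian E))) := by
    refine tendsto_integral_of_dominated_convergence (fun x => ‖g x * F x‖) (fun k => ?_) hgF.norm
      (fun k => .of_forall fun x => ?_) (.of_forall fun x => ?_)
    · have := (hχ k).continuous
      exact Continuous.aestronglyMeasurable (by fun_prop)
    · rw [mul_left_comm, norm_mul]
      exact mul_le_of_le_one_left (norm_nonneg _) (hχb k x)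
    · refine tendsto_const_nhds.congr' ?_
      filter_upwards [hχlim x] with k hk
      simp [hk]
  have t2 : Tendsto (fun k => ∫ x, χ k x ^ 2 * F x ∂(stdGaussian E)) atTop (𝓝 (1 + κ)) := by
    rw [← hFint]
    refine tendsto_integral_of_dominated_convergence (fun x => ‖F x‖) (fun k => ?_) hFi.norm
      (fun k => .of_forall fun x => ?_) (.of_forall fun x => ?_)
    · have := (hχ k).continuous
      exact Continuous.aestronglyMeasurable (by fun_prop)
    · rw [norm_mul]
      exact mul_le_of_le_one_left (norm_nonneg _) (hχb k x)
    · refine tendsto_const_nhds.congr' ?_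
      filter_upwards [hχlim x] with k hk
      simp [hk]
  have t3 : Tendsto (fun k : ℕ => C / ((k : ℝ) + 1)) atTop (𝓝 0) :=
    by
    simpa [div_eq_mul_inv] using (tendsto_one_div_add_atTop_nhds_zero_nat (𝕜 := ℝ)).const_mul C
  have t4 := (((((t3.pow 2).const_mul (Fintype.card ι : ℝ)).const_mul (1 + a⁻¹)).mul_const
    (1 + κ)).const_mul 2).const_add ((1 + a) / 2 * (∫ x, K x))
  have := le_of_tendsto_of_tendsto' t1 (t4.add (t2.mul_const l)) hk
  rw [hgFint] at this
  simpa using this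

/-- The logarithmic Sobolev inequality, in dual form, for a measure with a score. -/
theorem IsScore.logSobolev {U : E → E} (hU : IsScore μ U) {g : E → ℝ} (hg : Continuous g) {M : ℝ}
    (hM : ∀ x, |g x| ≤ M) :
    ∫ x, g x ∂μ ≤ 2⁻¹ * ∫ x, ‖U x‖ ^ 2 ∂μ
      + Real.log (∫ x, Real.exp (g x) ∂(stdGaussian E)) := by
  let B : ℕ → ContDiffBump (0 : E) := fun k =>
    ⟨((k : ℝ) + 1)⁻¹ / 2, ((k : ℝ) + 1)⁻¹, by positivity, half_lt_self (by positivity)⟩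
  set l := Real.log (∫ x, Real.exp (g x) ∂(stdGaussian E))
  have hη : ∀ k, ContDiff ℝ ∞ ((B k).normed volume) := fun k => (B k).contDiff_normed
  have hηs : ∀ k, HasCompactSupport ((B k).normed volume) := fun k => (B k).hasCompactSupport_normed
  have hη0 : ∀ k x, 0 ≤ (B k).normed volume x := fun k x => (B k).nonneg_normed x
  have hη1 : ∀ k, ∫ x, (B k).normed volume x = 1 := fun k => (B k).integral_normed
  have hηε : ∀ k x, (B k).normed volume x ≠ 0 → ‖x‖ ≤ ((k : ℝ) + 1)⁻¹ := fun k x hx => by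
    have h : x ∈ Function.support ((B k).normed volume) := hx
    rw [(B k).support_normed_eq] at h
    simpa using (mem_ball_zero_iff.1 h).le
  -- Three limits in this order: κ → 0 inside this bound, then k → ∞ at fixed a, so that (1 + a⁻¹) /
  -- (k + 1)² disappears, and finally a → 0.
  have hk : ∀ (k : ℕ) (a : ℝ), 0 < a → ∫ x, g x * mollify μ ((B k).normed volume) x
      ≤ (1 + a) / 2 * ((1 + a) * ∫ y, ‖U y‖ ^ 2 ∂μ + (1 + a⁻¹) * ((k : ℝ) + 1)⁻¹ ^ 2) + l := by
    intro k a ha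
    have hr0 : ∀ x, 0 ≤ mollify μ ((B k).normed volume) x := fun x =>
      integral_nonneg fun y => hη0 k _
    have hri : Integrable (mollify μ ((B k).normed volume)) := by
      simpa using integrable_mul_mollify (μ := μ) (hη k).continuous (hηs k)
        (continuous_const (y := (1 : ℝ))) (C := 1) (by simp)
    have hr1 : ∫ x, mollify μ ((B k).normed volume) x = 1 := by
      simpa [hη1] using integral_mul_mollify (μ := μ) (hη k).continuous (hηs k)
        (continuous_const (y := (1 : ℝ))) (C := 1) (by simp)
    have hKi := integrable_mollifySq_volume hU.memLp (hη k).continuous (hηs k) (hη0 k)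
    have hK := hU.sum_sq_fderiv_mollify_le (stdOrthonormalBasis ℝ E) (hη k) (hηs k) (hη0 k)
    have hK0 : ∀ x, 0 ≤ mollifySq μ ((B k).normed volume) U x := fun x =>
      integral_nonneg fun y => mul_nonneg (hη0 k _) (sq_nonneg _)
    have hle := integral_mollifySq_le hU.memLp (hη k).continuous (hηs k) (hη0 k) (hη1 k) (hηε k) ha
    have h1 : ∀ κ : ℝ, 0 < κ → _ := fun κ hκ => logSobolev_mollify_aux (stdOrthonormalBasis ℝ E)
      (contDiff_mollify (hη k) (hηs k)) hr0 hri hr1 hKi hK0 hK hκ ha hg hM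
    have t1 : Tendsto (fun κ : ℝ => (∫ x, g x * mollify μ ((B k).normed volume) x)
        + κ * ∫ x, g x ∂(stdGaussian E)) (𝓝[>] 0)
        (𝓝 ((∫ x, g x * mollify μ ((B k).normed volume) x) + 0 * ∫ x, g x ∂(stdGaussian E))) :=
      tendsto_nhdsWithin_of_tendsto_nhds (Continuous.tendsto (by fun_prop) _)
    have t2 : Tendsto (fun κ : ℝ => (1 + a) / 2 * (∫ x, mollifySq μ ((B k).normed volume) U x)
        + (1 + κ) * l) (𝓝[>] 0)
        (𝓝 ((1 + a) / 2 * (∫ x, mollifySq μ ((B k).normed volume) U x) + (1 + 0) * l)) :=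
      tendsto_nhdsWithin_of_tendsto_nhds (Continuous.tendsto (by fun_prop) _)
    have h2 := le_of_tendsto_of_tendsto t1 t2 (by
      filter_upwards [self_mem_nhdsWithin] with κ hκ using h1 κ hκ)
    simp only [zero_mul, add_zero, one_mul] at h2
    refine h2.trans ?_
    gcongr
  have hlim : Tendsto (fun k => ∫ x, g x * mollify μ ((B k).normed volume) x) atTop
      (𝓝 (∫ x, g x ∂μ)) := by
    simp_rw [integral_mul_mollify (hη _).continuous (hηs _) hg hM]
    refine tendsto_integral_of_dominated_convergence (fun _ => M) (fun k => ?_)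
      (integrable_const M) (fun k => .of_forall fun y => ?_) (.of_forall fun y => ?_)
    · exact (integrable_mul_mollify_prod (hη k).continuous (hηs k) hg hM).integral_prod_left.1
    · have hi : Integrable ((B k).normed volume) := (B k).integrable_normed
      calc ‖∫ z, g (y + z) * (B k).normed volume z‖
          ≤ ∫ z, M * (B k).normed volume z := by
            refine norm_integral_le_of_norm_le (hi.const_mul M) (.of_forall fun z => ?_)
            rw [norm_mul, Real.norm_of_nonneg (hη0 k z)]
            exact mul_le_mul_of_nonneg_right (hM _) (hη0 k z)
        _ = M := by rw [integral_const_mul, hη1, mul_one]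
    · have hrad : Tendsto (fun k => (B k).rOut) atTop (𝓝 0) := by
        simpa [B] using tendsto_one_div_add_atTop_nhds_zero_nat (𝕜 := ℝ)
      have h := ContDiffBump.convolution_tendsto_right_of_continuous (μ := volume) hrad hg y
      refine h.congr fun k => ?_
      rw [convolution_def, ← integral_neg_eq_self]
      refine integral_congr_ae (.of_forall fun z => ?_)
      simp [ContDiffBump.normed_neg, mul_comm]
  have ha : ∀ a : ℝ, 0 < a → ∫ x, g x ∂μ ≤ (1 + a) / 2 * ((1 + a) * ∫ y, ‖U y‖ ^ 2 ∂μ) + l := by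
    intro a ha
    have t : Tendsto (fun k : ℕ => ((k : ℝ) + 1)⁻¹) atTop (𝓝 0) := by
      simpa using tendsto_one_div_add_atTop_nhds_zero_nat (𝕜 := ℝ)
    have t' := ((((t.pow 2).const_mul (1 + a⁻¹)).const_add
      ((1 + a) * ∫ y, ‖U y‖ ^ 2 ∂μ)).const_mul ((1 + a) / 2)).add_const l
    have := le_of_tendsto_of_tendsto' hlim t' fun k => hk k a ha
    simpa using this
  have t : Tendsto (fun a : ℝ => (1 + a) / 2 * ((1 + a) * ∫ y, ‖U y‖ ^ 2 ∂μ) + l) (𝓝[>] 0)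
      (𝓝 ((1 + 0) / 2 * ((1 + 0) * ∫ y, ‖U y‖ ^ 2 ∂μ) + l)) :=
    tendsto_nhdsWithin_of_tendsto_nhds (Continuous.tendsto (by fun_prop) _)
  have := ge_of_tendsto t (by filter_upwards [self_mem_nhdsWithin] with a h using ha a h)
  simpa using this

end ScoreLogSobolev

/-! ### Diagonal operators and the Gaussian measures they produce -/

section Diagonal

variable {E : Type*} [NormedAddCommGroup E] [InnerProductSpace ℝ E]
  {ι : Type*} [Fintype ι] (b : OrthonormalBasis ι ℝ E)

/-- The operator which is diagonal in the orthonormal basis `b`, with eigenvalues `s`. -/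
def diagCLM (s : ι → ℝ) : E →L[ℝ] E := ∑ i, s i • (innerSL ℝ (b i)).smulRight (b i)

lemma diagCLM_apply (s : ι → ℝ) (x : E) : diagCLM b s x = ∑ i, (s i * inner ℝ (b i) x) • b i := by
  simp [diagCLM, smul_smul]

lemma inner_diagCLM (s : ι → ℝ) (x : E) (j : ι) :
    inner ℝ (b j) (diagCLM b s x) = s j * inner ℝ (b j) x := by
  classical
  simp [diagCLM_apply, inner_sum, real_inner_smul_right, b.inner_eq_ite]

lemma inner_diagCLM_comm (s : ι → ℝ) (x y : E) :
    inner ℝ (diagCLM b s x) y = inner ℝ x (diagCLM b s y) := by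
  simp only [diagCLM_apply, sum_inner, inner_sum, real_inner_smul_left, real_inner_smul_right]
  refine Finset.sum_congr rfl fun i _ => ?_
  rw [real_inner_comm x (b i)]
  ring

lemma diagCLM_diagCLM {s t : ι → ℝ} (h : ∀ i, s i * t i = 1) (x : E) :
    diagCLM b s (diagCLM b t x) = x := by
  rw [diagCLM_apply]
  simp_rw [inner_diagCLM, ← mul_assoc, h, one_mul]
  exact b.sum_repr' x

lemma norm_sq_diagCLM (s : ι → ℝ) (x : E) :
    ‖diagCLM b s x‖ ^ 2 = ∑ i, s i ^ 2 * inner ℝ (b i) x ^ 2 := by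
  rw [← b.sum_sq_inner_right]
  simp_rw [inner_diagCLM, mul_pow]

lemma det_diagCLM (s : ι → ℝ) : LinearMap.det (diagCLM b s : E →ₗ[ℝ] E) = ∏ i, s i := by
  classical
  rw [← LinearMap.det_toMatrix b.toBasis]
  have : LinearMap.toMatrix b.toBasis b.toBasis (diagCLM b s : E →ₗ[ℝ] E) = Matrix.diagonal s := by
    ext i j
    rw [LinearMap.toMatrix_apply, b.coe_toBasis, b.coe_toBasis_repr_apply, b.repr_apply_apply]
    simp only [ContinuousLinearMap.coe_coe, inner_diagCLM, b.inner_eq_ite, Matrix.diagonal_apply]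
    simp
  rw [this, Matrix.det_diagonal]

variable [FiniteDimensional ℝ E] [MeasurableSpace E] [BorelSpace E]

/-- The density relative to the standard Gaussian measure of the Gaussian measure with mean `m` and
covariance operator `(diagCLM b s) ^ 2`. -/
def diagDensity (s : ι → ℝ) (m x : E) : ℝ :=
  (∏ i, s i)⁻¹ * Real.exp (2⁻¹ * ‖x‖ ^ 2 - 2⁻¹ * ‖diagCLM b (fun i => (s i)⁻¹) (x - m)‖ ^ 2)

/-- The affine map multiplies Lebesgue measure by ∏ s_i⁻¹, and the rest is a quotient of Gaussian
densities. It serves both to change variables in the exponential integral (with m = 0) and to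
compute Gaussian deficits. -/
lemma map_stdGaussian_diagCLM {s : ι → ℝ} (hs : ∀ i, 0 < s i) (m : E) :
    (stdGaussian E).map (fun x => m + diagCLM b s x) =
      (stdGaussian E).withDensity fun x => ENNReal.ofReal (diagDensity b s m x) := by
  have hdet : LinearMap.det (diagCLM b s : E →ₗ[ℝ] E) ≠ 0 := by
    rw [det_diagCLM]; exact Finset.prod_ne_zero_iff.2 fun i _ => (hs i).ne'
  have hP : 0 < ∏ i, s i := Finset.prod_pos fun i _ => hs i
  have hvol : (volume : Measure E).map (fun x => m + diagCLM b s x)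
      = ENNReal.ofReal (∏ i, s i)⁻¹ • volume := by
    have h1 := Measure.map_linearMap_addHaar_eq_smul_addHaar (volume : Measure E) hdet
    rw [det_diagCLM, abs_of_pos (inv_pos.2 hP)] at h1
    have h2 : (fun x => m + diagCLM b s x) = (fun x => m + x) ∘ (diagCLM b s : E →ₗ[ℝ] E) := rfl
    rw [h2, ← Measure.map_map (measurable_const_add m) (diagCLM b s : E →ₗ[ℝ] E).continuous_of_finiteDimensional.measurable, h1, Measure.map_smul,
      map_add_left_eq_self]
  have hinv : ∀ x, diagCLM b (fun i => (s i)⁻¹) (m + diagCLM b s x - m) = x := fun x => by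
    rw [add_sub_cancel_left]
    exact diagCLM_diagCLM b (fun i => inv_mul_cancel₀ (hs i).ne') x
  have hT : Measurable fun x => m + diagCLM b s x := by fun_prop
  have hdm : Measurable fun x => ENNReal.ofReal (diagDensity b s m x) := by
    unfold diagDensity; fun_prop
  have hpm : Measurable fun x : E => ENNReal.ofReal (gaussianPdf x) :=
    continuous_gaussianPdf.measurable.ennreal_ofReal
  refine Measure.ext fun S hS => ?_
  rw [Measure.map_apply hT hS, ← lintegral_indicator_one (hT hS), lintegral_stdGaussian
    (measurable_one.indicator (hT hS)).aemeasurable, withDensity_apply _ hS,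
    ← lintegral_indicator hS, lintegral_stdGaussian (hdm.indicator hS).aemeasurable]
  set G : E → ℝ≥0∞ := fun y => ENNReal.ofReal
    (gaussianPdf (diagCLM b (fun i => (s i)⁻¹) (y - m))) * S.indicator 1 y with hG
  have hGm : Measurable G := (hpm.comp (by fun_prop)).mul (measurable_one.indicator hS)
  calc _ = ∫⁻ x, G (m + diagCLM b s x) := by
        refine lintegral_congr fun x => ?_
        simp only [hG, hinv]
        rfl
    _ = ∫⁻ y, ENNReal.ofReal (∏ i, s i)⁻¹ * G y := by
        rw [← lintegral_map hGm hT, hvol, lintegral_smul_measure, lintegral_const_mul _ hGm,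
          smul_eq_mul]
    _ = _ := by
        refine lintegral_congr fun y => ?_
        by_cases hy : y ∈ S
        · simp only [hG, Set.indicator_of_mem hy, Pi.one_apply, mul_one]
          rw [← ENNReal.ofReal_mul (inv_pos.2 hP).le, ← ENNReal.ofReal_mul (gaussianPdf_pos y).le]
          congr 1
          simp only [gaussianPdf, diagDensity]
          have he : Real.exp (-‖diagCLM b (fun i => (s i)⁻¹) (y - m)‖ ^ 2 / 2)
              = Real.exp (-‖y‖ ^ 2 / 2) * Real.exp (2⁻¹ * ‖y‖ ^ 2
                - 2⁻¹ * ‖diagCLM b (fun i => (s i)⁻¹) (y - m)‖ ^ 2) := by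
            rw [← Real.exp_add]; ring_nf
          rw [he]
          ring
        · simp [hG, hy]

end Diagonal

/-! ### From dual bounds to relative entropy -/

section Dual

variable {E : Type*} [NormedAddCommGroup E] [MeasurableSpace E] [BorelSpace E]
   {μ ν : Measure E} [IsProbabilityMeasure μ] [IsProbabilityMeasure ν]

lemma abs_clip_sub_le {M x y : ℝ} (hx : |x| ≤ M) : |max (-M) (min y M) - x| ≤ |y - x| := by
  have := abs_le.1 hx
  have hx' : max (-M) (min x M) = x := by rw [min_eq_left this.2, max_eq_right this.1]
  calc |max (-M) (min y M) - x| = |max (-M) (min y M) - max (-M) (min x M)| := by rw [hx']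
    _ ≤ |min y M - min x M| := by
      rw [max_comm, max_comm (-M)]; exact abs_max_sub_max_le_abs _ _ _
    _ ≤ |y - x| := by simpa using abs_min_sub_min_le_max y M x M

lemma abs_clip_le {M y : ℝ} (hM : 0 ≤ M) : |max (-M) (min y M)| ≤ M :=
  abs_le.2 ⟨le_max_left _ _, max_le (by linarith) (min_le_right _ _)⟩

lemma abs_exp_sub_exp_le {M x y : ℝ} (hx : |x| ≤ M) (hy : |y| ≤ M) :
    |Real.exp x - Real.exp y| ≤ Real.exp M * |x - y| := by
  wlog h : y ≤ x generalizing x y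
  · rw [abs_sub_comm, abs_sub_comm x]; exact this hy hx (not_le.1 h).le
  rw [abs_of_nonneg (by simpa using h), abs_of_nonneg (by simpa using h)]
  have h1 : Real.exp x - Real.exp y = Real.exp x * (1 - Real.exp (-(x - y))) := by
    rw [mul_sub, ← Real.exp_add]; ring_nf
  rw [h1]
  have := Real.add_one_le_exp (-(x - y))
  have h2 := (abs_le.1 hx).2
  have h3 : 0 ≤ x - y := by linarith
  have h4 : 1 - Real.exp (-(x - y)) ≤ x - y := by linarith
  calc _ ≤ Real.exp x * (x - y) := by gcongr
    _ ≤ _ := by gcongr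

/-- A dual entropy bound extends from bounded continuous to bounded measurable functions. -/
lemma dual_bound_of_continuous {B : ℝ}
    (h : ∀ (g : E → ℝ) (M : ℝ), Continuous g → (∀ x, |g x| ≤ M) →
      ∫ x, g x ∂μ ≤ B + Real.log (∫ x, Real.exp (g x) ∂ν))
    {g : E → ℝ} (hg : Measurable g) {M : ℝ} (hM : ∀ x, |g x| ≤ M) :
    ∫ x, g x ∂μ ≤ B + Real.log (∫ x, Real.exp (g x) ∂ν) := by
  have hM0 : 0 ≤ M := (abs_nonneg _).trans (hM 0)
  -- Approximating in L¹(μ + ν) makes one sequence work for both integrals; clipping at ±M keeps the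
  -- approximants bounded without worsening the error.
  have hgi : Integrable g (μ + ν) := Integrable.of_bound hg.aestronglyMeasurable M (.of_forall hM)
  have hex : ∀ k : ℕ, ∃ f : E → ℝ, Continuous f ∧ (∀ x, |f x| ≤ M) ∧
      ∫ x, |f x - g x| ∂(μ + ν) ≤ ((k : ℝ) + 1)⁻¹ := by
    intro k
    obtain ⟨f, hf, hfi⟩ := hgi.exists_boundedContinuous_integral_sub_le
      (ε := ((k : ℝ) + 1)⁻¹) (by positivity)
    refine ⟨fun x => max (-M) (min (f x) M), by fun_prop, fun x => abs_clip_le hM0, ?_⟩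
    refine le_trans ?_ hf
    refine integral_mono_of_nonneg (.of_forall fun x => abs_nonneg _) (hgi.sub hfi).norm
      (.of_forall fun x => ?_)
    simp only [Real.norm_eq_abs]
    rw [abs_sub_comm (g x)]
    exact abs_clip_sub_le (hM x)
  choose f hfc hfM hfi using hex
  have hlim0 : Tendsto (fun k : ℕ => ((k : ℝ) + 1)⁻¹) atTop (𝓝 0) := by
    simpa using tendsto_one_div_add_atTop_nhds_zero_nat (𝕜 := ℝ)
  have hfint : ∀ (ρ : Measure E) [IsFiniteMeasure ρ] k, Integrable (f k) ρ := fun ρ _ k =>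
    Integrable.of_bound (hfc k).aestronglyMeasurable M (.of_forall (hfM k))
  have hgint : ∀ (ρ : Measure E) [IsFiniteMeasure ρ], Integrable g ρ := fun ρ _ =>
    Integrable.of_bound hg.aestronglyMeasurable M (.of_forall hM)
  have hsum : ∀ k, ∫ x, |f k x - g x| ∂μ + ∫ x, |f k x - g x| ∂ν ≤ ((k : ℝ) + 1)⁻¹ := fun k => by
    have h1 : Integrable (fun x => |f k x - g x|) μ := ((hfint μ k).sub (hgint μ)).abs
    have h2 : Integrable (fun x => |f k x - g x|) ν := ((hfint ν k).sub (hgint ν)).abs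
    rw [← integral_add_measure h1 h2]
    exact hfi k
  have t1 : Tendsto (fun k => ∫ x, f k x ∂μ) atTop (𝓝 (∫ x, g x ∂μ)) := by
    rw [tendsto_iff_norm_sub_tendsto_zero]
    refine squeeze_zero (fun _ => norm_nonneg _) (fun k => ?_) hlim0
    rw [← integral_sub (hfint μ k) (hgint μ)]
    refine (norm_integral_le_integral_norm _).trans ?_
    have : 0 ≤ ∫ x, |f k x - g x| ∂ν := integral_nonneg fun x => abs_nonneg _
    simp only [Real.norm_eq_abs]
    linarith [hsum k]
  have t2 : Tendsto (fun k => ∫ x, Real.exp (f k x) ∂ν) atTop (𝓝 (∫ x, Real.exp (g x) ∂ν)) := by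
    rw [tendsto_iff_norm_sub_tendsto_zero]
    have := hlim0.const_mul (Real.exp M)
    rw [mul_zero] at this
    refine squeeze_zero (fun _ => norm_nonneg _) (fun k => ?_) this
    rw [← integral_sub (integrable_exp_of_bound (hfc k).aestronglyMeasurable (hfM k))
      (integrable_exp_of_bound hg.aestronglyMeasurable hM)]
    calc _ ≤ ∫ x, Real.exp M * |f k x - g x| ∂ν := by
          refine norm_integral_le_of_norm_le
            (((hfint ν k).sub (hgint ν)).abs.const_mul _) (.of_forall fun x => ?_)
          exact abs_exp_sub_exp_le (hfM k x) (hM x)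
      _ ≤ _ := by
          rw [integral_const_mul]
          have : 0 ≤ ∫ x, |f k x - g x| ∂μ := integral_nonneg fun x => abs_nonneg _
          gcongr
          linarith [hsum k]
  have hpos : 0 < ∫ x, Real.exp (g x) ∂ν :=
    integral_exp_pos (integrable_exp_of_bound hg.aestronglyMeasurable hM)
  exact le_of_tendsto_of_tendsto' t1 ((t2.log hpos.ne').const_add B)
    fun k => h (f k) M (hfc k) (hfM k)

/-- A dual entropy bound extends to test functions whose negative part is bounded. -/
lemma dual_bound_add_nonneg {Ω : Type*} [MeasurableSpace Ω] {μ ν : Measure Ω}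
    [IsProbabilityMeasure μ] [IsProbabilityMeasure ν] {B : ℝ}
    (h : ∀ (g : Ω → ℝ) (M : ℝ), Measurable g → (∀ x, |g x| ≤ M) →
      ∫ x, g x ∂μ ≤ B + Real.log (∫ x, Real.exp (g x) ∂ν))
    {g q : Ω → ℝ} (hg : Measurable g) {M : ℝ} (hM : ∀ x, |g x| ≤ M) (hq : Measurable q)
    (hq0 : ∀ x, 0 ≤ q x) (hqi : Integrable q μ) (hqe : Integrable (fun x => Real.exp (q x)) ν) :
    ∫ x, (g x + q x) ∂μ ≤ B + Real.log (∫ x, Real.exp (g x + q x) ∂ν) := by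
  have hgi : Integrable g μ := Integrable.of_bound hg.aestronglyMeasurable M (.of_forall hM)
  have hei : Integrable (fun x => Real.exp (g x + q x)) ν := by
    simp_rw [Real.exp_add]
    refine hqe.bdd_mul (c := Real.exp M) (by fun_prop) (.of_forall fun x => ?_)
    rw [Real.norm_eq_abs, abs_of_nonneg (Real.exp_pos _).le]
    gcongr
    exact (abs_le.1 (hM x)).2
  have hmin : ∀ x, ∀ᶠ k : ℕ in atTop, min (q x) k = q x := fun x => by
    filter_upwards [eventually_ge_atTop ⌈q x⌉₊] with k hk
    exact min_eq_left ((Nat.le_ceil _).trans (by exact_mod_cast hk))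
  have hmin0 : ∀ (k : ℕ) x, 0 ≤ min (q x) (k : ℝ) := fun k x => le_min (hq0 x) (Nat.cast_nonneg k)
  have t1 : Tendsto (fun k : ℕ => ∫ x, (g x + min (q x) k) ∂μ) atTop
      (𝓝 (∫ x, (g x + q x) ∂μ)) := by
    refine tendsto_integral_of_dominated_convergence (fun x => M + q x) (fun k => by fun_prop)
      ((integrable_const M).add hqi) (fun k => .of_forall fun x => ?_) (.of_forall fun x => ?_)
    · refine (norm_add_le _ _).trans (add_le_add (hM x) ?_)
      rw [Real.norm_of_nonneg (hmin0 k x)]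
      exact min_le_left _ _
    · refine tendsto_const_nhds.congr' ?_
      filter_upwards [hmin x] with k hk
      rw [hk]
  have t2 : Tendsto (fun k : ℕ => ∫ x, Real.exp (g x + min (q x) k) ∂ν) atTop
      (𝓝 (∫ x, Real.exp (g x + q x) ∂ν)) := by
    refine tendsto_integral_of_dominated_convergence (fun x => Real.exp (g x + q x))
      (fun k => by fun_prop) hei (fun k => .of_forall fun x => ?_) (.of_forall fun x => ?_)
    · rw [Real.norm_eq_abs, abs_of_nonneg (Real.exp_pos _).le]
      gcongr
      exact min_le_left _ _
    · refine tendsto_const_nhds.congr' ?_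
      filter_upwards [hmin x] with k hk
      rw [hk]
  refine le_of_tendsto_of_tendsto' t1 ((t2.log (integral_exp_pos hei).ne').const_add B)
    fun k => h _ (M + k) (by fun_prop) fun x => ?_
  refine (abs_add_le _ _).trans (add_le_add (hM x) ?_)
  rw [abs_of_nonneg (hmin0 k x)]
  exact min_le_right _ _

/-- A dual entropy bound controls the relative entropy. -/
lemma klDiv_le_of_dual_bound {Ω : Type*} [MeasurableSpace Ω] {μ ν : Measure Ω}
    [IsProbabilityMeasure μ] [IsProbabilityMeasure ν] (hμν : μ ≪ ν) {B : ℝ}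
    (h : ∀ (g : Ω → ℝ) (M : ℝ), Measurable g → (∀ x, |g x| ≤ M) →
      ∫ x, g x ∂μ ≤ B + Real.log (∫ x, Real.exp (g x) ∂ν)) :
    InformationTheory.klDiv μ ν ≤ ENNReal.ofReal B := by
  have hf0 : ∀ x, 0 ≤ (μ.rnDeriv ν x).toReal := fun x => ENNReal.toReal_nonneg
  set f : Ω → ℝ := fun x => (μ.rnDeriv ν x).toReal with hf
  have hfm : Measurable f := (Measure.measurable_rnDeriv μ ν).ennreal_toReal
  -- The optimal test function is log f; clipping f to [e^{-k}, e^k] makes it bounded.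
  set y : ℕ → Ω → ℝ := fun k x => max (Real.exp (-k)) (min (f x) (Real.exp k)) with hy
  have hym : ∀ k, Measurable (y k) := fun k => by fun_prop
  have hlow : ∀ (k : ℕ) x, Real.exp (-k) ≤ y k x := fun k x => le_max_left _ _
  have hpos : ∀ k x, 0 < y k x := fun k x => (Real.exp_pos _).trans_le (hlow k x)
  have hup : ∀ (k : ℕ) x, y k x ≤ Real.exp k := fun k x =>
    max_le (Real.exp_le_exp.2 (by linarith [(Nat.cast_nonneg k : (0 : ℝ) ≤ k)])) (min_le_right _ _)
  have hlog : ∀ (k : ℕ) x, |Real.log (y k x)| ≤ k := fun k x => abs_le.2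
    ⟨(Real.le_log_iff_exp_le (hpos k x)).2 (hlow k x), (Real.log_le_iff_le_exp (hpos k x)).2 (hup k x)⟩
  have hyi : ∀ k, Integrable (y k) ν := fun k => Integrable.of_bound (hym k).aestronglyMeasurable
    (Real.exp k) (.of_forall fun x => by rw [Real.norm_of_nonneg (hpos k x).le]; exact hup k x)
  have hli : ∀ k, Integrable (fun x => Real.log (y k x)) μ := fun k =>
    Integrable.of_bound (hym k).log.aestronglyMeasurable k (.of_forall (hlog k))
  have hfli : ∀ k, Integrable (fun x => f x * Real.log (y k x)) ν := fun k => by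
    simpa [hf] using (integrable_rnDeriv_smul_iff hμν).2 (hli k)
  -- The expression equals klFun(y) + (f - y) log y, and clipping gives f - y and log y the same
  -- sign wherever f ≠ y. Nonnegativity is what allows Fatou's lemma below.
  have hnonneg : ∀ (k : ℕ) x, 0 ≤ f x * Real.log (y k x) - y k x + 1 := by
    intro k x
    have h1 := InformationTheory.klFun_nonneg (hpos k x).le
    rw [InformationTheory.klFun_apply] at h1
    have hk0 : (0 : ℝ) ≤ k := Nat.cast_nonneg k
    have h2 : 0 ≤ (f x - y k x) * Real.log (y k x) := by
      rcases le_total (f x) (Real.exp (-k)) with h | h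
      · have : y k x = Real.exp (-k) := by
          simp only [hy]; rw [max_eq_left]; exact (min_le_left _ _).trans h
        rw [this, Real.log_exp]
        exact mul_nonneg_of_nonpos_of_nonpos (by linarith) (by linarith)
      · rcases le_total (f x) (Real.exp k) with h' | h'
        · have : y k x = f x := by simp only [hy]; rw [min_eq_left h', max_eq_right h]
          rw [this]; simp
        · have : y k x = Real.exp k := by
            simp only [hy]; rw [min_eq_right h', max_eq_right (Real.exp_le_exp.2 (by linarith))]
          rw [this, Real.log_exp]
          exact mul_nonneg (by linarith) hk0
    linarith
  have hbound : ∀ k, ∫ x, (f x * Real.log (y k x) - y k x + 1) ∂ν ≤ B := by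
    intro k
    have hi : Integrable (fun x => f x * Real.log (y k x) - y k x) ν := (hfli k).sub (hyi k)
    rw [integral_add hi (integrable_const 1), integral_sub (hfli k) (hyi k)]
    have h1 : ∫ x, f x * Real.log (y k x) ∂ν = ∫ x, Real.log (y k x) ∂μ := by
      simpa [hf] using integral_rnDeriv_smul hμν (f := fun x => Real.log (y k x))
    have h2 := h (fun x => Real.log (y k x)) k (hym k).log (hlog k)
    simp_rw [Real.exp_log (hpos k _)] at h2
    have hp : 0 < ∫ x, y k x ∂ν := by
      have := integral_exp_pos (f := fun x => Real.log (y k x)) (μ := ν)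
        (by simpa only [Real.exp_log (hpos k _)] using hyi k)
      simpa only [Real.exp_log (hpos k _)] using this
    -- The term -∫ y + 1 absorbs log ∫ y, leaving B alone.
    have h3 := Real.log_le_sub_one_of_pos hp
    rw [h1]
    simp
    linarith
  have hexp : Tendsto (fun k : ℕ => Real.exp (-(k : ℝ))) atTop (𝓝 0) :=
    Real.tendsto_exp_neg_atTop_nhds_zero.comp tendsto_natCast_atTop_atTop
  have hlim : ∀ x, Tendsto (fun k => f x * Real.log (y k x) - y k x + 1) atTop
      (𝓝 (InformationTheory.klFun (f x))) := by
    intro x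
    have hylim : Tendsto (fun k => y k x) atTop (𝓝 (f x)) := by
      have h1 : Tendsto (fun k : ℕ => max (Real.exp (-k)) (f x)) atTop (𝓝 (f x)) := by
        have h := hexp.max (tendsto_const_nhds (x := f x))
        rwa [max_eq_right (hf0 x)] at h
      refine h1.congr' ?_
      filter_upwards [(Real.tendsto_exp_atTop.comp tendsto_natCast_atTop_atTop).eventually
        (eventually_ge_atTop (f x))] with k hk
      simp only [hy]
      rw [min_eq_left (show f x ≤ Real.exp k from hk)]
    have h2 : Tendsto (fun k => f x * Real.log (y k x)) atTop (𝓝 (f x * Real.log (f x))) := by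
      by_cases hx : f x = 0
      · simp [hx]
      · exact (hylim.log hx).const_mul _
    rw [InformationTheory.klFun_apply, add_sub_right_comm]
    exact (h2.sub hylim).add_const 1
  rw [InformationTheory.klDiv_eq_lintegral_klFun_of_ac hμν]
  calc _ = ∫⁻ x, liminf (fun k => ENNReal.ofReal (f x * Real.log (y k x) - y k x + 1)) atTop ∂ν := by
        refine lintegral_congr fun x => ?_
        exact ((ENNReal.continuous_ofReal.tendsto _).comp (hlim x)).liminf_eq.symm
    _ ≤ liminf (fun k => ∫⁻ x, ENNReal.ofReal (f x * Real.log (y k x) - y k x + 1) ∂ν) atTop :=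
        lintegral_liminf_le fun k => by fun_prop
    _ ≤ ENNReal.ofReal B := by
        refine liminf_le_of_le (by isBoundedDefault) fun c hc => ?_
        obtain ⟨k, hk⟩ := hc.exists
        refine hk.trans ?_
        have hi : Integrable (fun x => f x * Real.log (y k x) - y k x + 1) ν :=
          ((hfli k).sub (hyi k)).add (integrable_const 1)
        rw [← ofReal_integral_eq_lintegral_ofReal hi (.of_forall (hnonneg k))]
        exact ENNReal.ofReal_le_ofReal (hbound k)

end Dual

/-! ### Integration by parts against affine functions, and scores of images -/

section Scaling

variable {E : Type*} [NormedAddCommGroup E] [InnerProductSpace ℝ E] [MeasurableSpace E]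
  [FiniteDimensional ℝ E] [BorelSpace E] {μ : Measure E} [IsProbabilityMeasure μ]
  {U : E → E}

/-- Integration by parts against a compactly supported multiple of an affine function. -/
lemma IsScore.integral_cutoff_affine (hU : IsScore μ U) (hm : MemLp id 2 μ) {χ : E → ℝ}
    (hχ : ContDiff ℝ ∞ χ) (hχs : HasCompactSupport χ) (v w : E) (c : ℝ) :
    ∫ x, (χ x * (inner ℝ v (U x - x) * (inner ℝ w x + c))
      + (χ x * inner ℝ w v + (inner ℝ w x + c) * fderiv ℝ χ x v)) ∂μ = 0 := by
  have hfd : ∀ x, fderiv ℝ (fun x => χ x * (inner ℝ w x + c)) x v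
      = χ x * inner ℝ w v + (inner ℝ w x + c) * fderiv ℝ χ x v := by
    intro x
    have h1 : HasFDerivAt (fun x => inner ℝ w x + c) (innerSL ℝ w) x :=
      (innerSL ℝ w).hasFDerivAt.add_const c
    have h2 := ((hχ.differentiable (by simp) x).hasFDerivAt).mul h1
    rw [HasFDerivAt.fderiv (f := fun x => χ x * (inner ℝ w x + c)) h2]
    simp
  have hψ : ContDiff ℝ ∞ fun x => χ x * (inner ℝ w x + c) :=
    hχ.mul ((contDiff_const.inner ℝ contDiff_id).add contDiff_const)
  have hψs : HasCompactSupport fun x => χ x * (inner ℝ w x + c) := hχs.mul_right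
  have h := hU.integral_eq _ hψ hψs v
  obtain ⟨D, hD⟩ := hψs.exists_bound_of_continuous hψ.continuous
  have hU1 : Integrable U μ := hU.memLp.integrable (by norm_num)
  have hm1 : Integrable (fun x => x) μ := hm.integrable (by norm_num)
  have hi1 : Integrable (fun x => χ x * (inner ℝ w x + c) * inner ℝ (U x) v) μ :=
    (hU1.inner_const v).bdd_mul hψ.continuous.aestronglyMeasurable (.of_forall hD)
  have hi2 : Integrable (fun x => χ x * (inner ℝ w x + c) * inner ℝ x v) μ :=
    (hm1.inner_const v).bdd_mul hψ.continuous.aestronglyMeasurable (.of_forall hD)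
  have hi3 : Integrable (fun x => fderiv ℝ (fun x => χ x * (inner ℝ w x + c)) x v) μ := by
    have h1 := hψ.continuous_fderiv (by simp)
    have h2 : Continuous fun x => fderiv ℝ (fun x => χ x * (inner ℝ w x + c)) x v := by fun_prop
    exact h2.integrable_of_hasCompactSupport (hψs.fderiv_apply ℝ v)
  rw [integral_sub hi2 hi3] at h
  have hi4 : Integrable (fun x => χ x * (inner ℝ w x + c) * inner ℝ x v
      - fderiv ℝ (fun x => χ x * (inner ℝ w x + c)) x v) μ := hi2.sub hi3
  have h0 : ∫ x, (χ x * (inner ℝ w x + c) * inner ℝ (U x) v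
      - (χ x * (inner ℝ w x + c) * inner ℝ x v
        - fderiv ℝ (fun x => χ x * (inner ℝ w x + c)) x v)) ∂μ = 0 := by
    rw [integral_sub hi1 hi4, h, integral_sub hi2 hi3, sub_self]
  rw [← h0]
  refine integral_congr_ae (.of_forall fun x => ?_)
  simp only [hfd, inner_sub_right, real_inner_comm v]
  ring

/-- Integration by parts against an affine function. -/
lemma IsScore.integral_inner_mul_affine (hU : IsScore μ U) (hm : MemLp id 2 μ) (v w : E) (c : ℝ) :
    ∫ x, inner ℝ v (U x - x) * (inner ℝ w x + c) ∂μ = -inner ℝ v w := by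
  obtain ⟨χ, C, hC0, hχ, hχs, hχ0, hχ1, hχlim, hχd, hχx⟩ := exists_cutoff E
  have hsub : MemLp (fun x => U x - x) 2 μ := hU.memLp.sub hm
  have hUx : MemLp (fun x => inner ℝ v (U x - x)) 2 μ := hsub.const_inner v
  have hmv : MemLp (fun x => inner ℝ w x) 2 μ := hm.const_inner w
  have hl : MemLp (fun x => inner ℝ w x + c) 2 μ := hmv.add (memLp_const c)
  have hprod : Integrable (fun x => inner ℝ v (U x - x) * (inner ℝ w x + c)) μ :=
    hUx.integrable_mul hl
  have hk := fun k => hU.integral_cutoff_affine hm (hχ k) (hχs k) v w c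
  have hlim : Tendsto (fun k => ∫ x, (χ k x * (inner ℝ v (U x - x) * (inner ℝ w x + c))
      + (χ k x * inner ℝ w v + (inner ℝ w x + c) * fderiv ℝ (χ k) x v)) ∂μ) atTop
      (𝓝 (∫ x, (1 * (inner ℝ v (U x - x) * (inner ℝ w x + c))
        + (1 * inner ℝ w v + 0)) ∂μ)) := by
    refine tendsto_integral_of_dominated_convergence
      (fun x => ‖inner ℝ v (U x - x) * (inner ℝ w x + c)‖ + (|inner ℝ w v|
        + (‖w‖ * C + |c| * C) * ‖v‖)) (fun k => ?_) (hprod.norm.add (integrable_const _))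
      (fun k => .of_forall fun x => ?_) (.of_forall fun x => ?_)
    · have hχc := (hχ k).continuous
      have hχc' := (hχ k).continuous_fderiv (by simp)
      have hm1 : AEStronglyMeasurable (χ k) μ := hχc.aestronglyMeasurable
      have hm2 : AEStronglyMeasurable (fun x => χ k x * inner ℝ w v
        + (inner ℝ w x + c) * fderiv ℝ (χ k) x v) μ :=
        Continuous.aestronglyMeasurable (by fun_prop)
      exact (hm1.mul hprod.1).add hm2
    · have hχabs : |χ k x| ≤ 1 := abs_le.2 ⟨by linarith [hχ0 k x], hχ1 k x⟩
      have hd1 : ‖fderiv ℝ (χ k) x‖ ≤ C := (hχd k x).trans (div_le_self hC0 (by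
        have : (0 : ℝ) ≤ k := Nat.cast_nonneg k
        linarith))
      have hw : |inner ℝ w x + c| ≤ ‖w‖ * ‖x‖ + |c| :=
        (abs_add_le _ _).trans (add_le_add (abs_real_inner_le_norm w x) le_rfl)
      -- The affine factor grows linearly; the bound ‖x‖ ‖∇χ_k‖ ≤ C compensates and gives a constant
      -- majorant.
      have hlast : |inner ℝ w x + c| * |fderiv ℝ (χ k) x v| ≤ (‖w‖ * C + |c| * C) * ‖v‖ := by
        calc _ ≤ (‖w‖ * ‖x‖ + |c|) * (‖fderiv ℝ (χ k) x‖ * ‖v‖) := by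
              gcongr
              exact (fderiv ℝ (χ k) x).le_opNorm v
          _ = (‖w‖ * (‖x‖ * ‖fderiv ℝ (χ k) x‖) + |c| * ‖fderiv ℝ (χ k) x‖) * ‖v‖ := by ring
          _ ≤ _ := by
              have := hχx k x
              gcongr
      refine (norm_add_le _ _).trans (add_le_add ?_ ((norm_add_le _ _).trans (add_le_add ?_ ?_)))
      · rw [norm_mul]; exact mul_le_of_le_one_left (norm_nonneg _) hχabs
      · rw [norm_mul]; exact mul_le_of_le_one_left (norm_nonneg _) hχabs
      · rw [norm_mul]; exact hlast
    · have h1 : Tendsto (fun k => χ k x) atTop (𝓝 1) := by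
        refine tendsto_const_nhds.congr' ?_
        filter_upwards [hχlim x] with k hk using hk.symm
      have h2 : Tendsto (fun k => fderiv ℝ (χ k) x v) atTop (𝓝 0) := by
        have t : Tendsto (fun k : ℕ => C / ((k : ℝ) + 1) * ‖v‖) atTop (𝓝 0) := by
          simpa [div_eq_mul_inv] using
            ((tendsto_one_div_add_atTop_nhds_zero_nat (𝕜 := ℝ)).const_mul C).mul_const ‖v‖
        refine squeeze_zero_norm (fun k => ?_) t
        exact ((fderiv ℝ (χ k) x).le_opNorm v).trans (by gcongr; exact hχd k x)
      have h3 := h2.const_mul (inner ℝ w x + c)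
      rw [mul_zero] at h3
      exact (h1.mul_const _).add ((h1.mul_const _).add h3)
  simp_rw [hk] at hlim
  have := tendsto_nhds_unique hlim tendsto_const_nhds
  simp only [one_mul, add_zero] at this
  rw [integral_add hprod (integrable_const _)] at this
  simp only [integral_const, probReal_univ, smul_eq_mul, one_mul] at this
  rw [real_inner_comm w v]
  linarith

lemma measurePreserving_diagCLM_inv {ι : Type*} [Fintype ι] (b : OrthonormalBasis ι ℝ E)
    {s : ι → ℝ} (hs : ∀ i, 0 < s i) :
    MeasurePreserving (diagCLM b fun i => (s i)⁻¹) (μ.map (diagCLM b s)) μ := by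
  refine ⟨by fun_prop, ?_⟩
  rw [Measure.map_map (by fun_prop) (by fun_prop)]
  have : (diagCLM b fun i => (s i)⁻¹) ∘ diagCLM b s = id := by
    ext1 x
    exact diagCLM_diagCLM b (fun i => inv_mul_cancel₀ (hs i).ne') x
  rw [this, Measure.map_id]

/-- The image of a measure with a score under a diagonal operator has a score. -/
lemma IsScore.map_diagCLM {ι : Type*} [Fintype ι] (b : OrthonormalBasis ι ℝ E) (hU : IsScore μ U)
    (hm : MemLp id 2 μ) {s : ι → ℝ} (hs : ∀ i, 0 < s i) :
    IsScore (μ.map (diagCLM b s)) fun y => diagCLM b (fun i => (s i)⁻¹)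
      (U (diagCLM b (fun i => (s i)⁻¹) y) - diagCLM b (fun i => (s i)⁻¹) y) + y := by
  set T := diagCLM b fun i => (s i)⁻¹ with hT
  set S := diagCLM b s with hS
  have hTS : ∀ x, T (S x) = x := fun x =>
    diagCLM_diagCLM b (fun i => inv_mul_cancel₀ (hs i).ne') x
  have hST : ∀ x, S (T x) = x := fun x =>
    diagCLM_diagCLM b (fun i => mul_inv_cancel₀ (hs i).ne') x
  have hmp : MeasurePreserving T (μ.map S) μ := measurePreserving_diagCLM_inv b hs
  have hSm : AEMeasurable S μ := by fun_prop
  have hid : MemLp (fun y => y) 2 (μ.map S) := by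
    rw [memLp_map_measure_iff (g := fun y => y) aestronglyMeasurable_id hSm]
    exact S.comp_memLp' hm
  have hmem : MemLp (fun y => T (U (T y) - T y) + y) 2 (μ.map S) :=
    (T.comp_memLp' ((hU.memLp.sub hm).comp_measurePreserving hmp)).add hid
  refine ⟨hmem, fun ψ hψ hψs v => ?_⟩
  have hψc := hψ.continuous
  have hψc' := hψ.continuous_fderiv (by simp)
  obtain ⟨D, hD⟩ := hψs.exists_bound_of_continuous hψc
  have hm1 : AEStronglyMeasurable (fun y => ψ y * inner ℝ (T (U (T y) - T y) + y) v) (μ.map S) :=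
    hψc.aestronglyMeasurable.mul (hmem.1.inner aestronglyMeasurable_const)
  rw [integral_map hSm hm1, integral_map hSm (Continuous.aestronglyMeasurable (by fun_prop))]
  simp only [hTS]
  have hψ' : ContDiff ℝ ∞ fun x => ψ (S x) := hψ.comp S.contDiff
  have hψs' : HasCompactSupport fun x => ψ (S x) := by
    let e : E ≃ₜ E := ⟨⟨S, T, hTS, hST⟩, S.continuous, T.continuous⟩
    exact hψs.comp_homeomorph e
  -- Pull the test function back by S and differentiate along T v, so that the chain rule returns
  -- the derivative of ψ along v. The part U - x is the Lebesgue score and transforms by T alone;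
  -- the final + y restores the Gaussian reference.
  have h := hU.integral_eq _ hψ' hψs' (T v)
  have hfd : ∀ x, fderiv ℝ (fun x => ψ (S x)) x (T v) = fderiv ℝ ψ (S x) v := fun x => by
    have h2 : HasFDerivAt (fun x => ψ (S x)) _ x :=
      ((hψ.differentiable (by simp) (S x)).hasFDerivAt).comp x S.hasFDerivAt
    rw [h2.fderiv]; simp [hST]
  simp only [hfd] at h
  have hψSm : AEStronglyMeasurable (fun x => ψ (S x)) μ :=
    Continuous.aestronglyMeasurable (by fun_prop)
  have hi1 : Integrable (fun x => ψ (S x) * inner ℝ (U x) (T v)) μ :=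
    ((hU.memLp.integrable (by norm_num)).inner_const _).bdd_mul hψSm (.of_forall fun x => hD _)
  have hi2 : Integrable (fun x => ψ (S x) * inner ℝ x (T v)) μ :=
    ((hm.integrable (by norm_num)).inner_const _).bdd_mul hψSm (.of_forall fun x => hD _)
  have hi3 : Integrable (fun x => fderiv ℝ ψ (S x) v) μ := by
    obtain ⟨D', hD'⟩ := (hψs.fderiv_apply ℝ v).exists_bound_of_continuous (by fun_prop)
    exact Integrable.of_bound (Continuous.aestronglyMeasurable (by fun_prop)) D'
      (.of_forall fun x => hD' _)
  have hi4 : Integrable (fun x => ψ (S x) * inner ℝ (S x) v) μ :=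
    (((S.comp_memLp' hm).integrable (by norm_num)).inner_const _).bdd_mul hψSm
      (.of_forall fun x => hD _)
  have hadj : ∀ x, inner ℝ (T x) v = inner ℝ x (T v) := fun x => inner_diagCLM_comm b _ x v
  have hl : ∀ x, ψ (S x) * inner ℝ (T (U x - x) + S x) v
      = ψ (S x) * inner ℝ (U x) (T v) - ψ (S x) * inner ℝ x (T v)
        + ψ (S x) * inner ℝ (S x) v := fun x => by
    rw [inner_add_left, hadj, inner_sub_left]; ring
  have hi5 : Integrable (fun x => ψ (S x) * inner ℝ (U x) (T v) - ψ (S x) * inner ℝ x (T v)) μ :=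
    hi1.sub hi2
  simp_rw [hl]
  rw [integral_add hi5 hi4, integral_sub hi1 hi2, h, integral_sub hi2 hi3, integral_sub hi4 hi3]
  ring

end Scaling

/-! ### Stretching, Cramér–Rao and the deficit estimate for scores -/

section KeyInequality

variable {E : Type*} [NormedAddCommGroup E] [InnerProductSpace ℝ E] [MeasurableSpace E]
  [FiniteDimensional ℝ E] [BorelSpace E] {μ : Measure E} [IsProbabilityMeasure μ]
  {U : E → E} {ι : Type*} [Fintype ι] (b : OrthonormalBasis ι ℝ E)

lemma integrable_diagDensity {s : ι → ℝ} (hs : ∀ i, 0 < s i) (m : E) :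
    Integrable (diagDensity b s m) (stdGaussian E) := by
  have hd : Measurable (diagDensity b s m) := by unfold diagDensity; fun_prop
  refine ⟨hd.aestronglyMeasurable, ?_⟩
  rw [hasFiniteIntegral_iff_ofReal (.of_forall fun x => ?_)]
  · have h := congrArg (fun ρ => ρ Set.univ) (map_stdGaussian_diagCLM b hs m)
    simp only [withDensity_apply _ MeasurableSet.univ, Measure.restrict_univ] at h
    rw [← h]
    exact measure_lt_top _ _
  · unfold diagDensity
    have : 0 < ∏ i, s i := Finset.prod_pos fun i _ => hs i
    positivity

lemma diagDensity_pos {s : ι → ℝ} (hs : ∀ i, 0 < s i) (m x : E) : 0 < diagDensity b s m x := by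
  unfold diagDensity
  have : 0 < ∏ i, s i := Finset.prod_pos fun i _ => hs i
  positivity

lemma integral_map_diagCLM {s : ι → ℝ} (hs : ∀ i, 0 < s i) (m : E) {F : E → ℝ} (hF : Measurable F) :
    ∫ x, F (m + diagCLM b s x) ∂(stdGaussian E)
      = ∫ x, diagDensity b s m x * F x ∂(stdGaussian E) := by
  have hd : Measurable (diagDensity b s m) := by unfold diagDensity; fun_prop
  rw [← integral_map (φ := fun x => m + diagCLM b s x) (by fun_prop) hF.aestronglyMeasurable,
    map_stdGaussian_diagCLM b hs m,
    integral_withDensity_eq_integral_toReal_smul hd.ennreal_ofReal (by simp)]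
  simp [ENNReal.toReal_ofReal (diagDensity_pos b hs m _).le]

/-- The dual entropy bound obtained by rescaling with a diagonal operator. -/
lemma IsScore.dual_bound (hU : IsScore μ U) (hm : MemLp id 2 μ) {s : ι → ℝ} (hs : ∀ i, 1 ≤ s i)
    {h : E → ℝ} (hh : Measurable h) {M : ℝ} (hM : ∀ x, |h x| ≤ M) :
    ∫ x, h x ∂μ ≤ (2⁻¹ * ∫ x, ‖diagCLM b (fun i => (s i)⁻¹) (U x - x) + diagCLM b s x‖ ^ 2 ∂μ
        - ∫ x, (2⁻¹ * ‖diagCLM b s x‖ ^ 2 - 2⁻¹ * ‖x‖ ^ 2) ∂μ + ∑ i, Real.log (s i))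
      + Real.log (∫ x, Real.exp (h x) ∂(stdGaussian E)) := by
  have hs0 : ∀ i, 0 < s i := fun i => one_pos.trans_le (hs i)
  have hP : 0 < ∏ i, s i := Finset.prod_pos fun i _ => hs0 i
  have hscore := hU.map_diagCLM b hm hs0
  set T := diagCLM b fun i => (s i)⁻¹ with hT
  set S := diagCLM b s with hS
  have hTS : ∀ x, T (S x) = x := fun x =>
    diagCLM_diagCLM b (fun i => inv_mul_cancel₀ (hs0 i).ne') x
  have hSm : AEMeasurable S μ := by fun_prop
  have : IsProbabilityMeasure (μ.map S) := Measure.isProbabilityMeasure_map hSm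
  set V : E → E := fun y => T (U (T y) - T y) + y with hV
  have hV2 : ∫ y, ‖V y‖ ^ 2 ∂(μ.map S) = ∫ x, ‖T (U x - x) + S x‖ ^ 2 ∂μ := by
    have hm1 : AEStronglyMeasurable (fun y => ‖V y‖ ^ 2) (μ.map S) := hscore.memLp.1.norm.pow 2
    rw [integral_map hSm hm1]
    simp only [hV, hTS]
  have hd1 : ∀ (g : E → ℝ) (M : ℝ), Measurable g → (∀ x, |g x| ≤ M) →
      ∫ x, g x ∂(μ.map S) ≤ 2⁻¹ * ∫ y, ‖V y‖ ^ 2 ∂(μ.map S)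
        + Real.log (∫ x, Real.exp (g x) ∂(stdGaussian E)) := fun g M hg hM =>
    dual_bound_of_continuous (fun g M hg hM => hscore.logSobolev hg hM) hg hM
  -- Up to the constant ∑ log s_i, q is the log-density of S_*γ relative to γ. Testing S_*μ with h ∘
  -- T + q thus transports the inequality back to μ. Stretching (s_i ≥ 1) makes q nonnegative, so it
  -- can be truncated from above.
  set q : E → ℝ := fun y => 2⁻¹ * ‖y‖ ^ 2 - 2⁻¹ * ‖T y‖ ^ 2 with hq
  have hq0 : ∀ y, 0 ≤ q y := fun y => by
    have : ‖T y‖ ^ 2 ≤ ‖y‖ ^ 2 := by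
      rw [hT, norm_sq_diagCLM, ← b.sum_sq_inner_right]
      refine Finset.sum_le_sum fun i _ => mul_le_of_le_one_left (sq_nonneg _) ?_
      exact pow_le_one₀ (inv_pos.2 (hs0 i)).le (inv_le_one_of_one_le₀ (hs i))
    simp only [hq]; linarith
  have hqm : Measurable q := by fun_prop
  have hx2 : Integrable (fun x => ‖x‖ ^ 2) μ := hm.integrable_norm_pow two_ne_zero
  have hSx2 : Integrable (fun x => ‖S x‖ ^ 2) μ :=
    (S.comp_memLp' hm).integrable_norm_pow two_ne_zero
  have hqS : ∀ x, q (S x) = 2⁻¹ * ‖S x‖ ^ 2 - 2⁻¹ * ‖x‖ ^ 2 := fun x => by simp only [hq, hTS]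
  have hqSi : Integrable (fun x => 2⁻¹ * ‖S x‖ ^ 2 - 2⁻¹ * ‖x‖ ^ 2) μ :=
    (hSx2.const_mul _).sub (hx2.const_mul _)
  have hqi : Integrable q (μ.map S) := by
    rw [integrable_map_measure hqm.aestronglyMeasurable hSm]
    exact hqSi.congr (.of_forall fun x => (hqS x).symm)
  have hqd : ∀ y, Real.exp (q y) = (∏ i, s i) * diagDensity b s 0 y := fun y => by
    simp only [diagDensity, sub_zero, hq]
    rw [← mul_assoc, mul_inv_cancel₀ hP.ne', one_mul]
  have hqe : Integrable (fun y => Real.exp (q y)) (stdGaussian E) := by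
    simp_rw [hqd]
    exact (integrable_diagDensity b hs0 0).const_mul _
  have hd2 := dual_bound_add_nonneg hd1 (g := fun y => h (T y)) (by fun_prop) (fun x => hM _)
    hqm hq0 hqi hqe
  have hexp : ∫ y, Real.exp (h (T y) + q y) ∂(stdGaussian E)
      = (∏ i, s i) * ∫ x, Real.exp (h x) ∂(stdGaussian E) := by
    have h1 := integral_map_diagCLM b hs0 0 (F := fun y => Real.exp (h (T y))) (by fun_prop)
    simp only [zero_add] at h1
    have h2 : ∀ x, T (diagCLM b s x) = x := hTS
    simp only [h2] at h1
    rw [h1, ← integral_const_mul]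
    refine integral_congr_ae (.of_forall fun y => ?_)
    simp only [Real.exp_add, hqd]
    ring
  have hpos : 0 < ∫ x, Real.exp (h x) ∂(stdGaussian E) :=
    integral_exp_pos (integrable_exp_of_bound hh.aestronglyMeasurable hM)
  have hlhs : ∫ y, (h (T y) + q y) ∂(μ.map S)
      = ∫ x, h x ∂μ + ∫ x, (2⁻¹ * ‖S x‖ ^ 2 - 2⁻¹ * ‖x‖ ^ 2) ∂μ := by
    have hm1 : Measurable fun y => h (T y) + q y := by fun_prop
    rw [integral_map hSm hm1.aestronglyMeasurable]
    simp only [hTS, hqS]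
    exact integral_add (Integrable.of_bound hh.aestronglyMeasurable M (.of_forall hM)) hqSi
  rw [hlhs, hexp, hV2, Real.log_mul hP.ne' hpos.ne', Real.log_prod fun i _ => (hs0 i).ne'] at hd2
  linarith

lemma integral_sq_add_mul {Ω : Type*} [MeasurableSpace Ω] {ρ : Measure Ω} {f g : Ω → ℝ}
    (hf : MemLp f 2 ρ) (hg : MemLp g 2 ρ) (s t : ℝ) :
    ∫ x, (s * f x + t * g x) ^ 2 ∂ρ
      = s ^ 2 * ∫ x, f x ^ 2 ∂ρ + 2 * s * t * ∫ x, f x * g x ∂ρ + t ^ 2 * ∫ x, g x ^ 2 ∂ρ := by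
  have h1 := hf.integrable_sq.const_mul (s ^ 2)
  have h2 : Integrable (fun x => 2 * s * t * (f x * g x)) ρ :=
    (hf.integrable_mul hg).const_mul (2 * s * t)
  have h3 := hg.integrable_sq.const_mul (t ^ 2)
  have h12 : Integrable (fun x => s ^ 2 * f x ^ 2 + 2 * s * t * (f x * g x)) ρ := h1.add h2
  rw [← integral_const_mul, ← integral_const_mul, ← integral_const_mul, ← integral_add h1 h2,
    ← integral_add h12 h3]
  exact integral_congr_ae (.of_forall fun x => by ring)

/-- The one dimensional Cramér–Rao inequality. -/
lemma IsScore.one_le_mul_variance (hU : IsScore μ U) (hm : MemLp id 2 μ) {v : E} (hv : ‖v‖ = 1) :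
    1 ≤ (∫ x, inner ℝ v (U x - x) ^ 2 ∂μ) * Var[fun x => inner ℝ v x; μ] := by
  have hsub : MemLp (fun x => U x - x) 2 μ := hU.memLp.sub hm
  have hf : MemLp (fun x => inner ℝ v (U x - x)) 2 μ := hsub.const_inner v
  have hmv : MemLp (fun x => inner ℝ v x) 2 μ := hm.const_inner v
  set c := ∫ x, inner ℝ v x ∂μ
  have hg : MemLp (fun x => inner ℝ v x + -c) 2 μ := hmv.add (memLp_const _)
  -- Centring by the mean c turns the second Cauchy–Schwarz factor into the variance.
  have h := hU.integral_inner_mul_affine hm v v (-c)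
  rw [real_inner_self_eq_norm_sq, hv, one_pow] at h
  have hneg : MemLp (fun x => -(inner ℝ v (U x - x))) 2 μ := hf.neg
  have hCS := integral_mul_le_sqrt_mul_sqrt hneg hg
  simp only [neg_mul, integral_neg, h, neg_neg, neg_sq] at hCS
  have hvar : Var[fun x => inner ℝ v x; μ] = ∫ x, (inner ℝ v x + -c) ^ 2 ∂μ :=
    variance_eq_integral hmv.aemeasurable
  rw [hvar]
  rw [← Real.sqrt_mul (integral_nonneg fun x => sq_nonneg _)] at hCS
  exact (Real.one_le_sqrt).1 hCS

/-- The relative entropy is bounded by half the Fisher information minus the variance term. -/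
theorem IsScore.klDiv_add_le (hU : IsScore μ U) (hm : MemLp id 2 μ) (hμ : μ ≪ stdGaussian E)
    {l : ι → ℝ} (hl : ∀ i, l i = Var[fun x => inner ℝ (b i) x; μ]) :
    (∀ i, 0 < l i) ∧
    InformationTheory.klDiv μ (stdGaussian E)
      + ENNReal.ofReal (2⁻¹ * ∑ i, if l i < 1 then (l i)⁻¹ - 1 + Real.log (l i) else 0)
      ≤ ENNReal.ofReal (2⁻¹ * ∫ x, ‖U x‖ ^ 2 ∂μ) := by
  have hCR : ∀ i, 1 ≤ (∫ x, inner ℝ (b i) (U x - x) ^ 2 ∂μ) * l i := fun i => by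
    rw [hl]; exact hU.one_le_mul_variance hm (b.norm_eq_one i)
  have hl0 : ∀ i, 0 < l i := fun i => by
    have h0 : 0 ≤ l i := by rw [hl]; exact variance_nonneg _ _
    refine lt_of_le_of_ne h0 fun h => ?_
    have := hCR i
    rw [← h, mul_zero] at this
    linarith
  refine ⟨hl0, ?_⟩
  set J : ι → ℝ := fun i => ∫ x, inner ℝ (b i) (U x - x) ^ 2 ∂μ with hJ
  set m : ι → ℝ := fun i => ∫ x, inner ℝ (b i) x ^ 2 ∂μ with hmdef
  have hJl : ∀ i, (l i)⁻¹ ≤ J i := fun i => by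
    rw [inv_eq_one_div, div_le_iff₀ (hl0 i)]; exact hCR i
  -- Directions of variance below 1 are stretched to variance 1; the others are left alone and
  -- contribute nothing.
  set s : ι → ℝ := fun i => if l i < 1 then (√(l i))⁻¹ else 1 with hs
  have hs1 : ∀ i, 1 ≤ s i := fun i => by
    simp only [hs]
    split_ifs with h
    · exact (one_le_inv₀ (Real.sqrt_pos.2 (hl0 i))).2 (Real.sqrt_le_one.2 h.le)
    · exact le_rfl
  have hs0 : ∀ i, 0 < s i := fun i => one_pos.trans_le (hs1 i)
  have hkl := klDiv_le_of_dual_bound hμ fun h M hh hM => hU.dual_bound b hm hs1 hh hM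
  have hsub : MemLp (fun x => U x - x) 2 μ := hU.memLp.sub hm
  have hf : ∀ i, MemLp (fun x => inner ℝ (b i) (U x - x)) 2 μ := fun i => hsub.const_inner _
  have hg : ∀ i, MemLp (fun x => inner ℝ (b i) x) 2 μ := fun i => hm.const_inner _
  have hcross : ∀ i, ∫ x, inner ℝ (b i) (U x - x) * inner ℝ (b i) x ∂μ = -1 := fun i => by
    have := hU.integral_inner_mul_affine hm (b i) (b i) 0
    simpa [b.norm_eq_one] using this
  have hlin : ∀ s t : ι → ℝ, ∫ x, ∑ i, (s i * inner ℝ (b i) (U x - x) + t i * inner ℝ (b i) x) ^ 2 ∂μ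
      = ∑ i, (s i ^ 2 * J i - 2 * (s i * t i) + t i ^ 2 * m i) := fun s t => by
    have hi : ∀ i, Integrable (fun x =>
        (s i * inner ℝ (b i) (U x - x) + t i * inner ℝ (b i) x) ^ 2) μ := fun i =>
      (((hf i).const_mul (s i)).add ((hg i).const_mul (t i))).integrable_sq
    rw [integral_finsetSum _ fun i _ => hi i]
    refine Finset.sum_congr rfl fun i _ => ?_
    rw [integral_sq_add_mul (hf i) (hg i), hcross]
    ring
  have hUint : ∫ x, ‖U x‖ ^ 2 ∂μ = ∑ i, (J i - 2 + m i) := by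
    have := hlin 1 1
    simp only [Pi.one_apply, one_mul, ← inner_add_right, sub_add_cancel, b.sum_sq_inner_right,
      one_pow, mul_one] at this
    exact this
  have hTS : ∫ x, ‖diagCLM b (fun i => (s i)⁻¹) (U x - x) + diagCLM b s x‖ ^ 2 ∂μ
      = ∑ i, ((s i)⁻¹ ^ 2 * J i - 2 + s i ^ 2 * m i) := by
    have := hlin (fun i => (s i)⁻¹) s
    simp only [← inner_diagCLM, inv_mul_cancel₀ (hs0 _).ne', mul_one] at this
    simp only [← inner_diagCLM b (fun i => (s i)⁻¹), ← inner_add_right,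
      b.sum_sq_inner_right] at this
    exact this
  have hq : ∫ x, (2⁻¹ * ‖diagCLM b s x‖ ^ 2 - 2⁻¹ * ‖x‖ ^ 2) ∂μ
      = ∑ i, (2⁻¹ * (s i ^ 2 * m i) - 2⁻¹ * m i) := by
    have hi : ∀ i, Integrable (fun x => inner ℝ (b i) x ^ 2) μ := fun i => (hg i).integrable_sq
    have hi2 : ∀ i, Integrable (fun x => (2⁻¹ * s i ^ 2 - 2⁻¹) * inner ℝ (b i) x ^ 2) μ :=
      fun i => (hi i).const_mul _
    have hpt : ∀ x, 2⁻¹ * ‖diagCLM b s x‖ ^ 2 - 2⁻¹ * ‖x‖ ^ 2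
        = ∑ i, (2⁻¹ * s i ^ 2 - 2⁻¹) * inner ℝ (b i) x ^ 2 := fun x => by
      rw [norm_sq_diagCLM, ← b.sum_sq_inner_right x, Finset.mul_sum, Finset.mul_sum,
        ← Finset.sum_sub_distrib]
      exact Finset.sum_congr rfl fun i _ => by ring
    simp only [hpt]
    rw [integral_finsetSum _ fun i _ => hi2 i]
    refine Finset.sum_congr rfl fun i _ => ?_
    rw [integral_const_mul]
    ring
  -- The zero test function shows that the entropy bound is nonnegative, so that `ENNReal.ofReal` is
  -- additive on it.
  have hX := hU.dual_bound b hm hs1 (h := fun _ => 0) measurable_const (M := 0) (by simp)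
  simp only [integral_zero, Real.exp_zero, integral_const, probReal_univ, smul_eq_mul, mul_one,
    Real.log_one, add_zero] at hX
  rw [hTS, hq] at hkl hX
  have hterm : ∀ i, (if l i < 1 then (l i)⁻¹ - 1 + Real.log (l i) else 0)
      ≤ (1 - (s i)⁻¹ ^ 2) * J i - 2 * Real.log (s i) := fun i => by
    simp only [hs]
    split_ifs with h
    · rw [inv_inv, Real.sq_sqrt (hl0 i).le, Real.log_inv, Real.log_sqrt (hl0 i).le]
      -- Cramér–Rao is used with the coefficient 1 - s_i⁻² = 1 - l i, whose sign is where l i < 1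
      -- matters.
      have h1 : (1 - l i) * (l i)⁻¹ ≤ (1 - l i) * J i :=
        mul_le_mul_of_nonneg_left (hJl i) (by linarith)
      have h2 : (1 - l i) * (l i)⁻¹ = (l i)⁻¹ - 1 := by
        rw [sub_mul, mul_inv_cancel₀ (hl0 i).ne', one_mul]
      linarith
    · simp
  have hnn : ∀ i, 0 ≤ (if l i < 1 then (l i)⁻¹ - 1 + Real.log (l i) else 0) := fun i => by
    split_ifs with h
    · have := Real.one_sub_inv_le_log_of_pos (hl0 i); linarith
    · exact le_rfl
  rw [hUint]
  refine (add_le_add_left hkl _).trans ?_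
  rw [← ENNReal.ofReal_add hX (mul_nonneg (by norm_num) (Finset.sum_nonneg fun i _ => hnn i))]
  refine ENNReal.ofReal_le_ofReal ?_
  rw [Finset.mul_sum, Finset.mul_sum, Finset.mul_sum, ← Finset.sum_sub_distrib,
    ← Finset.sum_add_distrib, ← Finset.sum_add_distrib]
  refine Finset.sum_le_sum fun i _ => ?_
  linarith [hterm i]

end KeyInequality

/-! ### Weak gradients vanish on the zero set -/

section WeakGradient

variable {E : Type*} [NormedAddCommGroup E] [InnerProductSpace ℝ E] [FiniteDimensional ℝ E]
  [MeasurableSpace E] [BorelSpace E] {f w : E → ℝ} {v : E}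

/-- Translations act continuously on locally integrable functions. -/
lemma tendsto_setIntegral_norm_translate_sub (hw : LocallyIntegrable w volume) {K : Set E}
    (hK : IsCompact K) :
    Tendsto (fun z => ∫ x in K, ‖w (x + z) - w x‖) (𝓝 0) (𝓝 0) := by
  rw [Metric.tendsto_nhds]
  intro ε hε
  set K' := Metric.cthickening 1 K
  have hK' : IsCompact K' := hK.cthickening
  have hi : Integrable (K'.indicator w) :=
    (integrable_indicator_iff hK'.measurableSet).2 (hw.integrableOn_isCompact hK')
  obtain ⟨g, hgs, hg, hgc, hgi⟩ := hi.exists_hasCompactSupport_integral_sub_le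
    (show 0 < ε / 4 by linarith)
  have huc : UniformContinuous g := hgs.uniformContinuous_of_continuous hgc
  set V := volume.real K
  have hV : 0 ≤ V := measureReal_nonneg
  obtain ⟨δ, hδ, hgδ⟩ := Metric.uniformContinuous_iff.1 huc (ε / (4 * (V + 1))) (by positivity)
  filter_upwards [Metric.ball_mem_nhds (0 : E) (lt_min one_pos hδ)] with z hz
  rw [mem_ball_zero_iff, lt_min_iff] at hz
  have h1 : Integrable fun x => ‖K'.indicator w x - g x‖ := (hi.sub hgi).norm
  have h2 : Integrable fun x => ‖K'.indicator w (x + z) - g (x + z)‖ := h1.comp_add_right z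
  have hb : ∀ x ∈ K, ‖w (x + z) - w x‖ ≤ ‖K'.indicator w (x + z) - g (x + z)‖
      + ‖K'.indicator w x - g x‖ + ε / (4 * (V + 1)) := fun x hx => by
    have hxz : x + z ∈ K' := Metric.mem_cthickening_of_dist_le _ x _ _ hx (by simpa using hz.1.le)
    have hx' : x ∈ K' := Metric.self_subset_cthickening _ hx
    rw [Set.indicator_of_mem hxz, Set.indicator_of_mem hx']
    have h3 : ‖g (x + z) - g x‖ ≤ ε / (4 * (V + 1)) := by
      rw [← dist_eq_norm]; exact (hgδ (by simpa using hz.2)).le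
    have h4 : w (x + z) - w x = (w (x + z) - g (x + z)) - (w x - g x) + (g (x + z) - g x) := by ring
    rw [h4]
    exact (norm_add_le _ _).trans (add_le_add (norm_sub_le _ _) h3)
  have h12 : Integrable fun x => ‖K'.indicator w (x + z) - g (x + z)‖
      + ‖K'.indicator w x - g x‖ := h2.add h1
  have hKf : volume K < ⊤ := hK.measure_lt_top
  have hci : IntegrableOn (fun _ : E => ε / (4 * (V + 1))) K := integrableOn_const hKf.ne
  have hmono : ∫ x in K, ‖w (x + z) - w x‖ ≤ ∫ x in K, (‖K'.indicator w (x + z) - g (x + z)‖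
      + ‖K'.indicator w x - g x‖ + ε / (4 * (V + 1))) := by
    refine integral_mono_of_nonneg (.of_forall fun x => norm_nonneg _) (h12.integrableOn.add hci) ?_
    filter_upwards [ae_restrict_mem hK.measurableSet] with x hx using hb x hx
  rw [integral_add h12.integrableOn hci, integral_add h2.integrableOn h1.integrableOn,
    setIntegral_const, smul_eq_mul] at hmono
  have h5 : ∫ x in K, ‖K'.indicator w (x + z) - g (x + z)‖ ≤ ε / 4 := by
    refine (setIntegral_le_integral h2 (.of_forall fun x => norm_nonneg _)).trans ?_
    rw [integral_add_right_eq_self (fun x => ‖K'.indicator w x - g x‖) z]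
    exact hg
  have h6 : ∫ x in K, ‖K'.indicator w x - g x‖ ≤ ε / 4 :=
    (setIntegral_le_integral h1 (.of_forall fun x => norm_nonneg _)).trans hg
  have h7 : V * (ε / (4 * (V + 1))) ≤ ε / 4 := by
    rw [mul_div_assoc', div_le_div_iff₀ (by positivity) (by norm_num)]
    nlinarith
  rw [dist_zero_right, Real.norm_of_nonneg (integral_nonneg fun x => norm_nonneg _)]
  linarith

/-- The derivative of the pairing of a weakly differentiable function with a translated test
function. -/
lemma hasDerivAt_integral_mul_translate (hf : LocallyIntegrable f volume)
    (hfw : ∀ φ : E → ℝ, ContDiff ℝ ∞ φ → HasCompactSupport φ →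
      ∫ x, f x * fderiv ℝ φ x v = - ∫ x, φ x * w x)
    {h : E → ℝ} (hh : ContDiff ℝ ∞ h) (hs : HasCompactSupport h) (t : ℝ) :
    HasDerivAt (fun s : ℝ => ∫ x, h x * f (x + s • v)) (∫ x, h x * w (x + t • v)) t := by
  have htr : ∀ (g : E → ℝ) (s : ℝ), ∫ x, h x * g (x + s • v) = ∫ x, h (x - s • v) * g x :=
    fun g s => by
      rw [← integral_add_right_eq_self (fun x => h (x - s • v) * g x) (s • v)]
      simp
  simp only [htr]
  -- With the reflected test function, the translated pairing is the convolution f * k evaluated at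
  -- s • v, which is differentiable in s.
  set k : E → ℝ := fun y => h (-y) with hk
  have hkd : ContDiff ℝ ∞ k := hh.comp contDiff_neg
  have hks : HasCompactSupport k := hs.comp_homeomorph (Homeomorph.neg E)
  have hconv := hks.hasFDerivAt_convolution_right (ContinuousLinearMap.mul ℝ ℝ) hf
    (hkd.of_le (by simp)) (t • v)
  have hline : HasDerivAt (fun s : ℝ => s • v) v t := by
    simpa using (hasDerivAt_id t).smul_const v
  have hcomp := hconv.comp_hasDerivAt t hline
  have hfun : (fun s : ℝ => ∫ x, h (x - s • v) * f x)
      = (convolution f k (ContinuousLinearMap.mul ℝ ℝ) volume) ∘ fun s : ℝ => s • v := by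
    funext s
    simp only [Function.comp, convolution, ContinuousLinearMap.mul_apply', hk, neg_sub]
    exact integral_congr_ae (.of_forall fun x => mul_comm _ _)
  rw [hfun]
  refine hcomp.congr_deriv ?_
  rw [convolution_precompR_apply _ hf (hks.fderiv ℝ) (hkd.continuous_fderiv (by simp))]
  simp only [convolution, ContinuousLinearMap.mul_apply']
  have hφ := hfw (fun x => h (x - t • v)) (hh.comp (contDiff_id.sub contDiff_const))
    (hs.comp_homeomorph (Homeomorph.subRight (t • v)))
  have hd1 : ∀ y, fderiv ℝ k y v = -fderiv ℝ h (-y) v := fun y => by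
    have h1 := ((hh.differentiable (by simp) (-y)).hasFDerivAt.comp y (hasFDerivAt_id y).neg)
    rw [HasFDerivAt.fderiv (f := k) h1]
    simp
  simp only [hd1, neg_sub, mul_neg, integral_neg]
  have hd2 : ∀ x, fderiv ℝ (fun x => h (x - t • v)) x v = fderiv ℝ h (x - t • v) v := fun x => by
    rw [fderiv_comp_sub]
  simp only [hd2] at hφ
  rw [hφ, neg_neg]

lemma locallyIntegrable_comp_add_right (hw : LocallyIntegrable w volume) (z : E) :
    LocallyIntegrable (fun x => w (x + z)) volume := by
  rw [locallyIntegrable_iff]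
  intro K hK
  have hK2 : IsCompact ((fun x => x + z) '' K) := hK.image (by fun_prop)
  have := hw.integrableOn_isCompact hK2
  have hmp : MeasurePreserving (fun x : E => x + z) volume volume :=
    measurePreserving_add_right volume z
  exact (hmp.integrableOn_image (MeasurableEquiv.addRight z).measurableEmbedding).1 this

/-- First order Taylor estimate for a weakly differentiable function against test functions. -/
lemma integral_mul_translate_le (hf : LocallyIntegrable f volume) (hw : LocallyIntegrable w volume)
    (hfw : ∀ φ : E → ℝ, ContDiff ℝ ∞ φ → HasCompactSupport φ →
      ∫ x, f x * fderiv ℝ φ x v = - ∫ x, φ x * w x)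
    {h : E → ℝ} (hh : ContDiff ℝ ∞ h) {K : Set E} (hK : IsCompact K)
    (hs : Function.support h ⊆ K) (h1 : ∀ x, |h x| ≤ 1) {t r : ℝ} (ht : 0 ≤ t)
    (hr : ∀ s ∈ Set.Icc 0 t, ∫ x in K, ‖w (x + s • v) - w x‖ ≤ r) :
    ((∫ x, h x * f (x + t • v)) - ∫ x, h x * f x) - t * ∫ x, h x * w x ≤ r * t := by
  have hcs : HasCompactSupport h := HasCompactSupport.of_support_subset_isCompact hK hs
  have hint : ∀ {g : E → ℝ}, LocallyIntegrable g volume → Integrable fun x => h x * g x :=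
    fun hg => hg.integrable_smul_left_of_hasCompactSupport hh.continuous hcs
  have hd := fun s => hasDerivAt_integral_mul_translate hf hfw hh hcs s
  have hd2 : ∀ s ∈ Set.Icc 0 t, HasDerivWithinAt
      (fun s : ℝ => (∫ x, h x * f (x + s • v)) - s * ∫ x, h x * w x)
      ((∫ x, h x * w (x + s • v)) - ∫ x, h x * w x) (Set.Icc 0 t) s := fun s _ => by
    have := (hd s).sub ((hasDerivAt_id s).mul_const (∫ x, h x * w x))
    rw [one_mul] at this
    exact this.hasDerivWithinAt
  have hb : ∀ s ∈ Set.Ico 0 t, ‖(∫ x, h x * w (x + s • v)) - ∫ x, h x * w x‖ ≤ r := by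
    intro s hs'
    have hwt := locallyIntegrable_comp_add_right hw (s • v)
    rw [← integral_sub (hint hwt) (hint hw)]
    refine (norm_integral_le_integral_norm _).trans (le_trans ?_ (hr s ⟨hs'.1, hs'.2.le⟩))
    rw [← integral_indicator hK.measurableSet]
    refine integral_mono_of_nonneg (.of_forall fun x => norm_nonneg _)
      ((integrable_indicator_iff hK.measurableSet).2
        ((hwt.sub hw).integrableOn_isCompact hK).norm) (.of_forall fun x => ?_)
    by_cases hx : x ∈ K
    · simp only [Set.indicator_of_mem hx]
      rw [← mul_sub, norm_mul]
      exact mul_le_of_le_one_left (norm_nonneg _) (h1 x)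
    · have : h x = 0 := by
        by_contra hne; exact hx (hs hne)
      simp [this, Set.indicator_of_notMem hx]
  have := norm_image_sub_le_of_norm_deriv_le_segment' hd2 hb t ⟨ht, le_rfl⟩
  simp only [zero_smul, add_zero, zero_mul, sub_zero] at this
  have h3 := (Real.le_norm_self _).trans this
  linarith

/-- Smooth approximations of the indicator function of a compact set. -/
lemma exists_smooth_approx_indicator {K : Set E} (hK : IsCompact K) :
    ∃ (K' : Set E) (g : ℕ → E → ℝ), IsCompact K' ∧ (∀ n, ContDiff ℝ ∞ (g n)) ∧
      (∀ n, Function.support (g n) ⊆ K') ∧ (∀ n x, |g n x| ≤ 1) ∧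
      ∀ f : E → ℝ, LocallyIntegrable f volume →
        Tendsto (fun n => ∫ x, g n x * f x) atTop (𝓝 (∫ x in K, f x)) := by
  obtain ⟨u, -, u_pos, u_lim⟩ : ∃ u, StrictAnti u ∧ (∀ n : ℕ, u n ∈ Set.Ioo (0 : ℝ) 1)
    ∧ Tendsto u atTop (𝓝 0) := exists_seq_strictAnti_tendsto' one_pos
  have hK' : IsCompact (Metric.cthickening 1 K) := hK.cthickening
  have vK : ∀ n, Metric.thickening (u n) K ⊆ Metric.cthickening 1 K := fun n =>
    Metric.thickening_subset_cthickening_of_le (u_pos n).2.le _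
  have : ∀ n, ∃ g : E → ℝ, Function.support g = Metric.thickening (u n) K ∧ ContDiff ℝ ∞ g ∧
      Set.range g ⊆ Set.Icc 0 1 ∧ ∀ x ∈ K, g x = 1 := fun n => by
    obtain ⟨g, g_smooth, g_range, g_supp, hg⟩ := exists_contMDiff_support_eq_eq_one_iff
      (modelWithCornersSelf ℝ E) (n := (⊤ : ℕ∞)) Metric.isOpen_thickening hK.isClosed
      (Metric.self_subset_thickening (u_pos n).1 K)
    exact ⟨g, g_supp, g_smooth.contDiff, g_range, fun x hx => (hg x).1 hx⟩
  choose g g_supp g_diff g_range hg using this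
  have hg1 : ∀ n x, |g n x| ≤ 1 := fun n x => by
    have := g_range n (Set.mem_range_self x)
    rw [abs_of_nonneg this.1]
    exact this.2
  refine ⟨_, g, hK', g_diff, fun n => (g_supp n).trans_subset (vK n), hg1, fun f hf => ?_⟩
  rw [← integral_indicator hK.measurableSet]
  refine tendsto_integral_of_dominated_convergence
    ((Metric.cthickening 1 K).indicator fun x => ‖f x‖)
    (fun n => (g_diff n).continuous.aestronglyMeasurable.mul hf.aestronglyMeasurable)
    ((integrable_indicator_iff hK'.measurableSet).2 (hf.integrableOn_isCompact hK').norm)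
    (fun n => .of_forall fun x => ?_) (.of_forall fun x => ?_)
  · rw [norm_mul]
    refine Set.le_indicator_apply (fun _ => mul_le_of_le_one_left (norm_nonneg _) (hg1 n x))
      fun hx => ?_
    have : g n x = 0 := by
      rw [← Function.notMem_support, g_supp]; exact fun h => hx (vK n h)
    simp [this]
  · by_cases hx : x ∈ K
    · simp [hg _ x hx, Set.indicator_of_mem hx]
    · rw [Set.indicator_of_notMem hx]
      refine tendsto_const_nhds.congr' ?_
      obtain ⟨ε, hε, hxε⟩ : ∃ ε, 0 < ε ∧ x ∉ Metric.thickening ε K := by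
        rw [← hK.isClosed.closure_eq, Metric.closure_eq_iInter_thickening K] at hx
        simpa using hx
      filter_upwards [(tendsto_order.1 u_lim).2 _ hε] with n hn
      have : g n x = 0 := by
        rw [← Function.notMem_support, g_supp]
        exact fun h => hxε (Metric.thickening_mono hn.le K h)
      simp [this]

/-- A zero of a nonnegative function is a minimum, in integrated form. Translating by a small t
along v changes ∫_K f by t ∫_K w up to an error r t; as f starts at 0 on K and stays nonnegative,
∫_K w ≥ -r for every r > 0. -/
lemma setIntegral_nonneg_of_isCompact_subset_zero (hf : LocallyIntegrable f volume)
    (hw : LocallyIntegrable w volume)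
    (hfw : ∀ φ : E → ℝ, ContDiff ℝ ∞ φ → HasCompactSupport φ →
      ∫ x, f x * fderiv ℝ φ x v = - ∫ x, φ x * w x)
    (hf0 : ∀ x, 0 ≤ f x) {K : Set E} (hK : IsCompact K) (hKf : ∀ x ∈ K, f x = 0) :
    0 ≤ ∫ x in K, w x := by
  obtain ⟨K', g, hK', hgd, hgs, hg1, hg⟩ := exists_smooth_approx_indicator hK
  refine le_of_forall_pos_le_add fun r hr => ?_
  have hline : Tendsto (fun s : ℝ => s • v) (𝓝 0) (𝓝 0) :=
    tendsto_id.zero_smul_const v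
  obtain ⟨ε, hε, hball⟩ := Metric.eventually_nhds_iff.1
    ((((tendsto_setIntegral_norm_translate_sub hw hK').comp hline).eventually
      (gt_mem_nhds hr)))
  have ht : 0 < ε / 2 := by linarith
  have hle : ∀ n, ((∫ x, g n x * f (x + (ε / 2) • v)) - ∫ x, g n x * f x) - ε / 2 * ∫ x, g n x * w x
      ≤ r * (ε / 2) := fun n =>
    integral_mul_translate_le hf hw hfw (hgd n) hK' (hgs n) (hg1 n) ht.le fun s hs => by
      refine (hball ?_).le
      rw [dist_zero_right, Real.norm_of_nonneg hs.1]
      linarith [hs.2]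
  have hlim := (((hg _ (locallyIntegrable_comp_add_right hf ((ε / 2) • v))).sub (hg _ hf)).sub
    ((hg _ hw).const_mul (ε / 2)))
  have h := le_of_tendsto' hlim hle
  have h0 : ∫ x in K, f x = 0 := by
    rw [setIntegral_congr_fun hK.measurableSet (g := fun _ => (0 : ℝ)) hKf]; simp
  have h1 : 0 ≤ ∫ x in K, f (x + (ε / 2) • v) := integral_nonneg fun x => hf0 _
  rw [h0] at h
  have h2 : 0 ≤ ε / 2 * ((∫ x in K, w x) + r) := by linarith
  exact (mul_nonneg_iff_of_pos_left ht).1 h2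

/-- If {f = 0, w < 0} had positive measure, inner regularity would give a compact subset of positive
measure, on which w would have a negative integral. -/
lemma ae_nonneg_of_eq_zero (hf : LocallyIntegrable f volume) (hfm : Measurable f)
    (hw : LocallyIntegrable w volume)
    (hfw : ∀ φ : E → ℝ, ContDiff ℝ ∞ φ → HasCompactSupport φ →
      ∫ x, f x * fderiv ℝ φ x v = - ∫ x, φ x * w x)
    (hf0 : ∀ x, 0 ≤ f x) : ∀ᵐ x, f x = 0 → 0 ≤ w x := by
  obtain ⟨w', hw', hww'⟩ := hw.aestronglyMeasurable
  set S := {x | f x = 0} ∩ {x | w' x < 0} with hS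
  have hSm : MeasurableSet S := (hfm (measurableSet_singleton 0)).inter
    (measurableSet_lt hw'.measurable measurable_const)
  have hS0 : volume S = 0 := by
    by_contra hne
    obtain ⟨K, hKS, hK, hpos⟩ := hSm.exists_lt_isCompact (pos_iff_ne_zero.2 hne)
    have h1 := setIntegral_nonneg_of_isCompact_subset_zero hf hw hfw hf0 hK fun x hx => (hKS hx).1
    have h2 : ∫ x in K, w x = ∫ x in K, w' x :=
      integral_congr_ae (ae_restrict_of_ae hww')
    have hi : IntegrableOn w' K := (hw.integrableOn_isCompact hK).congr (ae_restrict_of_ae hww')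
    have h3 : 0 < ∫ x in K, -w' x := by
      refine (setIntegral_pos_iff_support_of_nonneg_ae (f := fun x => -w' x) ?_ hi.neg).2 ?_
      · filter_upwards [ae_restrict_mem hK.measurableSet] with x hx
        have : w' x < 0 := (hKS hx).2
        simp only [Pi.zero_apply]; linarith
      · have : Function.support (fun x => -w' x) ∩ K = K :=
          Set.inter_eq_right.2 fun x hx => neg_ne_zero.2 (hKS hx).2.ne
        rwa [this]
    rw [integral_neg] at h3
    linarith
  filter_upwards [hww', measure_eq_zero_iff_ae_notMem.1 hS0] with x hx hxS hfx
  by_contra hneg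
  exact hxS ⟨hfx, by rw [Set.mem_ofPred_eq, ← hx]; exact not_le.1 hneg⟩

/-- The weak gradient of a nonnegative function vanishes almost everywhere on its zero set. -/
lemma HasWeakGradient.ae_eq_zero_of_eq_zero {G : E → E} (h : HasWeakGradient f G)
    (hfm : Measurable f) (hf0 : ∀ x, 0 ≤ f x) : ∀ᵐ x, f x = 0 → G x = 0 := by
  obtain ⟨hf, hG, hfG⟩ := h
  have hw : ∀ v, LocallyIntegrable (fun x => inner ℝ (G x) v) volume := fun v =>
    locallyIntegrable_iff.2 fun K hK => (hG.integrableOn_isCompact hK).inner_const v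
  have hv : ∀ v, ∀ᵐ x, f x = 0 → 0 ≤ inner ℝ (G x) v := fun v =>
    ae_nonneg_of_eq_zero hf hfm (hw v) (fun φ hφ hφs => hfG φ hφ hφs v) hf0
  set b := stdOrthonormalBasis ℝ E
  -- Opposite directions give both signs, hence equality.
  have h1 : ∀ᵐ x, ∀ i, (f x = 0 → 0 ≤ inner ℝ (G x) (b i)) ∧ (f x = 0 → 0 ≤ inner ℝ (G x) (-(b i))) :=
    ae_all_iff.2 fun i => (hv (b i)).and (hv (-(b i)))
  filter_upwards [h1] with x hx hfx
  refine InnerProductSpace.ext_inner_right_basis b.toBasis fun i => ?_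
  have h2 := (hx i).1 hfx
  have h3 := (hx i).2 hfx
  rw [inner_neg_right] at h3
  simp only [OrthonormalBasis.coe_toBasis, inner_zero_left]
  linarith

end WeakGradient

/-! ### From weak gradients to scores; the general deficit bound -/

section ScoreOfWeakGradient

variable {E : Type*} [NormedAddCommGroup E] [InnerProductSpace ℝ E] [FiniteDimensional ℝ E]
  [MeasurableSpace E] [BorelSpace E] {μ : Measure E} [IsProbabilityMeasure μ] {G : E → E}

lemma measurable_gaussianDensity (μ : Measure E) : Measurable (gaussianDensity μ) :=
  (Measure.measurable_rnDeriv _ _).ennreal_toReal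

lemma integral_eq_integral_gaussianPdf_mul (hμ : μ ≪ stdGaussian E) (g : E → ℝ) :
    ∫ x, g x ∂μ = ∫ x, gaussianPdf x * (gaussianDensity μ x * g x) := by
  rw [← integral_rnDeriv_smul hμ, integral_stdGaussian]
  rfl

/-- The logarithmic weak gradient of the density is a score. -/
lemma HasWeakGradient.isScore (hμ : μ ≪ stdGaussian E) (hG : HasWeakGradient (gaussianDensity μ) G)
    (hfin : ∫⁻ x, ‖(gaussianDensity μ x)⁻¹ • G x‖ₑ ^ 2 ∂μ ≠ ⊤) :
    IsScore μ fun x => (gaussianDensity μ x)⁻¹ • G x := by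
  set f := gaussianDensity μ
  have hfm : Measurable f := measurable_gaussianDensity μ
  have hf0 : ∀ x, 0 ≤ f x := fun x => ENNReal.toReal_nonneg
  -- Since f⁻¹ = 0 where f = 0, the product f (f⁻¹ • G) loses the part of G on the zero set; nothing
  -- is lost only because G vanishes there.
  have hz := hG.ae_eq_zero_of_eq_zero hfm hf0
  obtain ⟨hf, hGl, hfG⟩ := hG
  have hac : μ ≪ volume := hμ.trans stdGaussian_absolutelyContinuous
  refine ⟨⟨hfm.inv.aestronglyMeasurable.smul (hGl.aestronglyMeasurable.mono_ac hac), ?_⟩, ?_⟩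
  · rw [eLpNorm_lt_top_iff_lintegral_rpow_enorm_lt_top two_ne_zero ENNReal.ofNat_ne_top]
    simpa using hfin.lt_top
  · intro ψ hψ hψs v
    have hg := contDiff_gaussianPdf (E := E)
    -- Testing with ψ times the Gaussian density passes from Lebesgue to Gaussian integrals and
    -- produces the ⟨x, v⟩ term.
    have hφ : ContDiff ℝ ∞ fun x => ψ x * gaussianPdf x := hψ.mul hg
    have hφs : HasCompactSupport fun x => ψ x * gaussianPdf x := hψs.mul_right
    have h := hfG _ hφ hφs v
    have hd : ∀ x, fderiv ℝ (fun x => ψ x * gaussianPdf x) x v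
        = gaussianPdf x * fderiv ℝ ψ x v - gaussianPdf x * (ψ x * inner ℝ x v) := fun x => by
      rw [fderiv_fun_mul (hψ.differentiable (by simp) x) (hg.differentiable (by simp) x)]
      simp only [add_apply, smul_apply, smul_eq_mul, fderiv_gaussianPdf_apply]
      ring
    simp only [hd] at h
    rw [integral_eq_integral_gaussianPdf_mul hμ, integral_eq_integral_gaussianPdf_mul hμ]
    have h1 : ∫ x, gaussianPdf x * (f x * (ψ x * inner ℝ ((f x)⁻¹ • G x) v))
        = ∫ x, ψ x * gaussianPdf x * inner ℝ (G x) v := by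
      refine integral_congr_ae ?_
      filter_upwards [hz] with x hx
      by_cases hfx : f x = 0
      · simp [hx hfx]
      · rw [real_inner_smul_left]
        field_simp
    rw [h1, ← neg_eq_iff_eq_neg.2 h, ← integral_neg]
    exact integral_congr_ae (.of_forall fun x => by simp only; ring)

/-- The key inequality between relative entropy and relative Fisher information. -/
lemma two_mul_klDiv_add_le_fisherInfo {ι : Type*} [Fintype ι] (b : OrthonormalBasis ι ℝ E)
    (hm : MemLp id 2 μ) {l : ι → ℝ} (hl : ∀ i, l i = Var[fun x => inner ℝ (b i) x; μ])
    (hI : fisherInfo μ ≠ ⊤) :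
    (∀ i, 0 < l i) ∧ 2 * (InformationTheory.klDiv μ (stdGaussian E)
      + ENNReal.ofReal (2⁻¹ * ∑ i, if l i < 1 then (l i)⁻¹ - 1 + Real.log (l i) else 0))
      ≤ fisherInfo μ := by
  have key : ∀ G, (μ ≪ stdGaussian E ∧ HasWeakGradient (gaussianDensity μ) G) →
      ∫⁻ x, ‖(gaussianDensity μ x)⁻¹ • G x‖ₑ ^ 2 ∂μ ≠ ⊤ →
      (∀ i, 0 < l i) ∧ 2 * (InformationTheory.klDiv μ (stdGaussian E)
        + ENNReal.ofReal (2⁻¹ * ∑ i, if l i < 1 then (l i)⁻¹ - 1 + Real.log (l i) else 0))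
        ≤ ∫⁻ x, ‖(gaussianDensity μ x)⁻¹ • G x‖ₑ ^ 2 ∂μ := fun G hG hfin => by
    have hs := hG.2.isScore hG.1 hfin
    obtain ⟨h1, h2⟩ := hs.klDiv_add_le b hm hG.1 hl
    refine ⟨h1, (mul_le_mul_right h2 2).trans_eq ?_⟩
    rw [ENNReal.ofReal_mul (by norm_num), ← mul_assoc, ENNReal.ofReal_inv_of_pos two_pos,
      ENNReal.ofReal_ofNat, ENNReal.mul_inv_cancel two_ne_zero ENNReal.ofNat_ne_top, one_mul,
      ofReal_integral_eq_lintegral_ofReal (hs.memLp.integrable_norm_pow two_ne_zero)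
        (.of_forall fun x => sq_nonneg _)]
    refine lintegral_congr fun x => ?_
    rw [ENNReal.ofReal_pow (norm_nonneg _), ofReal_norm]
  refine ⟨?_, le_iInf₂ fun G hG => ?_⟩
  · obtain ⟨G, hG⟩ := iInf_lt_iff.1 (lt_top_iff_ne_top.2 hI)
    obtain ⟨hG, hfin⟩ := iInf_lt_iff.1 hG
    exact (key G hG hfin.ne).1
  · by_cases hfin : ∫⁻ x, ‖(gaussianDensity μ x)⁻¹ • G x‖ₑ ^ 2 ∂μ = ⊤
    · rw [hfin]; exact le_top
    · exact (key G hG hfin).2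

/-- The logarithmic Sobolev inequality. -/
lemma two_mul_klDiv_le_fisherInfo (hm : MemLp id 2 μ) :
    2 * InformationTheory.klDiv μ (stdGaussian E) ≤ fisherInfo μ := by
  by_cases hI : fisherInfo μ = ⊤
  · rw [hI]; exact le_top
  · exact (mul_le_mul_right le_self_add 2).trans
      (two_mul_klDiv_add_le_fisherInfo (stdOrthonormalBasis ℝ E) hm (fun _ => rfl) hI).2

/-- With finite information the entropy is finite as well, so the deficit is a real number and not
⊥. -/
lemma klDiv_ne_top_of_fisherInfo_ne_top (hm : MemLp id 2 μ) (hI : fisherInfo μ ≠ ⊤) :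
    InformationTheory.klDiv μ (stdGaussian E) ≠ ⊤ := fun h => by
  have := two_mul_klDiv_le_fisherInfo hm
  rw [h, ENNReal.mul_top two_ne_zero, top_le_iff] at this
  exact hI this

lemma deficit_eq_coe (hm : MemLp id 2 μ) (hI : fisherInfo μ ≠ ⊤) :
    deficit μ = ((1 / 2 * (fisherInfo μ).toReal
      - (InformationTheory.klDiv μ (stdGaussian E)).toReal : ℝ) : EReal) := by
  rw [deficit, if_neg hI, EReal.coe_sub, EReal.coe_mul, EReal.coe_ennreal_toReal hI,
    EReal.coe_ennreal_toReal (klDiv_ne_top_of_fisherInfo_ne_top hm hI)]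

lemma EReal.coe_finsetSum {ι : Type*} (s : Finset ι) (g : ι → ℝ) :
    ((∑ i ∈ s, g i : ℝ) : EReal) = ∑ i ∈ s, (g i : EReal) :=
  map_sum (⟨⟨Real.toEReal, EReal.coe_zero⟩, EReal.coe_add⟩ : ℝ →+ EReal) g s

lemma inv_sub_one_add_log_nonneg {l : ℝ} (hl : 0 < l) : 0 ≤ l⁻¹ - 1 + Real.log l := by
  have := Real.one_sub_inv_le_log_of_pos hl
  linarith

/-- The deficit bound in terms of the variances along an orthonormal basis. -/
theorem sum_eigenTerm_le_deficit {ι : Type*} [Fintype ι] (b : OrthonormalBasis ι ℝ E)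
    (hm : MemLp id 2 μ) {l : ι → ℝ} (hl : ∀ i, l i = Var[fun x => inner ℝ (b i) x; μ]) :
    ((1 / 2 : ℝ) : EReal) * (∑ i, if l i < 1 then eigenTerm (l i) else 0) ≤ deficit μ := by
  by_cases hI : fisherInfo μ = ⊤
  · rw [deficit, if_pos hI]; exact le_top
  obtain ⟨hl0, hle⟩ := two_mul_klDiv_add_le_fisherInfo b hm hl hI
  have hK := klDiv_ne_top_of_fisherInfo_ne_top hm hI
  -- Positivity of the variances, from Cramér–Rao, means that no summand is ⊤ here; a zero variance
  -- forces infinite information, the case already settled.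
  have hsum : (∑ i, if l i < 1 then eigenTerm (l i) else 0)
      = ((∑ i, if l i < 1 then (l i)⁻¹ - 1 + Real.log (l i) else 0 : ℝ) : EReal) := by
    rw [EReal.coe_finsetSum]
    refine Finset.sum_congr rfl fun i _ => ?_
    split_ifs
    · rw [eigenTerm, if_neg (hl0 i).ne']
    · simp
  set S := ∑ i, if l i < 1 then (l i)⁻¹ - 1 + Real.log (l i) else 0 with hS
  have hS0 : 0 ≤ S := Finset.sum_nonneg fun i _ => by
    split_ifs
    · exact inv_sub_one_add_log_nonneg (hl0 i)
    · exact le_rfl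
  rw [hsum, deficit_eq_coe hm hI, ← EReal.coe_mul, EReal.coe_le_coe_iff]
  have h := ENNReal.toReal_mono hI hle
  rw [ENNReal.toReal_mul, ENNReal.toReal_add hK ENNReal.ofReal_ne_top,
    ENNReal.toReal_ofReal (by positivity), ENNReal.toReal_ofNat] at h
  linarith

lemma deficit_nonneg (hm : MemLp id 2 μ) : 0 ≤ deficit μ := by
  by_cases hI : fisherInfo μ = ⊤
  · rw [deficit, if_pos hI]; exact le_top
  rw [deficit_eq_coe hm hI, ← EReal.coe_zero, EReal.coe_le_coe_iff]
  have h := ENNReal.toReal_mono hI (two_mul_klDiv_le_fisherInfo hm)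
  rw [ENNReal.toReal_mul, ENNReal.toReal_ofNat] at h
  linarith

end ScoreOfWeakGradient

/-! ### Diagonalising the covariance matrix -/

section Covariance

variable {n : ℕ} {μ : Measure (EuclideanSpace ℝ (Fin n))}

lemma covariance_inner_eq_dotProduct [IsFiniteMeasure μ] (hm : MemLp id 2 μ)
    (u v : EuclideanSpace ℝ (Fin n)) :
    cov[fun x => inner ℝ u x, fun x => inner ℝ v x; μ] = u.ofLp ⬝ᵥ (covMatrix μ).mulVec v.ofLp := by
  have hc : ∀ i, MemLp (fun x : EuclideanSpace ℝ (Fin n) => x i) 2 μ := fun i =>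
    (EuclideanSpace.proj (𝕜 := ℝ) i).comp_memLp' hm
  have hin : ∀ u x : EuclideanSpace ℝ (Fin n), inner ℝ u x = ∑ i, u i * x i := fun u x => by
    simp [PiLp.inner_apply, mul_comm]
  simp only [hin]
  rw [covariance_fun_sum_fun_sum (fun i => (hc i).const_mul _) fun i => (hc i).const_mul _]
  simp only [covariance_const_mul_left, covariance_const_mul_right, dotProduct, Matrix.mulVec,
    covMatrix, Matrix.of_apply, Finset.mul_sum]
  exact Finset.sum_congr rfl fun i _ => Finset.sum_congr rfl fun j _ => by ring

/-- An orthonormal basis of eigenvectors of the covariance matrix. -/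
def covBasis (μ : Measure (EuclideanSpace ℝ (Fin n))) :
    OrthonormalBasis (Fin n) ℝ (EuclideanSpace ℝ (Fin n)) :=
  (isHermitian_covMatrix μ).eigenvectorBasis

lemma mulVec_covBasis (i : Fin n) :
    (covMatrix μ).mulVec (covBasis μ i).ofLp = covEigenvalues μ i • (covBasis μ i).ofLp :=
  (isHermitian_covMatrix μ).mulVec_eigenvectorBasis i

lemma ofLp_dotProduct_eq_inner (u v : EuclideanSpace ℝ (Fin n)) :
    u.ofLp ⬝ᵥ v.ofLp = inner ℝ u v := by
  simp [PiLp.inner_apply, dotProduct, mul_comm]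

lemma covariance_covBasis [IsFiniteMeasure μ] (hm : MemLp id 2 μ) (i j : Fin n) :
    cov[fun x => inner ℝ (covBasis μ i) x, fun x => inner ℝ (covBasis μ j) x; μ]
      = if i = j then covEigenvalues μ j else 0 := by
  rw [covariance_inner_eq_dotProduct hm, mulVec_covBasis, dotProduct_smul,
    ofLp_dotProduct_eq_inner, orthonormal_iff_ite.1 (covBasis μ).orthonormal]
  simp

lemma covEigenvalues_eq_variance [IsFiniteMeasure μ] (hm : MemLp id 2 μ) (i : Fin n) :
    covEigenvalues μ i = Var[fun x => inner ℝ (covBasis μ i) x; μ] := by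
  have h1 : AEMeasurable (fun x => inner ℝ (covBasis μ i) x) μ := by fun_prop
  rw [← covariance_self h1, covariance_covBasis hm, if_pos rfl]

lemma covEigenvalues_nonneg [IsFiniteMeasure μ] (hm : MemLp id 2 μ) (i : Fin n) :
    0 ≤ covEigenvalues μ i := by
  rw [covEigenvalues_eq_variance hm]; exact variance_nonneg _ _

lemma covEigenvalues_le_one (h : (1 - covMatrix μ).PosSemidef) (i : Fin n) :
    covEigenvalues μ i ≤ 1 := by
  have := h.dotProduct_mulVec_nonneg (covBasis μ i).ofLp
  rw [Matrix.sub_mulVec, mulVec_covBasis, Matrix.one_mulVec, star_trivial, dotProduct_sub,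
    dotProduct_smul, ofLp_dotProduct_eq_inner, real_inner_self_eq_norm_sq,
    (covBasis μ).norm_eq_one] at this
  simpa using this

lemma posSemidef_covMatrix [IsFiniteMeasure μ] (hm : MemLp id 2 μ) :
    (covMatrix μ).PosSemidef := by
  refine .of_dotProduct_mulVec_nonneg (isHermitian_covMatrix μ) fun x => ?_
  have h := covariance_inner_eq_dotProduct hm (WithLp.toLp 2 x) (WithLp.toLp 2 x)
  rw [covariance_self (by fun_prop)] at h
  rw [star_trivial, ← WithLp.ofLp_toLp 2 x, ← h]
  exact variance_nonneg _ _

lemma sum_eigenTerm_of_le_one (h : (1 - covMatrix μ).PosSemidef) :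
    (∑ i, if covEigenvalues μ i < 1 then eigenTerm (covEigenvalues μ i) else 0)
      = ∑ i, eigenTerm (covEigenvalues μ i) := by
  refine Finset.sum_congr rfl fun i _ => ?_
  split_ifs with h1
  · rfl
  -- The only omitted value is 1, where the term is 0.
  · rw [le_antisymm (covEigenvalues_le_one h i) (not_lt.1 h1)]
    simp [eigenTerm]

end Covariance

/-! ### Information and entropy for smooth positive densities -/

section SmoothDensity

variable {E : Type*} [NormedAddCommGroup E] [InnerProductSpace ℝ E] [FiniteDimensional ℝ E]
  [MeasurableSpace E] [BorelSpace E] {μ : Measure E} {f : E → ℝ} {G : E → E}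

lemma gaussianDensity_ae_eq (hμ : μ = (stdGaussian E).withDensity fun x => ENNReal.ofReal (f x))
    (hf : Measurable f) (hf0 : ∀ x, 0 < f x) : gaussianDensity μ =ᵐ[stdGaussian E] f := by
  filter_upwards [Measure.rnDeriv_withDensity (stdGaussian E) hf.ennreal_ofReal] with x hx
  rw [gaussianDensity, hμ, hx, ENNReal.toReal_ofReal (hf0 x).le]

lemma hasWeakGradient_of_contDiff (hf : ContDiff ℝ 1 f) (hG : Continuous G)
    (hfG : ∀ x v, fderiv ℝ f x v = inner ℝ (G x) v) : HasWeakGradient f G := by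
  refine ⟨hf.continuous.locallyIntegrable, hG.locallyIntegrable, fun φ hφ hφs v => ?_⟩
  have hfd := hf.continuous_fderiv one_ne_zero
  have hφd := hφ.continuous_fderiv (by simp)
  rw [integral_mul_fderiv_eq_neg_fderiv_mul_of_integrable]
  · congr 1
    exact integral_congr_ae (.of_forall fun x => by simp only [hfG, mul_comm])
  · exact ((hfd.clm_apply continuous_const).mul hφ.continuous).integrable_of_hasCompactSupport
      hφs.mul_left
  · exact (hf.continuous.mul (hφd.clm_apply continuous_const)).integrable_of_hasCompactSupport
      (hφs.fderiv_apply ℝ v).mul_left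
  · exact (hf.continuous.mul hφ.continuous).integrable_of_hasCompactSupport hφs.mul_left
  · exact fun x _ => hf.differentiable one_ne_zero x
  · exact fun x _ => hφ.differentiable (by simp) x

lemma HasWeakGradient.congr {g : E → ℝ} (h : HasWeakGradient f G) (hfg : f =ᵐ[volume] g) :
    HasWeakGradient g G := by
  refine ⟨?_, h.2.1, fun φ hφ hφs v => ?_⟩
  · exact locallyIntegrable_iff.2 fun K hK =>
      (h.1.integrableOn_isCompact hK).congr (ae_restrict_of_ae hfg)
  · rw [← h.2.2 φ hφ hφs v]
    refine integral_congr_ae ?_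
    filter_upwards [hfg] with x hx
    rw [hx]

/-- The Fisher information of a measure with a smooth positive density. -/
lemma fisherInfo_le_of_contDiff
    (hμ : μ = (stdGaussian E).withDensity fun x => ENNReal.ofReal (f x)) (hf : ContDiff ℝ 1 f)
    (hf0 : ∀ x, 0 < f x) (hG : Continuous G) (hfG : ∀ x v, fderiv ℝ f x v = inner ℝ (G x) v) :
    fisherInfo μ ≤ ∫⁻ x, ‖(f x)⁻¹ • G x‖ₑ ^ 2 ∂μ := by
  have hae := gaussianDensity_ae_eq hμ hf.continuous.measurable hf0
  have hac : μ ≪ stdGaussian E := hμ ▸ withDensity_absolutelyContinuous _ _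
  refine (iInf₂_le G ⟨hac, (hasWeakGradient_of_contDiff hf hG hfG).congr
    (volume_absolutelyContinuous_stdGaussian.ae_eq hae).symm⟩).trans_eq (lintegral_congr_ae ?_)
  filter_upwards [hac.ae_le hae] with x hx
  rw [hx]

lemma toReal_klDiv_eq_integral_log [IsProbabilityMeasure μ]
    (hμ : μ = (stdGaussian E).withDensity fun x => ENNReal.ofReal (f x))
    (hf : Measurable f) (hf0 : ∀ x, 0 < f x) :
    (InformationTheory.klDiv μ (stdGaussian E)).toReal = ∫ x, Real.log (f x) ∂μ := by
  have hac : μ ≪ stdGaussian E := hμ ▸ withDensity_absolutelyContinuous _ _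
  rw [InformationTheory.toReal_klDiv_of_measure_eq hac (by simp)]
  refine integral_congr_ae ?_
  filter_upwards [hac.ae_le (gaussianDensity_ae_eq hμ hf hf0)] with x hx
  rw [llr, ← hx]
  rfl

end SmoothDensity

/-! ### The deficit of a nondegenerate Gaussian measure -/

section GaussianDensity

variable {E : Type*} [NormedAddCommGroup E] [InnerProductSpace ℝ E] [FiniteDimensional ℝ E]
  [MeasurableSpace E] [BorelSpace E] {ι : Type*} [Fintype ι] (b : OrthonormalBasis ι ℝ E)

lemma integral_norm_sq_add_diagCLM (m : E) (s : ι → ℝ) :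
    ∫ x, ‖m + diagCLM b s x‖ ^ 2 ∂(stdGaussian E) = ‖m‖ ^ 2 + ∑ i, s i ^ 2 := by
  have hm : MemLp id 2 (stdGaussian E) := IsGaussian.memLp_two_id
  have hg : ∀ i, MemLp (fun x => inner ℝ (b i) x) 2 (stdGaussian E) := fun i => hm.const_inner _
  have h1 : ∀ i, ∫ x, inner ℝ (b i) x ∂(stdGaussian E) = 0 := fun i =>
    integral_strongDual_stdGaussian (innerSL ℝ (b i))
  have h2 : ∀ i, ∫ x, inner ℝ (b i) x ^ 2 ∂(stdGaussian E) = 1 := fun i => by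
    have h := variance_dual_stdGaussian (innerSL ℝ (b i))
    rw [innerSL_apply_norm, b.norm_eq_one, one_pow] at h
    have hv := variance_of_integral_eq_zero (X := fun x => inner ℝ (b i) x)
      (μ := stdGaussian E) (by fun_prop) (h1 i)
    exact hv.symm.trans h
  have hi : ∀ i, Integrable (fun x => (inner ℝ (b i) m * 1 + s i * inner ℝ (b i) x) ^ 2)
      (stdGaussian E) := fun i =>
    (((memLp_const (1 : ℝ)).const_mul _).add ((hg i).const_mul (s i))).integrable_sq
  have hpt : ∀ x, ‖m + diagCLM b s x‖ ^ 2
      = ∑ i, (inner ℝ (b i) m * 1 + s i * inner ℝ (b i) x) ^ 2 := fun x => by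
    rw [← b.sum_sq_inner_right]
    simp only [inner_add_right, inner_diagCLM, mul_one]
  simp only [hpt]
  rw [integral_finsetSum _ fun i _ => hi i, ← b.sum_sq_inner_right m, ← Finset.sum_add_distrib]
  refine Finset.sum_congr rfl fun i _ => ?_
  rw [integral_sq_add_mul (memLp_const (1 : ℝ)) (hg i), h2]
  simp [h1]

lemma contDiff_diagDensity (s : ι → ℝ) (m : E) : ContDiff ℝ 1 (diagDensity b s m) := by
  unfold diagDensity
  have h1 : ContDiff ℝ 1 fun x : E => ‖x‖ ^ 2 := contDiff_norm_sq ℝ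
  have h2 : ContDiff ℝ 1 fun x : E => ‖diagCLM b (fun i => (s i)⁻¹) (x - m)‖ ^ 2 :=
    ((diagCLM b fun i => (s i)⁻¹).contDiff.comp (contDiff_id.sub contDiff_const)).norm_sq ℝ
  exact contDiff_const.mul ((contDiff_const.mul h1).sub (contDiff_const.mul h2)).exp

lemma fderiv_diagDensity_apply (s : ι → ℝ) (m x v : E) :
    fderiv ℝ (diagDensity b s m) x v = inner ℝ (diagDensity b s m x • (x - diagCLM b
      (fun i => (s i)⁻¹) (diagCLM b (fun i => (s i)⁻¹) (x - m)))) v := by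
  set A := diagCLM b fun i => (s i)⁻¹ with hA
  have h1 : HasFDerivAt (fun x : E => ‖x‖ ^ 2) _ x := (hasFDerivAt_id x).norm_sq
  have h2 : HasFDerivAt (fun x : E => ‖A (x - m)‖ ^ 2) _ x :=
    (A.hasFDerivAt.comp x ((hasFDerivAt_id x).sub_const m)).norm_sq
  have h3 := (((h1.const_mul 2⁻¹).sub (h2.const_mul 2⁻¹)).exp).const_mul (∏ i, s i)⁻¹
  rw [HasFDerivAt.fderiv (f := diagDensity b s m) h3, inner_smul_left, inner_sub_left, hA,
    inner_diagCLM_comm]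
  simp [diagDensity, ← hA, inner_sub_left]
  ring

variable {s : ι → ℝ}

/-- At the point m + Sx the score is m + (S - S⁻¹)x, so the information is a second moment of the
standard Gaussian. -/
lemma fisherInfo_map_diagCLM_le (hs : ∀ i, 0 < s i) (m : E) :
    fisherInfo ((stdGaussian E).map fun x => m + diagCLM b s x)
      ≤ ENNReal.ofReal (‖m‖ ^ 2 + ∑ i, (s i - (s i)⁻¹) ^ 2) := by
  have hcd := contDiff_diagDensity b s m
  set A := diagCLM b fun i => (s i)⁻¹ with hA
  have hG : Continuous fun x => diagDensity b s m x • (x - A (A (x - m))) :=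
    hcd.continuous.smul (by fun_prop)
  refine (fisherInfo_le_of_contDiff (map_stdGaussian_diagCLM b hs m) hcd
    (diagDensity_pos b hs m) hG (fderiv_diagDensity_apply b s m)).trans_eq ?_
  have hinv : ∀ x (y : E), (diagDensity b s m x)⁻¹ • diagDensity b s m x • y = y := fun x =>
    inv_smul_smul₀ (diagDensity_pos b hs m x).ne'
  simp only [hinv]
  rw [lintegral_map (by fun_prop) (by fun_prop), ← integral_norm_sq_add_diagCLM b,
    ofReal_integral_eq_lintegral_ofReal _ (.of_forall fun x => sq_nonneg _)]
  · refine lintegral_congr fun x => ?_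
    have hx : m + diagCLM b s x - A (A (m + diagCLM b s x - m))
        = m + diagCLM b (fun i => s i - (s i)⁻¹) x := by
      have h1 : A (diagCLM b s x) = x :=
        diagCLM_diagCLM b (fun i => inv_mul_cancel₀ (hs i).ne') x
      rw [add_sub_cancel_left, h1, add_sub_assoc, hA]
      simp only [diagCLM_apply, ← Finset.sum_sub_distrib, ← sub_smul, sub_mul]
    rw [hx, ENNReal.ofReal_pow (norm_nonneg _), ofReal_norm]
  · have hm : MemLp id 2 (stdGaussian E) := IsGaussian.memLp_two_id
    have h2 : MemLp (fun x => m + diagCLM b (fun i => s i - (s i)⁻¹) x) 2 (stdGaussian E) :=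
      (memLp_const m).add ((diagCLM b _).comp_memLp' hm)
    exact h2.integrable_norm_pow two_ne_zero

lemma toReal_klDiv_map_diagCLM (hs : ∀ i, 0 < s i) (m : E) :
    (InformationTheory.klDiv ((stdGaussian E).map fun x => m + diagCLM b s x)
      (stdGaussian E)).toReal
      = 2⁻¹ * (‖m‖ ^ 2 + ∑ i, s i ^ 2) - 2⁻¹ * Fintype.card ι - ∑ i, Real.log (s i) := by
  have hP : 0 < ∏ i, s i := Finset.prod_pos fun i _ => hs i
  have hmeas : AEMeasurable (fun x => m + diagCLM b s x) (stdGaussian E) := by fun_prop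
  have hd : Measurable (diagDensity b s m) := (contDiff_diagDensity b s m).continuous.measurable
  have := Measure.isProbabilityMeasure_map hmeas
  rw [toReal_klDiv_eq_integral_log (map_stdGaussian_diagCLM b hs m) hd (diagDensity_pos b hs m),
    integral_map hmeas hd.log.aestronglyMeasurable]
  -- The term ‖x‖² is written with zero mean and unit weights so that `integral_norm_sq_add_diagCLM`
  -- evaluates both squares.
  have hpt : ∀ x, Real.log (diagDensity b s m (m + diagCLM b s x))
      = 2⁻¹ * ‖m + diagCLM b s x‖ ^ 2 - 2⁻¹ * ‖0 + diagCLM b (fun _ => 1) x‖ ^ 2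
        - ∑ i, Real.log (s i) := fun x => by
    have h1 : diagCLM b (fun i => (s i)⁻¹) (diagCLM b s x) = x :=
      diagCLM_diagCLM b (fun i => inv_mul_cancel₀ (hs i).ne') x
    have h2 : diagCLM b (fun _ => (1 : ℝ)) x = x := by
      rw [diagCLM_apply]; simpa using b.sum_repr' x
    rw [diagDensity, Real.log_mul (inv_pos.2 hP).ne' (Real.exp_pos _).ne', Real.log_exp,
      Real.log_inv, Real.log_prod fun i _ => (hs i).ne', add_sub_cancel_left, h1, zero_add, h2]
    ring
  have hm : MemLp id 2 (stdGaussian E) := IsGaussian.memLp_two_id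
  have hi : ∀ (m : E) (s : ι → ℝ), Integrable (fun x => 2⁻¹ * ‖m + diagCLM b s x‖ ^ 2)
      (stdGaussian E) := fun m s => by
    have h2 : MemLp (fun x => m + diagCLM b s x) 2 (stdGaussian E) :=
      (memLp_const m).add ((diagCLM b _).comp_memLp' hm)
    exact (h2.integrable_norm_pow two_ne_zero).const_mul _
  have hi2 : Integrable (fun x => 2⁻¹ * ‖m + diagCLM b s x‖ ^ 2
    - 2⁻¹ * ‖0 + diagCLM b (fun _ => 1) x‖ ^ 2) (stdGaussian E) := (hi m s).sub (hi 0 _)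
  simp only [hpt]
  rw [integral_sub hi2 (integrable_const _), integral_sub (hi m s) (hi 0 _), integral_const_mul,
    integral_const_mul, integral_norm_sq_add_diagCLM, integral_norm_sq_add_diagCLM]
  simp

/-- The deficit of a nondegenerate Gaussian measure. -/
lemma deficit_map_diagCLM_le (hs : ∀ i, 0 < s i) (m : E) :
    deficit ((stdGaussian E).map fun x => m + diagCLM b s x)
      ≤ ((1 / 2 * ∑ i, ((s i ^ 2)⁻¹ - 1 + Real.log (s i ^ 2)) : ℝ) : EReal) := by
  have hmeas : AEMeasurable (fun x => m + diagCLM b s x) (stdGaussian E) := by fun_prop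
  have := Measure.isProbabilityMeasure_map hmeas
  have hle := fisherInfo_map_diagCLM_le b hs m
  have hI := ne_top_of_le_ne_top ENNReal.ofReal_ne_top hle
  have hm : MemLp id 2 ((stdGaussian E).map fun x => m + diagCLM b s x) := by
    rw [memLp_map_measure_iff (by fun_prop) hmeas]
    have hm : MemLp id 2 (stdGaussian E) := IsGaussian.memLp_two_id
    exact (memLp_const m).add ((diagCLM b _).comp_memLp' hm)
  have h := ENNReal.toReal_mono ENNReal.ofReal_ne_top hle
  rw [ENNReal.toReal_ofReal (by positivity)] at h
  rw [deficit_eq_coe hm hI, EReal.coe_le_coe_iff, toReal_klDiv_map_diagCLM b hs]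
  have hsq : ∀ i, (s i - (s i)⁻¹) ^ 2 = s i ^ 2 - 2 + (s i ^ 2)⁻¹ := fun i => by
    have := (hs i).ne'
    field_simp
    ring
  simp only [hsq, Finset.sum_add_distrib, Finset.sum_sub_distrib, Finset.sum_const,
    Finset.card_univ, nsmul_eq_mul, Real.log_pow, ← Finset.mul_sum] at h ⊢
  push_cast
  linarith

end GaussianDensity

/-! ### Gaussian measures attain equality -/

section Gaussian

variable {n : ℕ} {ν : Measure (EuclideanSpace ℝ (Fin n))}

/-- A Gaussian measure is the image of the standard one under an affine map which is diagonal in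
the eigenbasis of the covariance matrix. -/
lemma eq_map_stdGaussian (hν : IsGaussian ν) :
    ν = (stdGaussian (EuclideanSpace ℝ (Fin n))).map fun x =>
      (∫ x, id x ∂ν) + diagCLM (covBasis ν) (fun i => √(covEigenvalues ν i)) x := by
  have hm : MemLp id 2 ν := IsGaussian.memLp_two_id
  set m := ∫ x, id x ∂ν with hmdef
  set b := covBasis ν with hb
  set S := diagCLM b fun i => √(covEigenvalues ν i) with hS
  have hmeas : AEMeasurable (fun x => m + S x) (stdGaussian (EuclideanSpace ℝ (Fin n))) := by
    fun_prop
  have := Measure.isProbabilityMeasure_map hmeas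
  refine Measure.ext_of_charFun (funext fun t => ?_)
  have hcov : covarianceBilin ν t t = ‖S t‖ ^ 2 := by
    have hbb : ∀ i j, covarianceBilin ν (b i) (b j) = if i = j then covEigenvalues ν j else 0 :=
      fun i j => by rw [covarianceBilin_apply_eq_cov hm, hb, covariance_covBasis hm]
    rw [norm_sq_diagCLM]
    conv_lhs => rw [← b.sum_repr' t]
    simp only [map_sum, map_smul, sum_apply, smul_apply, hbb, smul_eq_mul,
      mul_ite, mul_zero, Finset.sum_ite_eq', Finset.mem_univ, if_true]
    refine Finset.sum_congr rfl fun i _ => ?_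
    rw [Real.sq_sqrt (covEigenvalues_nonneg hm i)]
    ring
  have hSt := charFun_stdGaussian (S t)
  rw [charFun_apply] at hSt
  rw [IsGaussian.charFun_eq', hcov, charFun_apply, integral_map hmeas (by fun_prop)]
  have hpt : ∀ x, Complex.exp (inner ℝ (m + S x) t * Complex.I)
      = Complex.exp (inner ℝ t m * Complex.I) * Complex.exp (inner ℝ x (S t) * Complex.I) :=
    fun x => by
      rw [inner_add_left, hS, inner_diagCLM_comm, real_inner_comm, ← Complex.exp_add]
      push_cast
      ring_nf
  simp only [hpt]
  rw [integral_const_mul, hSt, ← Complex.exp_add]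
  congr 1
  push_cast
  ring

lemma eigenTerm_nonneg {l : ℝ} (hl : 0 ≤ l) : 0 ≤ eigenTerm l := by
  rw [eigenTerm]
  split_ifs with h
  · exact le_top
  · exact_mod_cast inv_sub_one_add_log_nonneg (lt_of_le_of_ne hl (Ne.symm h))

/-- A zero eigenvalue makes the right side ⊤; otherwise ν is an invertible affine image of the
standard Gaussian and the explicit computation applies. -/
lemma deficit_le_of_isGaussian (hν : IsGaussian ν) :
    deficit ν ≤ ((1 / 2 : ℝ) : EReal) * ∑ i, eigenTerm (covEigenvalues ν i) := by
  have hm : MemLp id 2 ν := IsGaussian.memLp_two_id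
  have hl := covEigenvalues_nonneg hm
  by_cases h0 : ∃ i, covEigenvalues ν i = 0
  · obtain ⟨i, hi⟩ := h0
    have h1 : (⊤ : EReal) ≤ ∑ i, eigenTerm (covEigenvalues ν i) := by
      have := Finset.single_le_sum (f := fun i => eigenTerm (covEigenvalues ν i))
        (fun j _ => eigenTerm_nonneg (hl j)) (Finset.mem_univ i)
      simpa [eigenTerm, hi] using this
    rw [top_le_iff.1 h1, EReal.coe_mul_top_of_pos (by norm_num)]
    exact le_top
  · push Not at h0
    have hs : ∀ i, 0 < √(covEigenvalues ν i) := fun i =>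
      Real.sqrt_pos.2 (lt_of_le_of_ne (hl i) (Ne.symm (h0 i)))
    have h := deficit_map_diagCLM_le (covBasis ν) hs (∫ x, id x ∂ν)
    rw [← eq_map_stdGaussian hν] at h
    refine h.trans_eq ?_
    rw [EReal.coe_mul, EReal.coe_finsetSum]
    congr 1
    refine Finset.sum_congr rfl fun i _ => ?_
    rw [Real.sq_sqrt (hl i), eigenTerm, if_neg (h0 i)]

lemma covEigenvalues_congr {μ : Measure (EuclideanSpace ℝ (Fin n))}
    (h : covMatrix ν = covMatrix μ) : covEigenvalues ν = covEigenvalues μ := by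
  have key : ∀ (A B : Matrix (Fin n) (Fin n) ℝ) (hA : A.IsHermitian) (hB : B.IsHermitian),
      A = B → hA.eigenvalues = hB.eigenvalues := by
    rintro A _ hA hB rfl
    rfl
  exact key _ _ _ _ h

/-- The deficit of a Gaussian measure whose covariance is at most the identity. -/
lemma deficit_eq_of_isGaussian (hν : IsGaussian ν) (h : (1 - covMatrix ν).PosSemidef) :
    ((1 / 2 : ℝ) : EReal) * ∑ i, eigenTerm (covEigenvalues ν i) = deficit ν := by
  -- The reverse inequality is the general deficit bound applied to ν, so the explicit computation
  -- is needed in one direction only.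
  refine le_antisymm ?_ (deficit_le_of_isGaussian hν)
  have hm : MemLp id 2 ν := IsGaussian.memLp_two_id
  rw [← sum_eigenTerm_of_le_one h]
  exact sum_eigenTerm_le_deficit (covBasis ν) hm (covEigenvalues_eq_variance hm)

lemma exists_isGaussian_covMatrix_eq {C : Matrix (Fin n) (Fin n) ℝ} (hC : C.PosSemidef) :
    ∃ ν : Measure (EuclideanSpace ℝ (Fin n)), IsGaussian ν ∧ covMatrix ν = C := by
  refine ⟨multivariateGaussian 0 C, inferInstance, ?_⟩
  ext i j
  rw [covMatrix, Matrix.of_apply, covariance_eval_multivariateGaussian hC]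

end Gaussian

/-! ### Gaussian mixtures with large variance and small deficit -/

section Mixture

lemma gaussianReal_zero_one_eq_stdGaussian : gaussianReal 0 1 = stdGaussian ℝ := by
  refine Measure.ext_of_charFun (funext fun t => ?_)
  rw [charFun_stdGaussian, charFun_gaussianReal]
  have h : ((‖t‖ : ℝ) : ℂ) ^ 2 = (t : ℂ) ^ 2 := by
    rw [← Complex.ofReal_pow, Real.norm_eq_abs, sq_abs, Complex.ofReal_pow]
  rw [h]
  congr 1
  simp [neg_div]

lemma gaussianReal_one_eq_withDensity (a : ℝ) : gaussianReal a 1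
    = (stdGaussian ℝ).withDensity fun x => ENNReal.ofReal (Real.exp (a * x - a ^ 2 / 2)) := by
  rw [← gaussianReal_zero_one_eq_stdGaussian, gaussianReal_of_var_ne_zero _ one_ne_zero,
    gaussianReal_of_var_ne_zero _ one_ne_zero, ← withDensity_mul _ (measurable_gaussianPDF 0 1)
      (by fun_prop)]
  congr 1
  funext x
  rw [Pi.mul_apply, gaussianPDF, gaussianPDF, ← ENNReal.ofReal_mul (gaussianPDFReal_nonneg 0 1 x)]
  congr 1
  rw [gaussianPDFReal, gaussianPDFReal, mul_assoc (√(2 * Real.pi * _))⁻¹, ← Real.exp_add]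
  congr 2
  simp
  ring

/-- The mixture `(1 - ε) N(0, 1) + ε N(a, 1)`. -/
def gaussianMixture (ε : ℝ≥0) (a : ℝ) : Measure ℝ :=
  (1 - ε) • gaussianReal 0 1 + ε • gaussianReal a 1

variable {ε : ℝ≥0} {a : ℝ}

lemma isGaussianMixture_gaussianMixture (hε : ε ≤ 1) (a : ℝ) :
    IsGaussianMixture (gaussianMixture ε a) := by
  refine ⟨2, ![1 - ε, ε], ![0, a], ![1, 1], ?_, ?_, ?_⟩
  · simpa using tsub_add_cancel_of_le hε
  · simp [Fin.forall_fin_two]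
  · simp [gaussianMixture]

lemma isProbabilityMeasure_gaussianMixture (hε : ε ≤ 1) (a : ℝ) :
    IsProbabilityMeasure (gaussianMixture ε a) := by
  refine ⟨?_⟩
  simp only [gaussianMixture, Measure.add_apply, Measure.smul_apply, measure_univ]
  have h : (1 - ε) + ε = 1 := tsub_add_cancel_of_le hε
  rw [ENNReal.smul_def, ENNReal.smul_def, smul_eq_mul, smul_eq_mul, mul_one, mul_one,
    ← ENNReal.coe_add, h, ENNReal.coe_one]

lemma integrable_gaussianMixture {g : ℝ → ℝ} (h0 : Integrable g (gaussianReal 0 1))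
    (ha : Integrable g (gaussianReal a 1)) : Integrable g (gaussianMixture ε a) :=
  (h0.smul_measure_nnreal).add_measure ha.smul_measure_nnreal

lemma integral_gaussianMixture (hε : ε ≤ 1) {g : ℝ → ℝ} (h0 : Integrable g (gaussianReal 0 1))
    (ha : Integrable g (gaussianReal a 1)) :
    ∫ x, g x ∂(gaussianMixture ε a)
      = (1 - ε) * ∫ x, g x ∂(gaussianReal 0 1) + ε * ∫ x, g x ∂(gaussianReal a 1) := by
  rw [gaussianMixture, integral_add_measure h0.smul_measure_nnreal ha.smul_measure_nnreal,
    integral_smul_nnreal_measure, integral_smul_nnreal_measure, NNReal.smul_def, NNReal.smul_def,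
    NNReal.coe_sub hε]
  rfl

lemma memLp_id_gaussianMixture : MemLp id 2 (gaussianMixture ε a) := by
  have h : ∀ a, Integrable (fun x : ℝ => id x ^ 2) (gaussianReal a 1) := fun a =>
    MemLp.integrable_sq IsGaussian.memLp_two_id
  exact (memLp_two_iff_integrable_sq aestronglyMeasurable_id).2
    (integrable_gaussianMixture (h 0) (h a))

lemma variance_gaussianMixture (hε : ε ≤ 1) (a : ℝ) :
    Var[id; gaussianMixture ε a] = 1 + ε * (1 - ε) * a ^ 2 := by
  have := isProbabilityMeasure_gaussianMixture hε a
  have hi : ∀ a, Integrable (fun x : ℝ => x) (gaussianReal a 1) := fun a =>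
    IsGaussian.integrable_id
  have h : ∀ a, MemLp (id : ℝ → ℝ) 2 (gaussianReal a 1) := fun a => IsGaussian.memLp_two_id
  have hi2 : ∀ a, Integrable (fun x : ℝ => x ^ 2) (gaussianReal a 1) := fun a =>
    (h a).integrable_sq
  have h2 : ∀ a, ∫ x, x ^ 2 ∂(gaussianReal a 1) = 1 + a ^ 2 := fun a => by
    have h1 := variance_eq_sub (h a)
    rw [variance_id_gaussianReal] at h1
    simp only [Pi.pow_apply, id, integral_id_gaussianReal] at h1
    simp only [NNReal.coe_one] at h1
    linarith
  rw [variance_eq_sub memLp_id_gaussianMixture]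
  simp only [Pi.pow_apply, id]
  rw [integral_gaussianMixture hε (hi 0) (hi a), integral_gaussianMixture hε (hi2 0) (hi2 a), h2,
    h2, integral_id_gaussianReal, integral_id_gaussianReal]
  ring

/-- The density of `gaussianMixture ε a` with respect to the standard Gaussian measure. -/
def mixtureDensity (ε : ℝ≥0) (a x : ℝ) : ℝ := (1 - ε) + ε * Real.exp (a * x - a ^ 2 / 2)

lemma mixtureDensity_pos (hε : ε < 1) (a x : ℝ) : 0 < mixtureDensity ε a x := by
  have h1 : (ε : ℝ) < 1 := by exact_mod_cast hε
  have : 0 ≤ ε * Real.exp (a * x - a ^ 2 / 2) := by positivity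
  unfold mixtureDensity
  linarith

lemma contDiff_mixtureDensity (ε : ℝ≥0) (a : ℝ) : ContDiff ℝ 1 (mixtureDensity ε a) := by
  unfold mixtureDensity
  fun_prop

lemma gaussianMixture_eq_withDensity (hε : ε ≤ 1) (a : ℝ) : gaussianMixture ε a
    = (stdGaussian ℝ).withDensity fun x => ENNReal.ofReal (mixtureDensity ε a x) := by
  have hd : (fun x => ENNReal.ofReal (mixtureDensity ε a x))
      = (fun _ => ((1 - ε : ℝ≥0) : ℝ≥0∞)) + (ε : ℝ≥0∞) •
        fun x => ENNReal.ofReal (Real.exp (a * x - a ^ 2 / 2)) := by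
    funext x
    have h1 : ((1 - ε : ℝ≥0) : ℝ) = 1 - ε := NNReal.coe_sub hε
    rw [mixtureDensity, ← h1, ENNReal.ofReal_add (NNReal.coe_nonneg _) (by positivity),
      ENNReal.ofReal_mul (NNReal.coe_nonneg _), ENNReal.ofReal_coe_nnreal,
      ENNReal.ofReal_coe_nnreal]
    rfl
  rw [hd, withDensity_add_left measurable_const, withDensity_const,
    withDensity_smul _ (by fun_prop), ← gaussianReal_one_eq_withDensity,
    ← gaussianReal_zero_one_eq_stdGaussian]
  rfl

/-- With e the density of N(a, 1) relative to γ, the mixture density f satisfies f' = a ε e and ε e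
≤ f. Hence f'² / f ≤ ε a² e, and e integrates to 1. -/
lemma fisherInfo_gaussianMixture_le (hε : ε < 1) (a : ℝ) :
    fisherInfo (gaussianMixture ε a) ≤ ENNReal.ofReal (ε * a ^ 2) := by
  have hμ := gaussianMixture_eq_withDensity hε.le a
  have hcd := contDiff_mixtureDensity ε a
  have hpos := mixtureDensity_pos hε a
  set e : ℝ → ℝ := fun x => Real.exp (a * x - a ^ 2 / 2) with he
  have hfG : ∀ x v, fderiv ℝ (mixtureDensity ε a) x v = inner ℝ (ε * (e x * a)) v := fun x v => by
    have h1 : HasDerivAt (mixtureDensity ε a) (ε * (e x * (a * 1))) x :=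
      (((((hasDerivAt_id x).const_mul a).sub_const (a ^ 2 / 2)).exp).const_mul (ε : ℝ)).const_add _
    rw [h1.hasFDerivAt.fderiv]
    simp
  refine (fisherInfo_le_of_contDiff hμ hcd hpos (by fun_prop) hfG).trans ?_
  have hm : Measurable fun x => ‖(mixtureDensity ε a x)⁻¹ • (ε * (e x * a))‖ₑ ^ 2 := by
    have := hcd.continuous.measurable
    fun_prop
  rw [hμ, lintegral_withDensity_eq_lintegral_mul _ hcd.continuous.measurable.ennreal_ofReal hm]
  calc _ ≤ ∫⁻ x, ENNReal.ofReal (ε * a ^ 2) * ENNReal.ofReal (e x) ∂(stdGaussian ℝ) := by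
        refine lintegral_mono fun x => ?_
        have hw := hpos x
        have hwe : ε * e x ≤ mixtureDensity ε a x := by
          have h1 : (ε : ℝ) < 1 := by exact_mod_cast hε
          simp only [mixtureDensity, he]
          linarith
        have he0 : 0 ≤ ε * e x := by positivity
        rw [Pi.mul_apply, ← ofReal_norm, ← ENNReal.ofReal_pow (norm_nonneg _),
          ← ENNReal.ofReal_mul hw.le, ← ENNReal.ofReal_mul (by positivity)]
        refine ENNReal.ofReal_le_ofReal ?_
        rw [Real.norm_eq_abs, sq_abs, smul_eq_mul]
        have h2 : mixtureDensity ε a x * ((mixtureDensity ε a x)⁻¹ * (ε * (e x * a))) ^ 2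
            = (mixtureDensity ε a x)⁻¹ * (ε * e x) * (ε * e x * a ^ 2) := by
          field_simp
        rw [h2]
        have h3 : (mixtureDensity ε a x)⁻¹ * (ε * e x) ≤ 1 := by
          rw [inv_mul_le_iff₀ hw]; linarith
        calc _ ≤ 1 * (ε * e x * a ^ 2) := by gcongr
          _ = _ := by ring
    _ = ENNReal.ofReal (ε * a ^ 2) * gaussianReal a 1 Set.univ := by
        rw [lintegral_const_mul _ (by fun_prop), gaussianReal_one_eq_withDensity,
          withDensity_apply _ MeasurableSet.univ, Measure.restrict_univ]
    _ = _ := by rw [measure_univ, mul_one]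

/-- Keep a single component inside the logarithm: log f ≥ log(1 - ε) is integrated under N(0, 1),
and log f ≥ log ε + ax - a² / 2 under N(a, 1), where ax - a² / 2 has mean a² / 2. -/
lemma le_toReal_klDiv_gaussianMixture (hε0 : 0 < ε) (hε : ε < 1) (a : ℝ) :
    ε * a ^ 2 / 2 - Real.binEntropy ε
      ≤ (InformationTheory.klDiv (gaussianMixture ε a) (stdGaussian ℝ)).toReal := by
  have hcd := contDiff_mixtureDensity ε a
  have := isProbabilityMeasure_gaussianMixture hε.le a
  have h0 : (0 : ℝ) < ε := by exact_mod_cast hε0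
  have h1 : (0 : ℝ) < 1 - ε := by
    have : (ε : ℝ) < 1 := by exact_mod_cast hε
    linarith
  have hpos := mixtureDensity_pos hε a
  rw [toReal_klDiv_eq_integral_log (gaussianMixture_eq_withDensity hε.le a)
    hcd.continuous.measurable hpos]
  have hid : ∀ c, Integrable (fun x : ℝ => x) (gaussianReal c 1) := fun c =>
    IsGaussian.integrable_id
  have hlin : ∀ c, Integrable (fun x : ℝ => a * x - a ^ 2 / 2) (gaussianReal c 1) := fun c =>
    ((hid c).const_mul a).sub (integrable_const _)
  have hlow1 : ∀ x, Real.log (1 - ε) ≤ Real.log (mixtureDensity ε a x) := fun x => by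
    refine Real.log_le_log h1 ?_
    have : 0 ≤ ε * Real.exp (a * x - a ^ 2 / 2) := by positivity
    rw [mixtureDensity]; linarith
  have hlow2 : ∀ x, Real.log ε + (a * x - a ^ 2 / 2) ≤ Real.log (mixtureDensity ε a x) :=
    fun x => by
      rw [← Real.log_exp (a * x - a ^ 2 / 2), ← Real.log_mul h0.ne' (Real.exp_pos _).ne']
      refine Real.log_le_log (by positivity) ?_
      rw [mixtureDensity]; linarith
  have hup : ∀ x, Real.log (mixtureDensity ε a x) ≤ |a * x - a ^ 2 / 2| := fun x => by
    rw [Real.log_le_iff_le_exp (hpos x)]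
    have h2 : Real.exp (a * x - a ^ 2 / 2) ≤ Real.exp |a * x - a ^ 2 / 2| :=
      Real.exp_le_exp.2 (le_abs_self _)
    have h3 : 1 ≤ Real.exp |a * x - a ^ 2 / 2| := Real.one_le_exp (abs_nonneg _)
    rw [mixtureDensity]
    nlinarith
  have hi : ∀ c, Integrable (fun x => Real.log (mixtureDensity ε a x)) (gaussianReal c 1) :=
    fun c => by
      refine ((integrable_const |Real.log (1 - ε)|).add (hlin c).abs).mono'
        hcd.continuous.measurable.log.aestronglyMeasurable (.of_forall fun x => ?_)
      rw [Pi.add_apply, Real.norm_eq_abs, abs_le]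
      have h2 := neg_abs_le (Real.log (1 - ε))
      have h3 := abs_nonneg (Real.log (1 - ε))
      have h4 := abs_nonneg (a * x - a ^ 2 / 2)
      exact ⟨by linarith [hlow1 x], by linarith [hup x]⟩
  rw [integral_gaussianMixture hε.le (hi 0) (hi a)]
  have hA : Real.log (1 - ε) ≤ ∫ x, Real.log (mixtureDensity ε a x) ∂(gaussianReal 0 1) := by
    have := integral_mono (μ := gaussianReal 0 1) (integrable_const _) (hi 0) hlow1
    simpa using this
  have hB : Real.log ε + a ^ 2 / 2
      ≤ ∫ x, Real.log (mixtureDensity ε a x) ∂(gaussianReal a 1) := by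
    have h2 : Integrable (fun x : ℝ => Real.log ε + (a * x - a ^ 2 / 2)) (gaussianReal a 1) :=
      (integrable_const _).add (hlin a)
    have h3 := integral_mono h2 (hi a) hlow2
    rw [integral_add (integrable_const _) (hlin a), integral_sub ((hid a).const_mul a)
      (integrable_const _), integral_const_mul, integral_id_gaussianReal] at h3
    simp only [integral_const, probReal_univ, one_smul] at h3
    linarith
  have hA' := mul_le_mul_of_nonneg_left hA h1.le
  have hB' := mul_le_mul_of_nonneg_left hB h0.le
  rw [Real.binEntropy, Real.log_inv, Real.log_inv]
  linarith

/-- The terms ε a² / 2 in the two preceding bounds cancel, which leaves a bound independent of a. -/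
lemma deficit_gaussianMixture_le (hε0 : 0 < ε) (hε : ε < 1) (a : ℝ) :
    deficit (gaussianMixture ε a) ≤ ((Real.binEntropy ε : ℝ) : EReal) := by
  have := isProbabilityMeasure_gaussianMixture hε.le a
  have hle := fisherInfo_gaussianMixture_le hε a
  have hI := ne_top_of_le_ne_top ENNReal.ofReal_ne_top hle
  have h := ENNReal.toReal_mono ENNReal.ofReal_ne_top hle
  rw [ENNReal.toReal_ofReal (by positivity)] at h
  rw [deficit_eq_coe memLp_id_gaussianMixture hI, EReal.coe_le_coe_iff]
  linarith [le_toReal_klDiv_gaussianMixture hε0 hε a]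

theorem exists_gaussianMixture_deficit_lt :
    ∃ μ : ℕ → Measure ℝ, (∀ k, IsGaussianMixture (μ k)) ∧
      Tendsto (fun k => Var[id; μ k]) atTop atTop ∧
      Tendsto (fun k => deficit (μ k)) atTop (𝓝 0) ∧
      ∀ᶠ k in atTop, deficit (μ k) < ((1 / 2 : ℝ) : EReal) * eigenTerm Var[id; μ k] := by
  -- With a = k + 2 = 1 / ε the variance 1 + ε(1 - ε)a² is exactly k + 2, while ε → 0. The offset 2
  -- keeps ε below 1 from k = 0 on.
  set ε : ℕ → ℝ≥0 := fun k => ((k : ℝ≥0) + 2)⁻¹ with hεdef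
  have hε0 : ∀ k, 0 < ε k := fun k => by positivity
  have hε1 : ∀ k, ε k < 1 := fun k => inv_lt_one_of_one_lt₀ <|
    one_lt_two.trans_le (le_add_of_nonneg_left (Nat.cast_nonneg k))
  have hvar : ∀ k : ℕ, Var[id; gaussianMixture (ε k) (k + 2)] = (k : ℝ) + 2 := fun k => by
    rw [variance_gaussianMixture (hε1 k).le]
    have h : (k : ℝ) + 2 ≠ 0 := by positivity
    simp only [hεdef]
    push_cast
    field_simp
    ring
  have hεlim : Tendsto (fun k => (ε k : ℝ)) atTop (𝓝 0) := by
    simp only [hεdef]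
    push_cast
    exact tendsto_inv_atTop_zero.comp
      (tendsto_atTop_add_const_right _ _ tendsto_natCast_atTop_atTop)
  have hvarlim : Tendsto (fun k : ℕ => (k : ℝ) + 2) atTop atTop :=
    tendsto_atTop_add_const_right _ _ tendsto_natCast_atTop_atTop
  have hδ : Tendsto (fun k : ℕ => deficit (gaussianMixture (ε k) (k + 2))) atTop (𝓝 0) := by
    have hent : Tendsto (fun k => ((Real.binEntropy (ε k) : ℝ) : EReal)) atTop (𝓝 0) := by
      have h1 := (Real.binEntropy_continuous.tendsto 0).comp hεlim
      rw [Real.binEntropy_zero] at h1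
      exact (continuous_coe_real_ereal.tendsto 0).comp h1
    refine tendsto_of_tendsto_of_tendsto_of_le_of_le tendsto_const_nhds hent (fun k => ?_)
      fun k => deficit_gaussianMixture_le (hε0 k) (hε1 k) _
    have := isProbabilityMeasure_gaussianMixture (hε1 k).le ((k : ℝ) + 2)
    exact deficit_nonneg memLp_id_gaussianMixture
  refine ⟨fun k => gaussianMixture (ε k) (k + 2),
    fun k => isGaussianMixture_gaussianMixture (hε1 k).le _, ?_, hδ, ?_⟩
  · simpa only [hvar] using hvarlim
  · have hone : (0 : EReal) < 1 := zero_lt_one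
    -- Once log(k + 2) ≥ 3, half of the eigenvalue term is at least 1, and the deficit is eventually
    -- below 1.
    filter_upwards [hδ.eventually (gt_mem_nhds hone),
      (Real.tendsto_log_atTop.comp hvarlim).eventually (eventually_ge_atTop 3)] with k hk hk2
    refine hk.trans_le ?_
    have hpos : (0 : ℝ) < (k : ℝ) + 2 := by positivity
    rw [hvar, eigenTerm, if_neg hpos.ne', ← EReal.coe_mul, ← EReal.coe_one, EReal.coe_le_coe_iff]
    have h1 : 0 < ((k : ℝ) + 2)⁻¹ := inv_pos.2 hpos
    simp only [Function.comp] at hk2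
    linarith

end Mixture

end LogSobolev

end

/-! ### Assembly of the bound, the Gaussian equality and the counterexample -/

theorem theorem1p3 :
    (∀ (n : ℕ) (μ : Measure (EuclideanSpace ℝ (Fin n))), IsProbabilityMeasure μ → MemLp id 2 μ →
      ((1 / 2 : ℝ) : EReal) *
          (∑ i, if covEigenvalues μ i < 1 then eigenTerm (covEigenvalues μ i) else 0)
        ≤ deficit μ ∧
      ((1 - covMatrix μ).PosSemidef →
        ((1 / 2 : ℝ) : EReal) * (∑ i, eigenTerm (covEigenvalues μ i)) ≤ deficit μ ∧
        (∃ ν : Measure (EuclideanSpace ℝ (Fin n)), IsGaussian ν ∧ covMatrix ν = covMatrix μ) ∧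
        (∀ ν : Measure (EuclideanSpace ℝ (Fin n)), IsGaussian ν → covMatrix ν = covMatrix μ →
          ((1 / 2 : ℝ) : EReal) * (∑ i, eigenTerm (covEigenvalues μ i)) = deficit ν))) ∧
    (∃ μ : ℕ → Measure ℝ, (∀ k, IsGaussianMixture (μ k)) ∧
      Tendsto (fun k => Var[id; μ k]) atTop atTop ∧
      Tendsto (fun k => deficit (μ k)) atTop (𝓝 0) ∧
      ∀ᶠ k in atTop, deficit (μ k) < ((1 / 2 : ℝ) : EReal) * eigenTerm Var[id; μ k]) := by
  refine ⟨fun n μ hμ hm => ?_, exists_gaussianMixture_deficit_lt⟩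
  have hle := sum_eigenTerm_le_deficit (covBasis μ) hm (covEigenvalues_eq_variance hm)
  refine ⟨hle, fun hC => ⟨?_, exists_isGaussian_covMatrix_eq (posSemidef_covMatrix hm),
    fun ν hν hcov => ?_⟩⟩
  · rwa [sum_eigenTerm_of_le_one hC] at hle
  · rw [← covEigenvalues_congr hcov]
    exact deficit_eq_of_isGaussian hν (hcov ▸ hC)
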